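/- **Definitions.** A category is *cartesian* if it has all finite limits. A colimit cone $(D(I)\to Z)_I$ is *stable under pullback* if for every map $Z'\to Z$ the cone $(D(I)\times_Z Z'\to Z')_I$ is again a colimit cone. A *nested sequence* is a functor $A_0\to A_1\to\cdots$ out of the ordered set $\omega$ that sends every morphism to a monomorphism. A category $\mathcal E$ is *suitable* if - $\mathcal E$ is cartesian; - $\mathcal E$ has finite coproducts, these have monic coprojections, are stable under pullback, and are disjoint: for all $A,B$ the square formed by $0\to A$, $0\to B$ and the coprojections $A\to A+B\leftarrow B$ is a pullback; - $\mathcal E$ has colimits of nested sequences, these commute with pullbacks, and they have monic coprojections. A monad $T=(T,\eta,\mu)$ on $\mathcal E$ is *cartesian* if $T$ preserves pullbacks and all naturality squares of $\eta$ and $\mu$ are pullbacks; it is *suitable* if it is cartesian and $T$ preserves colimits of nested sequences. The pair $(\mathcal E,T)$ is *suitable* if $\mathcal E$ and $T$ are. A *$T$-graph* is a diagram $TC_0\xleftarrow{d}C_1\xrightarrow{c}C_0$ in $\mathcal E$; a map of $T$-graphs is a pair $(f_0,f_1)$ commuting with $d$ and $c$. A *$T$-multicategory* is a $T$-graph together with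 the structure of a monad on $C_0$ in the bicategory of spans $TR\leftarrow M\to S$, where the composite of $TR\leftarrow M\to S$ and $TS\leftarrow N\to Q$ is $TM\times_{TS}N$, with left leg $TM\times_{TS}N\to TM\to T^2R\xrightarrow{\mu_R}TR$, and the identity on $S$ is $TS\xleftarrow{\eta_S}S\xrightarrow{1}S$. Maps of $T$-multicategories are the maps of $T$-graphs that preserve identities and composition. Write $T\text{-}\mathbf{Graph}$ and $T\text{-}\mathbf{Multicat}$ for the resulting categories, and, for $S\in\mathcal E$, $\mathcal E'_S\cong\mathcal E/(TS\times S)$ and $T\text{-}\mathbf{Multicat}_S$ for the subcategories of objects with $C_0=S$ and maps with $f_0=1_S$. An adjunction is *monadic* if its comparison functor to the category of algebras of the induced monad is an equivalence. **Theorem.** 1. Let $(\mathcal E,T)$ be suitable. The forgetful functor $T\text{-}\mathbf{Multicat}\to T\text{-}\mathbf{Graph}$ has a left adjoint, the adjunction is monadic, and if $T'$ is the resulting monad then $(T\text{-}\mathbf{Graph},T')$ is suitable. 2. Let $(\mathcal E,T)$ be suitable and let $S\in\mathcal E$. The forgetful functor $T\text{-}\mathbf{Multicat}_S\to\mathcal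 E'_S$ has a left adjoint, the adjunction is monadic, and if $T'_S$ is the resulting monad then $(\mathcal E'_S,T'_S)$ is suitable. Moreover, if $\mathcal E$ has filtered colimits and $T$ preserves them, then $\mathcal E'_S$ has filtered colimits; and if in addition filtered colimits in $\mathcal E$ are stable under pullback, then filtered colimits in $\mathcal E'_S$ are stable under pullback and $T'_S$ preserves them. 3. Let $\mathcal E$ be a category equivalent to a functor category $[\mathbb E,\mathbf{Set}]$ with $\mathbb E$ small, and let $T$ be a finitary (that is, filtered-colimit-preserving) cartesian monad on $\mathcal E$. Then $(\mathcal E,T)$ is suitable. -/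

import Mathlib

open CategoryTheory CategoryTheory.Limits

universe w' w v u

/-! ### Suitable categories and suitable monads -/

section Suitable

/-- A nested sequence: a functor out of the ordered set of natural numbers that sends every
morphism to a monomorphism. -/
def IsNested {E : Type u} [Category.{v} E] (A : ℕ ⥤ E) : Prop :=
  ∀ ⦃m n : ℕ⦄ (f : m ⟶ n), Mono (A.map f)

/-- Suitable categories: finite limits; disjoint finite coproducts, stable under pullback;
colimits of nested sequences, which commute with pullbacks and have monic coprojections. -/
class IsSuitableCategory (E : Type u) [Category.{v} E] : Prop
    extends HasFiniteLimits E where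
  hasFiniteCoproducts : HasFiniteCoproducts E
  mono_coprojection : ∀ {J : Type} [Finite J] (D : Discrete J ⥤ E) (c : Cocone D),
    IsColimit c → ∀ j, Mono (c.ι.app j)
  disjoint : ∀ A B : E,
    IsPullback (initial.to A) (initial.to B) (coprod.inl : A ⟶ A ⨿ B) (coprod.inr : B ⟶ A ⨿ B)
  /-- Pulling a coproduct cocone back along a map into its vertex gives a coproduct cocone. (The
  condition in `IsUniversalColimit` that the map of diagrams is equifibered is automatic for
  diagrams obtained by pullback.) -/
  coproduct_stable : ∀ {J : Type} [Finite J] (D : Discrete J ⥤ E) (c : Cocone D),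
    IsColimit c → IsUniversalColimit c
  hasColimit_nested : ∀ A : ℕ ⥤ E, IsNested A → HasColimit A
  nested_mono_coprojection : ∀ A : ℕ ⥤ E, IsNested A → ∀ c : Cocone A,
    IsColimit c → ∀ n, Mono (c.ι.app n)
  /-- The colimit of the levelwise pullback `P` of nested sequences `A`, `B` over `C` is the
  pullback of the colimits. -/
  nested_commute : ∀ (P A B C : ℕ ⥤ E) (p : P ⟶ A) (q : P ⟶ B) (f : A ⟶ C) (g : B ⟶ C),
    IsNested A → IsNested B → IsNested C →
    (∀ n, IsPullback (p.app n) (q.app n) (f.app n) (g.app n)) →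
    ∀ (cP : Cocone P) (cA : Cocone A) (cB : Cocone B) (cC : Cocone C)
      (hP : IsColimit cP) (hA : IsColimit cA) (hB : IsColimit cB) (_ : IsColimit cC),
      IsPullback (hP.map cA p) (hP.map cB q) (hA.map cC f) (hB.map cC g)

/-- Cartesian monads: the unit and the multiplication are cartesian natural transformations,
and the endofunctor preserves pullbacks. -/
structure IsCartesianMonad {E : Type u} [Category.{v} E] (T : Monad E) : Prop where
  unit : ∀ ⦃X Y : E⦄ (f : X ⟶ Y), IsPullback (T.η.app X) f (T.map f) (T.η.app Y)
  mult : ∀ ⦃X Y : E⦄ (f : X ⟶ Y),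
    IsPullback (T.μ.app X) (T.map (T.map f)) (T.map f) (T.μ.app Y)
  preserves_pullbacks : PreservesLimitsOfShape WalkingCospan T.toFunctor

/-- Suitable monads: cartesian monads that preserve colimits of nested sequences. -/
structure IsSuitableMonad {E : Type u} [Category.{v} E] (T : Monad E) : Prop
    extends IsCartesianMonad T where
  preserves_nested : ∀ A : ℕ ⥤ E, IsNested A → PreservesColimit A T.toFunctor

/-- Filtered colimits, of diagrams of the given size, are stable under pullback. -/
def FilteredColimitsStable (E : Type u) [Category.{v} E] : Prop :=
  ∀ {J : Type w} [Category.{w'} J] [IsFiltered J] (D : J ⥤ E) (c : Cocone D),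
    IsColimit c → IsUniversalColimit c

end Suitable

/-! ### Spans of the form `T R ⟵ M ⟶ S` -/

section Spans

/-- A 1-cell `R ⟶ S` of the Kleisli bicategory of spans: a diagram `T R ⟵ M ⟶ S`. -/
structure TSpan {E : Type u} [Category.{v} E] (T : Monad E) (R S : E) where
  apex : E
  dom : apex ⟶ T.obj R
  cod : apex ⟶ S

namespace TSpan

/-- A 2-cell between spans with the same feet. -/
@[ext]
structure Hom {E : Type u} [Category.{v} E] {T : Monad E} {R S : E} (M N : TSpan T R S) where
  hom : M.apex ⟶ N.apex
  w_dom : hom ≫ N.dom = M.dom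
  w_cod : hom ≫ N.cod = M.cod

attribute [simp] Hom.w_dom Hom.w_cod

instance {E : Type u} [Category.{v} E] {T : Monad E} {R S : E} : Category (TSpan T R S) where
  Hom M N := Hom M N
  id M := ⟨𝟙 _, by simp, by simp⟩
  comp f g := ⟨f.hom ≫ g.hom, by simp, by simp⟩
  id_comp f := Hom.ext (Category.id_comp f.hom)
  comp_id f := Hom.ext (Category.comp_id f.hom)
  assoc f g h := Hom.ext (Category.assoc f.hom g.hom h.hom)

@[simp] lemma id_hom {E : Type u} [Category.{v} E] {T : Monad E} {R S : E} (M : TSpan T R S) :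
    Hom.hom (𝟙 M) = 𝟙 M.apex := rfl

@[simp] lemma comp_hom {E : Type u} [Category.{v} E] {T : Monad E} {R S : E}
    {M N P : TSpan T R S} (f : M ⟶ N) (g : N ⟶ P) : Hom.hom (f ≫ g) = f.hom ≫ g.hom := rfl

@[ext] lemma hom_ext {E : Type u} [Category.{v} E] {T : Monad E} {R S : E} {M N : TSpan T R S}
    {f g : M ⟶ N} (h : f.hom = g.hom) : f = g := Hom.ext h

/-- The identity 1-cell `T S ⟵ S ⟶ S`, given by the unit of `T` and the identity. -/
abbrev unit {E : Type u} [Category.{v} E] (T : Monad E) (S : E) : TSpan T S S where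
  apex := S
  dom := T.η.app S
  cod := 𝟙 S

/-- The composite `N ∘ M` of 1-cells: the pullback of `T M ⟶ T S ⟵ N`. -/
noncomputable abbrev comp {E : Type u} [Category.{v} E] [HasPullbacks E] {T : Monad E} {R S Q : E}
    (N : TSpan T S Q) (M : TSpan T R S) : TSpan T R Q where
  apex := pullback (T.map M.cod) N.dom
  dom := pullback.fst (T.map M.cod) N.dom ≫ T.map M.dom ≫ T.μ.app R
  cod := pullback.snd (T.map M.cod) N.dom ≫ N.cod

/-- Horizontal composition of 2-cells. -/
@[simps]
noncomputable def hcomp {E : Type u} [Category.{v} E] [HasPullbacks E] {T : Monad E} {R S Q : E}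
    {N N' : TSpan T S Q} {M M' : TSpan T R S} (g : N ⟶ N') (f : M ⟶ M') :
    N.comp M ⟶ N'.comp M' where
  hom := pullback.map _ _ _ _ (T.map f.hom) g.hom (𝟙 (T.obj S))
    (by simp [← Functor.map_comp]) (by simp)
  w_dom := by
    refine (pullback.lift_fst_assoc _ _ _ _).trans ?_
    rw [Category.assoc, ← Functor.map_comp_assoc, f.w_dom]
  w_cod := by
    refine (pullback.lift_snd_assoc _ _ _ _).trans ?_
    rw [Category.assoc, g.w_cod]

lemma hcomp_id {E : Type u} [Category.{v} E] [HasPullbacks E] {T : Monad E} {R S Q : E}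
    (N : TSpan T S Q) (M : TSpan T R S) : hcomp (𝟙 N) (𝟙 M) = 𝟙 (N.comp M) := by
  apply hom_ext
  apply pullback.hom_ext <;> simp

lemma hcomp_comp {E : Type u} [Category.{v} E] [HasPullbacks E] {T : Monad E} {R S Q : E}
    {N N' N'' : TSpan T S Q} {M M' M'' : TSpan T R S} (g : N ⟶ N') (g' : N' ⟶ N'')
    (f : M ⟶ M') (f' : M' ⟶ M'') :
    hcomp (g ≫ g') (f ≫ f') = hcomp g f ≫ hcomp g' f' := by
  apply hom_ext
  refine Eq.trans ?_ (pullback.map_comp (f := T.map M.cod) (g := N.dom) (f' := T.map M'.cod)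
    (g' := N'.dom) (f'' := T.map M''.cod) (g'' := N''.dom) (T.map f.hom) (T.map f'.hom) g.hom g'.hom
    (𝟙 (T.obj S)) (𝟙 (T.obj S)) (by simp [← Functor.map_comp]) (by simp)
    (by simp [← Functor.map_comp]) (by simp)).symm
  simp

/-- The coherence 2-cell `P ∘ (N ∘ M) ⟶ (P ∘ N) ∘ M`; it is invertible if `T` is cartesian. -/
@[simps]
noncomputable def assoc {E : Type u} [Category.{v} E] [HasPullbacks E] {T : Monad E}
    {R S Q O : E} (P : TSpan T Q O) (N : TSpan T S Q) (M : TSpan T R S) :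
    P.comp (N.comp M) ⟶ (P.comp N).comp M where
  hom := pullback.lift
    (pullback.fst (T.map (N.comp M).cod) P.dom ≫ T.map (pullback.fst (T.map M.cod) N.dom) ≫
      T.μ.app M.apex)
    (pullback.lift
      (pullback.fst (T.map (N.comp M).cod) P.dom ≫ T.map (pullback.snd (T.map M.cod) N.dom))
      (pullback.snd (T.map (N.comp M).cod) P.dom)
      (by simpa using pullback.condition (f := T.map (N.comp M).cod) (g := P.dom)))
    (by
      have h := congrArg T.map (pullback.condition (f := T.map M.cod) (g := N.dom))
      simp only [Functor.map_comp] at h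
      have n := T.μ.naturality M.cod
      simp only [Functor.comp_map] at n
      simp only [Category.assoc, pullback.lift_fst_assoc]
      rw [← n, reassoc_of% h])
  w_dom := by
    have n := T.μ.naturality M.dom
    simp only [Functor.comp_map] at n
    refine (pullback.lift_fst_assoc _ _ _ _).trans ?_
    simp only [Functor.map_comp, Category.assoc, T.assoc, reassoc_of% n]
  w_cod := by
    refine (pullback.lift_snd_assoc _ _ _ _).trans ?_
    exact pullback.lift_snd_assoc _ _ _ _

/-- The coherence 2-cell `M ⟶ M ∘ 1`, which is always invertible. -/
@[simps]
noncomputable def rightUnit {E : Type u} [Category.{v} E] [HasPullbacks E] {T : Monad E}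
    {R S : E} (M : TSpan T R S) : M ⟶ M.comp (unit T R) where
  hom := pullback.lift M.dom (𝟙 M.apex) (by simp)
  w_dom := by
    refine (pullback.lift_fst_assoc _ _ _ _).trans ?_
    simp
  w_cod := by
    refine (pullback.lift_snd_assoc _ _ _ _).trans ?_
    simp

/-- The coherence 2-cell `M ⟶ 1 ∘ M`; it is invertible if `T` is cartesian. -/
@[simps]
noncomputable def leftUnit {E : Type u} [Category.{v} E] [HasPullbacks E] {T : Monad E}
    {R S : E} (M : TSpan T R S) : M ⟶ (unit T S).comp M where
  hom := pullback.lift (T.η.app M.apex) M.cod (T.η.naturality M.cod).symm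
  w_dom := by
    have n := T.η.naturality M.dom
    simp only [Functor.id_map] at n
    refine (pullback.lift_fst_assoc _ _ _ _).trans ?_
    simp [← reassoc_of% n]
  w_cod := by
    refine (pullback.lift_snd_assoc _ _ _ _).trans ?_
    simp

end TSpan

end Spans

/-! ### Graphs and multicategories -/

section Multicategories

/-- A `T`-graph: an object `C₀` and a diagram `T C₀ ⟵ C₁ ⟶ C₀`. -/
structure TGraph {E : Type u} [Category.{v} E] (T : Monad E) where
  obj : E
  span : TSpan T obj obj

/-- A map of `T`-graphs. -/
@[ext]
structure TGraph.Hom {E : Type u} [Category.{v} E] {T : Monad E} (X Y : TGraph T) where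
  obj : X.obj ⟶ Y.obj
  arr : X.span.apex ⟶ Y.span.apex
  w_dom : arr ≫ Y.span.dom = X.span.dom ≫ T.map obj
  w_cod : arr ≫ Y.span.cod = X.span.cod ≫ obj

instance {E : Type u} [Category.{v} E] {T : Monad E} : Category (TGraph T) where
  Hom X Y := TGraph.Hom X Y
  id X := ⟨𝟙 _, 𝟙 _, by simp, by simp⟩
  comp f g := ⟨f.obj ≫ g.obj, f.arr ≫ g.arr,
    by simp [g.w_dom, reassoc_of% f.w_dom], by simp [g.w_cod, reassoc_of% f.w_cod]⟩
  id_comp f := TGraph.Hom.ext (Category.id_comp f.obj) (Category.id_comp f.arr)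
  comp_id f := TGraph.Hom.ext (Category.comp_id f.obj) (Category.comp_id f.arr)
  assoc f g h := TGraph.Hom.ext (Category.assoc f.obj g.obj h.obj)
    (Category.assoc f.arr g.arr h.arr)

@[simp] lemma TGraph.id_obj {E : Type u} [Category.{v} E] {T : Monad E} (X : TGraph T) :
    TGraph.Hom.obj (𝟙 X) = 𝟙 X.obj := rfl

@[simp] lemma TGraph.id_arr {E : Type u} [Category.{v} E] {T : Monad E} (X : TGraph T) :
    TGraph.Hom.arr (𝟙 X) = 𝟙 X.span.apex := rfl

@[simp] lemma TGraph.comp_obj {E : Type u} [Category.{v} E] {T : Monad E} {X Y Z : TGraph T}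
    (f : X ⟶ Y) (g : Y ⟶ Z) : TGraph.Hom.obj (f ≫ g) = f.obj ≫ g.obj := rfl

@[simp] lemma TGraph.comp_arr {E : Type u} [Category.{v} E] {T : Monad E} {X Y Z : TGraph T}
    (f : X ⟶ Y) (g : Y ⟶ Z) : TGraph.Hom.arr (f ≫ g) = f.arr ≫ g.arr := rfl

/-- The category of `T`-graphs on `S`; its morphisms are the maps of `T`-graphs that are the
identity on `S`. -/
abbrev TGraphOn {E : Type u} [Category.{v} E] (T : Monad E) (S : E) := TSpan T S S

/-- The map `f₁ * f₁ : C₁ ∘ C₁ ⟶ D₁ ∘ D₁` induced by a map of `T`-graphs. -/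
noncomputable def TGraph.Hom.arrArr {E : Type u} [Category.{v} E] [HasPullbacks E] {T : Monad E}
    {X Y : TGraph T} (f : TGraph.Hom X Y) :
    (X.span.comp X.span).apex ⟶ (Y.span.comp Y.span).apex :=
  pullback.map _ _ _ _ (T.map f.arr) f.arr (T.map f.obj)
    (by simp [← Functor.map_comp, f.w_cod]) f.w_dom.symm

lemma TGraph.arrArr_id {E : Type u} [Category.{v} E] [HasPullbacks E] {T : Monad E}
    (X : TGraph T) : TGraph.Hom.arrArr (𝟙 X) = 𝟙 _ := by
  apply pullback.hom_ext <;> simp [TGraph.Hom.arrArr]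

lemma TGraph.arrArr_comp {E : Type u} [Category.{v} E] [HasPullbacks E] {T : Monad E}
    {X Y Z : TGraph T} (f : X ⟶ Y) (g : Y ⟶ Z) :
    TGraph.Hom.arrArr (f ≫ g) = f.arrArr ≫ g.arrArr := by
  refine Eq.trans ?_ (pullback.map_comp (T.map f.arr) (T.map g.arr) f.arr g.arr
    (T.map f.obj) (T.map g.obj) (by simp [← Functor.map_comp, f.w_cod]) f.w_dom.symm
    (by simp [← Functor.map_comp, g.w_cod]) g.w_dom.symm).symm
  simp [TGraph.Hom.arrArr]

/-- A `T`-multicategory on `S`: a monad on the object `S` in the bicategory of spans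
`T R ⟵ M ⟶ S`. -/
structure TMulticatOn {E : Type u} [Category.{v} E] [HasPullbacks E] (T : Monad E) (S : E) where
  span : TSpan T S S
  ids : TSpan.unit T S ⟶ span
  comp : span.comp span ⟶ span
  comp_ids : span.rightUnit ≫ TSpan.hcomp (𝟙 span) ids ≫ comp = 𝟙 span
  ids_comp : span.leftUnit ≫ TSpan.hcomp ids (𝟙 span) ≫ comp = 𝟙 span
  assoc : TSpan.hcomp (𝟙 span) comp ≫ comp =
    TSpan.assoc span span span ≫ TSpan.hcomp comp (𝟙 span) ≫ comp

/-- A map of `T`-multicategories on `S` that is the identity on `S`. -/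
@[ext]
structure TMulticatOn.Hom {E : Type u} [Category.{v} E] [HasPullbacks E] {T : Monad E} {S : E}
    (C D : TMulticatOn T S) where
  map : C.span ⟶ D.span
  map_ids : C.ids ≫ map = D.ids
  map_comp : C.comp ≫ map = TSpan.hcomp map map ≫ D.comp

instance {E : Type u} [Category.{v} E] [HasPullbacks E] {T : Monad E} {S : E} :
    Category (TMulticatOn T S) where
  Hom C D := TMulticatOn.Hom C D
  id C := ⟨𝟙 _, by simp, by
    rw [TSpan.hcomp_id, Category.comp_id, Category.id_comp]⟩
  comp f g := ⟨f.map ≫ g.map, by rw [← Category.assoc, f.map_ids, g.map_ids], by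
    rw [← Category.assoc, f.map_comp, Category.assoc, g.map_comp, ← Category.assoc]
    rw [TSpan.hcomp_comp]⟩
  id_comp f := TMulticatOn.Hom.ext (Category.id_comp f.map)
  comp_id f := TMulticatOn.Hom.ext (Category.comp_id f.map)
  assoc f g h := TMulticatOn.Hom.ext (Category.assoc f.map g.map h.map)

/-- The forgetful functor from `T`-multicategories on `S` to `T`-graphs on `S`. -/
def TMulticatOn.forget {E : Type u} [Category.{v} E] [HasPullbacks E] (T : Monad E) (S : E) :
    TMulticatOn T S ⥤ TGraphOn T S where
  obj C := C.span
  map f := f.map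

/-- A `T`-multicategory: an object of objects `S` and a `T`-multicategory on it. -/
structure TMulticat {E : Type u} [Category.{v} E] [HasPullbacks E] (T : Monad E) where
  obj : E
  on : TMulticatOn T obj

/-- The underlying `T`-graph of a `T`-multicategory. -/
abbrev TMulticat.graph {E : Type u} [Category.{v} E] [HasPullbacks E] {T : Monad E}
    (C : TMulticat T) : TGraph T where
  obj := C.obj
  span := C.on.span

/-- A map of `T`-multicategories: a map of the underlying `T`-graphs that respects identities
and composition. -/
@[ext]
structure TMulticat.Hom {E : Type u} [Category.{v} E] [HasPullbacks E] {T : Monad E}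
    (C D : TMulticat T) where
  map : C.graph ⟶ D.graph
  map_ids : C.on.ids.hom ≫ map.arr = map.obj ≫ D.on.ids.hom
  map_comp : C.on.comp.hom ≫ map.arr = map.arrArr ≫ D.on.comp.hom

instance {E : Type u} [Category.{v} E] [HasPullbacks E] {T : Monad E} :
    Category (TMulticat T) where
  Hom C D := TMulticat.Hom C D
  id C := ⟨𝟙 _, (Category.comp_id _).trans (Category.id_comp _).symm, by
    rw [TGraph.arrArr_id]
    exact (Category.comp_id _).trans (Category.id_comp _).symm⟩
  comp f g := ⟨f.map ≫ g.map, by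
    rw [TGraph.comp_arr, TGraph.comp_obj, reassoc_of% f.map_ids, g.map_ids, Category.assoc], by
    rw [TGraph.comp_arr, TGraph.arrArr_comp, reassoc_of% f.map_comp, g.map_comp,
      Category.assoc]⟩
  id_comp f := TMulticat.Hom.ext (Category.id_comp f.map)
  comp_id f := TMulticat.Hom.ext (Category.comp_id f.map)
  assoc f g h := TMulticat.Hom.ext (Category.assoc f.map g.map h.map)

/-- The forgetful functor from `T`-multicategories to `T`-graphs. -/
def TMulticat.forget {E : Type u} [Category.{v} E] [HasPullbacks E] (T : Monad E) :
    TMulticat T ⥤ TGraph T where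
  obj C := C.graph
  map f := f.map

end Multicategories

/-! ### Pullback squares in an arbitrary category -/

section PullbackSquares

variable {E : Type u} [Category.{v} E]

/-! A multicategory on `S` is a monad on `S` among spans, so the free one on a span `X` is a free
monad: a solution of `W = 1 + X ∘ W`. Left composition with `X` preserves colimits of nested
sequences, because `T` does and because these colimits commute with pullbacks. Hence `W` is the
colimit of `A₀ = 1`, `Aₙ₊₁ = 1 + X ∘ Aₙ`, whose transition maps are monic since coprojections and
sums of monos are. Replacing `1` by any span `B` gives the free left `X`-action on `B`
(`exists_isFreeAct`), with a universal property stated for maps that may also change the feet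
(`IsFreeAct.exists_lift`, `IsFreeAct.lift_ext`); this is what lets one construction serve both
varying and fixed objects.

The functor `X ∘ -` need not preserve sums, but `- ∘ B` is given by pullback along a map into the
feet, so it preserves sums and nested colimits. Therefore a free action on `I`, composed with `B`,
is free on `I ∘ B` (`IsFreeAct.hcomp`). In particular `W ∘ W` is the free action on `1 ∘ W ≅ W`.
This defines the composition of `W`, and the remaining multicategory laws and the universal property
follow by comparing maps of actions out of free actions.

Monadicity is checked directly. On underlying graphs each counit is split by the unit, which makes
algebra maps preserve identities and composition. For an algebra, the structure map is a split
epimorphism of graphs, and its associativity law says exactly that composition descends along it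
(`TMulticatOn.transfer`).

The induced monad is cartesian because `W` is the sum of `1` and `X ∘ W`: coprojections are
cartesian for sums of maps, so the identities, the action and thus the unit are cartesian. The
composition and the multiplication are maps out of free actions, and `IsFreeAct.isPullback` reduces
their cartesianness to generators by passing through the approximations. Pullbacks are preserved
because composites, sums and nested colimits of pullback squares are pullback squares.

Preservation of colimits is also proved along the approximations (`isColimit_freeArr`). The only
substantial step is `X ∘ Aₙ`, a pullback of `T Aₙ` and `X`. For nested sequences this uses
commutation with pullbacks. For filtered colimits over a fixed `S`, stability gives a colimit
indexed by `J × J`, and the diagonal of a filtered category is final (`isColimit_of_isPullback`).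

Suitability of spans, graphs and functor categories is transported along jointly conservative
families of functors (`JointlyConservative.isSuitableCategory`): apexes, the two components, and
evaluations respectively. -/

lemma IsPullback.of_exists_lift {P X Y Z : E} {p : P ⟶ X} {q : P ⟶ Y} {f : X ⟶ Z} {g : Y ⟶ Z}
    (w : p ≫ f = q ≫ g)
    (lift : ∀ {S : E} (x : S ⟶ X) (y : S ⟶ Y), x ≫ f = y ≫ g → ∃ l : S ⟶ P, l ≫ p = x ∧ l ≫ q = y)
    (ext : ∀ {S : E} (l l' : S ⟶ P), l ≫ p = l' ≫ p → l ≫ q = l' ≫ q → l = l') :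
    IsPullback p q f g :=
  ⟨⟨w⟩, ⟨PullbackCone.IsLimit.mk w (fun s => (lift s.fst s.snd s.condition).choose)
    (fun s => (lift s.fst s.snd s.condition).choose_spec.1)
    (fun s => (lift s.fst s.snd s.condition).choose_spec.2)
    (fun s _ h₁ h₂ => ext _ _
      (h₁.trans (lift s.fst s.snd s.condition).choose_spec.1.symm)
      (h₂.trans (lift s.fst s.snd s.condition).choose_spec.2.symm))⟩⟩

/-- With monos expressed as pullback squares, every later result on pullbacks (being reflected,
being closed under sums) yields the corresponding result on monos. -/
lemma IsPullback.mono_iff_self {X Y : E} (f : X ⟶ Y) :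
    Mono f ↔ IsPullback (𝟙 X) (𝟙 X) f f := by
  constructor
  · intro h
    exact IsPullback.of_exists_lift rfl
      (fun x y hxy => ⟨x, by simp, by simpa using (cancel_mono f).1 hxy⟩)
      (fun l l' h _ => by simpa using h)
  · intro h
    refine ⟨fun a b hab => ?_⟩
    have h₁ := h.lift_fst a b hab
    have h₂ := h.lift_snd a b hab
    exact (by simpa using h₁.symm : a = _).trans (by simpa using h₂)

/-- The pullback of a square of cospans whose three component squares are pullbacks. -/
lemma IsPullback.cube {A₀ A₁ A₂ A₃ B₀ B₁ B₂ B₃ C₀ C₁ C₂ C₃ P₀ P₁ P₂ P₃ : E}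
    {f₀ : A₀ ⟶ C₀} {g₀ : B₀ ⟶ C₀} {p₀ : P₀ ⟶ A₀} {q₀ : P₀ ⟶ B₀}
    {f₁ : A₁ ⟶ C₁} {g₁ : B₁ ⟶ C₁} {p₁ : P₁ ⟶ A₁} {q₁ : P₁ ⟶ B₁}
    {f₂ : A₂ ⟶ C₂} {g₂ : B₂ ⟶ C₂} {p₂ : P₂ ⟶ A₂} {q₂ : P₂ ⟶ B₂}
    {f₃ : A₃ ⟶ C₃} {g₃ : B₃ ⟶ C₃} {p₃ : P₃ ⟶ A₃} {q₃ : P₃ ⟶ B₃}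
    (h₀ : IsPullback p₀ q₀ f₀ g₀) (h₁ : IsPullback p₁ q₁ f₁ g₁)
    (h₂ : IsPullback p₂ q₂ f₂ g₂) (h₃ : IsPullback p₃ q₃ f₃ g₃)
    {a₁ : A₀ ⟶ A₁} {a₂ : A₀ ⟶ A₂} {a₁' : A₁ ⟶ A₃} {a₂' : A₂ ⟶ A₃}
    {b₁ : B₀ ⟶ B₁} {b₂ : B₀ ⟶ B₂} {b₁' : B₁ ⟶ B₃} {b₂' : B₂ ⟶ B₃}
    {c₁ : C₀ ⟶ C₁} {c₂ : C₀ ⟶ C₂} {c₁' : C₁ ⟶ C₃} {c₂' : C₂ ⟶ C₃}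
    {r₁ : P₀ ⟶ P₁} {r₂ : P₀ ⟶ P₂} {r₁' : P₁ ⟶ P₃} {r₂' : P₂ ⟶ P₃}
    (ha : IsPullback a₁ a₂ a₁' a₂') (hb : IsPullback b₁ b₂ b₁' b₂')
    (hc : IsPullback c₁ c₂ c₁' c₂')
    (hf₁ : f₀ ≫ c₁ = a₁ ≫ f₁) (hf₂ : f₀ ≫ c₂ = a₂ ≫ f₂)
    (hg₁ : g₀ ≫ c₁ = b₁ ≫ g₁) (hg₂ : g₀ ≫ c₂ = b₂ ≫ g₂)
    (hp₁ : r₁ ≫ p₁ = p₀ ≫ a₁) (hp₂ : r₂ ≫ p₂ = p₀ ≫ a₂)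
    (hp₁' : r₁' ≫ p₃ = p₁ ≫ a₁') (hp₂' : r₂' ≫ p₃ = p₂ ≫ a₂')
    (hq₁ : r₁ ≫ q₁ = q₀ ≫ b₁) (hq₂ : r₂ ≫ q₂ = q₀ ≫ b₂)
    (hq₁' : r₁' ≫ q₃ = q₁ ≫ b₁') (hq₂' : r₂' ≫ q₃ = q₂ ≫ b₂') :
    IsPullback r₁ r₂ r₁' r₂' := by
  refine IsPullback.of_exists_lift ?_ ?_ ?_
  · apply h₃.hom_ext
    · simp only [Category.assoc, hp₁', hp₂', reassoc_of% hp₁, reassoc_of% hp₂, ha.w]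
    · simp only [Category.assoc, hq₁', hq₂', reassoc_of% hq₁, reassoc_of% hq₂, hb.w]
  · intro S x y hxy
    have eA : (x ≫ p₁) ≫ a₁' = (y ≫ p₂) ≫ a₂' := by
      simp only [Category.assoc, ← hp₁', ← hp₂', reassoc_of% hxy]
    have eB : (x ≫ q₁) ≫ b₁' = (y ≫ q₂) ≫ b₂' := by
      simp only [Category.assoc, ← hq₁', ← hq₂', reassoc_of% hxy]
    -- The lifts into `A₀` and `B₀` agree in `C₀` because `C₀` is itself a pullback, so agreement
    -- can be tested in `C₁` and `C₂`.
    have eC : ha.lift _ _ eA ≫ f₀ = hb.lift _ _ eB ≫ g₀ := by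
      apply hc.hom_ext
      · rw [Category.assoc, Category.assoc, hf₁, hg₁, ha.lift_fst_assoc, hb.lift_fst_assoc,
          Category.assoc, Category.assoc, h₁.w]
      · rw [Category.assoc, Category.assoc, hf₂, hg₂, ha.lift_snd_assoc, hb.lift_snd_assoc,
          Category.assoc, Category.assoc, h₂.w]
    refine ⟨h₀.lift _ _ eC, ?_, ?_⟩
    · apply h₁.hom_ext
      · rw [Category.assoc, hp₁, h₀.lift_fst_assoc, ha.lift_fst]
      · rw [Category.assoc, hq₁, h₀.lift_snd_assoc, hb.lift_fst]
    · apply h₂.hom_ext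
      · rw [Category.assoc, hp₂, h₀.lift_fst_assoc, ha.lift_snd]
      · rw [Category.assoc, hq₂, h₀.lift_snd_assoc, hb.lift_snd]
  · intro S l l' e₁ e₂
    apply h₀.hom_ext
    · apply ha.hom_ext
      · simp only [Category.assoc, ← hp₁, reassoc_of% e₁]
      · simp only [Category.assoc, ← hp₂, reassoc_of% e₂]
    · apply hb.hom_ext
      · simp only [Category.assoc, ← hq₁, reassoc_of% e₁]
      · simp only [Category.assoc, ← hq₂, reassoc_of% e₂]

end PullbackSquares

/-! ### Binary sums in a suitable category: universality, disjointness, sums of pullback squares -/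

section Sums

variable {E : Type u} [Category.{v} E]

/-- `i` and `j` exhibit `L` as the coproduct of `A` and `B`. -/
structure IsSum {A B L : E} (i : A ⟶ L) (j : B ⟶ L) : Prop where
  exists_desc : ∀ {Z : E} (f : A ⟶ Z) (g : B ⟶ Z), ∃ h : L ⟶ Z, i ≫ h = f ∧ j ≫ h = g
  hom_ext : ∀ {Z : E} (f g : L ⟶ Z), i ≫ f = i ≫ g → j ≫ f = j ≫ g → f = g

lemma isSum_iff {A B L : E} (i : A ⟶ L) (j : B ⟶ L) :
    IsSum i j ↔ Nonempty (IsColimit (BinaryCofan.mk i j)) := by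
  constructor
  · intro h
    exact ⟨BinaryCofan.isColimitMk (fun s => (h.exists_desc s.inl s.inr).choose)
      (fun s => (h.exists_desc s.inl s.inr).choose_spec.1)
      (fun s => (h.exists_desc s.inl s.inr).choose_spec.2)
      (fun s m h₁ h₂ => h.hom_ext _ _
        (h₁.trans (h.exists_desc s.inl s.inr).choose_spec.1.symm)
        (h₂.trans (h.exists_desc s.inl s.inr).choose_spec.2.symm))⟩
  · rintro ⟨h⟩
    refine ⟨fun f g => ?_, fun f g h₁ h₂ => BinaryCofan.IsColimit.hom_ext h h₁ h₂⟩
    obtain ⟨l, h₁, h₂⟩ := BinaryCofan.IsColimit.desc' h f g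
    exact ⟨l, h₁, h₂⟩

lemma isSum_coprod (A B : E) [HasBinaryCoproduct A B] :
    IsSum (coprod.inl : A ⟶ A ⨿ B) (coprod.inr : B ⟶ A ⨿ B) :=
  ⟨fun f g => ⟨coprod.desc f g, coprod.inl_desc _ _, coprod.inr_desc _ _⟩,
    fun _ _ h₁ h₂ => coprod.hom_ext h₁ h₂⟩

lemma IsSum.isIso_of_comp {A B L L' : E} {i : A ⟶ L} {j : B ⟶ L} {i' : A ⟶ L'} {j' : B ⟶ L'}
    (h : IsSum i j) (h' : IsSum i' j') (f : L ⟶ L') (hi : i ≫ f = i') (hj : j ≫ f = j') :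
    IsIso f := by
  obtain ⟨g, h₁, h₂⟩ := h'.exists_desc i j
  refine ⟨g, h.hom_ext _ _ ?_ ?_, h'.hom_ext _ _ ?_ ?_⟩
  · rw [reassoc_of% hi, h₁, Category.comp_id]
  · rw [reassoc_of% hj, h₂, Category.comp_id]
  · rw [reassoc_of% h₁, hi, Category.comp_id]
  · rw [reassoc_of% h₂, hj, Category.comp_id]

lemma IsSum.iso_comp {A B A' B' L : E} {i : A ⟶ L} {j : B ⟶ L} (h : IsSum i j)
    (a : A' ⟶ A) (b : B' ⟶ B) [IsIso a] [IsIso b] : IsSum (a ≫ i) (b ≫ j) := by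
  refine ⟨fun f g => ?_, fun f g h₁ h₂ => ?_⟩
  · obtain ⟨l, h₁, h₂⟩ := h.exists_desc (inv a ≫ f) (inv b ≫ g)
    exact ⟨l, by rw [Category.assoc, h₁, IsIso.hom_inv_id_assoc],
      by rw [Category.assoc, h₂, IsIso.hom_inv_id_assoc]⟩
  · refine h.hom_ext _ _ ?_ ?_
    · simpa only [Category.assoc, cancel_epi] using h₁
    · simpa only [Category.assoc, cancel_epi] using h₂

lemma IsSum.symm {A B L : E} {i : A ⟶ L} {j : B ⟶ L} (h : IsSum i j) : IsSum j i :=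
  ⟨fun f g => (h.exists_desc g f).imp fun _ h => ⟨h.2, h.1⟩,
    fun f g h₁ h₂ => h.hom_ext f g h₂ h₁⟩

lemma IsSum.isIso_of_isInitial {A B L : E} {i : A ⟶ L} {j : B ⟶ L} (h : IsSum i j)
    (hB : IsInitial B) : IsIso i := by
  obtain ⟨r, h₁, h₂⟩ := h.exists_desc (𝟙 A) (hB.to A)
  exact ⟨r, h₁, h.hom_ext _ _ (by simp [reassoc_of% h₁]) (hB.hom_ext _ _)⟩

instance IsSuitableCategory.instHasFiniteCoproducts [IsSuitableCategory E] :
    HasFiniteCoproducts E :=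
  IsSuitableCategory.hasFiniteCoproducts

instance IsSuitableCategory.finitaryPreExtensive [IsSuitableCategory E] :
    FinitaryPreExtensive E where
  universal' c hc := IsSuitableCategory.coproduct_stable _ c hc

variable [IsSuitableCategory E]

lemma IsSum.universal {A B L A' B' L' : E} {i : A ⟶ L} {j : B ⟶ L} (h : IsSum i j)
    {i' : A' ⟶ L'} {j' : B' ⟶ L'} {a : A' ⟶ A} {b : B' ⟶ B} {l : L' ⟶ L}
    (hi : IsPullback i' a l i) (hj : IsPullback j' b l j) : IsSum i' j' := by
  rw [isSum_iff] at h ⊢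
  obtain ⟨h⟩ := h
  refine IsSuitableCategory.coproduct_stable _ _ h (BinaryCofan.mk i' j') (mapPair a b) l ?_
    (NatTrans.Equifibered.of_discrete _) ?_
  · ext ⟨⟨⟩⟩
    · exact hi.w.symm
    · exact hj.w.symm
  · rintro ⟨⟨⟩⟩
    · exact hi
    · exact hj

lemma IsSum.mono_left {A B L : E} {i : A ⟶ L} {j : B ⟶ L} (h : IsSum i j) : Mono i := by
  obtain ⟨h⟩ := (isSum_iff i j).1 h
  exact IsSuitableCategory.mono_coprojection _ _ h ⟨.left⟩

lemma IsSum.disjoint {A B L : E} {i : A ⟶ L} {j : B ⟶ L} (h : IsSum i j) {S : E}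
    (a : S ⟶ A) (b : S ⟶ B) (hab : a ≫ i = b ≫ j) : Nonempty (IsInitial S) := by
  obtain ⟨d, h₁, h₂⟩ := h.exists_desc (coprod.inl : A ⟶ A ⨿ B) coprod.inr
  have e : a ≫ coprod.inl = b ≫ (coprod.inr : B ⟶ A ⨿ B) := by
    rw [← h₁, ← h₂, reassoc_of% hab]
  let t := (IsSuitableCategory.disjoint A B).lift a b e
  -- The initial object is strict, a consequence of universality of the empty coproduct; so an
  -- object mapping to it is initial.
  have := (initialIsInitial (C := E)).isIso_to t
  exact ⟨initialIsInitial.ofIso (asIso t).symm⟩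

/-- Pulling the sum back along `x` splits `S` into a part over `A` and a part over `B`. The
hypothesis makes the second part initial, so the first is all of `S`. -/
lemma IsSum.exists_lift {A B L : E} {i : A ⟶ L} {j : B ⟶ L} (h : IsSum i j) {S : E} (x : S ⟶ L)
    (hx : ∀ {U : E} (s : U ⟶ S) (b : U ⟶ B), s ≫ x = b ≫ j → Nonempty (IsInitial U)) :
    ∃ l : S ⟶ A, l ≫ i = x := by
  have hs := h.universal (IsPullback.of_hasPullback x i) (IsPullback.of_hasPullback x j)
  obtain ⟨hU⟩ := hx _ _ (pullback.condition (f := x) (g := j))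
  have := hs.isIso_of_isInitial hU
  exact ⟨inv (pullback.fst x i) ≫ pullback.snd x i, by simp [← pullback.condition]⟩

/-- Coprojections are cartesian with respect to sums of maps. -/
lemma IsSum.isPullback_left {A B L A' B' L' : E} {i : A ⟶ L} {j : B ⟶ L} {i' : A' ⟶ L'}
    {j' : B' ⟶ L'} (h : IsSum i j) (h' : IsSum i' j') {a : A ⟶ A'} {b : B ⟶ B'} {l : L ⟶ L'}
    (hi : i ≫ l = a ≫ i') (hj : j ≫ l = b ≫ j') : IsPullback i a l i' := by
  have := h.mono_left
  have := h'.mono_left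
  refine IsPullback.of_exists_lift hi (fun {S} x y hxy => ?_)
    (fun k k' hk _ => (cancel_mono i).1 hk)
  obtain ⟨t, ht⟩ := h.exists_lift x (fun {U} s c hs => by
    refine h'.disjoint (s ≫ y) (c ≫ b) ?_
    rw [Category.assoc, ← hxy, reassoc_of% hs, hj, Category.assoc])
  refine ⟨t, ht, (cancel_mono i').1 ?_⟩
  rw [Category.assoc, ← hi, reassoc_of% ht, hxy]

lemma IsSum.isPullback_right {A B L A' B' L' : E} {i : A ⟶ L} {j : B ⟶ L} {i' : A' ⟶ L'}
    {j' : B' ⟶ L'} (h : IsSum i j) (h' : IsSum i' j') {a : A ⟶ A'} {b : B ⟶ B'} {l : L ⟶ L'}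
    (hi : i ≫ l = a ≫ i') (hj : j ≫ l = b ≫ j') : IsPullback j b l j' :=
  h.symm.isPullback_left h'.symm hj hi

/-- The copairing of two pullback squares over the same map is a pullback square. -/
lemma IsSum.isPullback_desc {A B L A' B' L' Z Z' : E} {i : A ⟶ L} {j : B ⟶ L} {i' : A' ⟶ L'}
    {j' : B' ⟶ L'} (h : IsSum i j) (h' : IsSum i' j') {a : A ⟶ A'} {b : B ⟶ B'} {l : L ⟶ L'}
    (hi : i ≫ l = a ≫ i') (hj : j ≫ l = b ≫ j') {f : L ⟶ Z} {f' : L' ⟶ Z'} {z : Z ⟶ Z'}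
    (hA : IsPullback (i ≫ f) a z (i' ≫ f')) (hB : IsPullback (j ≫ f) b z (j' ≫ f')) :
    IsPullback f l z f' := by
  have w : f ≫ z = l ≫ f' := h.hom_ext _ _
    (by simpa [reassoc_of% hi] using hA.w) (by simpa [reassoc_of% hj] using hB.w)
  have sq := IsPullback.of_hasPullback z f'
  let t : L ⟶ pullback z f' := pullback.lift f l w
  have ht₁ : t ≫ pullback.fst z f' = f := pullback.lift_fst _ _ _
  have ht₂ : t ≫ pullback.snd z f' = l := pullback.lift_snd _ _ _
  -- Universality presents the actual pullback of `z` and `f'` as the sum of its parts over `A'` and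
  -- `B'`. Those parts are `A` and `B`, so the comparison map `t` from `L` is invertible.
  have e₁ : IsPullback (i ≫ t) a (pullback.snd z f') i' := by
    refine IsPullback.of_right (h₁₂ := pullback.fst z f') (v₁₃ := z) (h₂₂ := f') ?_ ?_ sq.flip.flip
    · simpa [ht₁] using hA
    · simp [ht₂, hi]
  have e₂ : IsPullback (j ≫ t) b (pullback.snd z f') j' := by
    refine IsPullback.of_right (h₁₂ := pullback.fst z f') (v₁₃ := z) (h₂₂ := f') ?_ ?_ sq.flip.flip
    · simpa [ht₁] using hB
    · simp [ht₂, hj]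
  have := h.isIso_of_comp (h'.universal e₁ e₂) t rfl rfl
  exact IsPullback.of_iso_pullback ⟨w⟩ (asIso t) ht₁ ht₂

/-- Sums of pullback squares are pullback squares. -/
lemma IsSum.isPullback {A₀ A₁ A₂ A₃ B₀ B₁ B₂ B₃ L₀ L₁ L₂ L₃ : E}
    {i₀ : A₀ ⟶ L₀} {j₀ : B₀ ⟶ L₀} {i₁ : A₁ ⟶ L₁} {j₁ : B₁ ⟶ L₁}
    {i₂ : A₂ ⟶ L₂} {j₂ : B₂ ⟶ L₂} {i₃ : A₃ ⟶ L₃} {j₃ : B₃ ⟶ L₃}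
    (h₀ : IsSum i₀ j₀) (h₁ : IsSum i₁ j₁) (h₂ : IsSum i₂ j₂) (h₃ : IsSum i₃ j₃)
    {a₁ : A₀ ⟶ A₁} {a₂ : A₀ ⟶ A₂} {a₁' : A₁ ⟶ A₃} {a₂' : A₂ ⟶ A₃}
    {b₁ : B₀ ⟶ B₁} {b₂ : B₀ ⟶ B₂} {b₁' : B₁ ⟶ B₃} {b₂' : B₂ ⟶ B₃}
    {l₁ : L₀ ⟶ L₁} {l₂ : L₀ ⟶ L₂} {l₁' : L₁ ⟶ L₃} {l₂' : L₂ ⟶ L₃}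
    (ha : IsPullback a₁ a₂ a₁' a₂') (hb : IsPullback b₁ b₂ b₁' b₂')
    (hi₁ : i₀ ≫ l₁ = a₁ ≫ i₁) (hj₁ : j₀ ≫ l₁ = b₁ ≫ j₁)
    (hi₂ : i₀ ≫ l₂ = a₂ ≫ i₂) (hj₂ : j₀ ≫ l₂ = b₂ ≫ j₂)
    (hi₁' : i₁ ≫ l₁' = a₁' ≫ i₃) (hj₁' : j₁ ≫ l₁' = b₁' ≫ j₃)
    (hi₂' : i₂ ≫ l₂' = a₂' ≫ i₃) (hj₂' : j₂ ≫ l₂' = b₂' ≫ j₃) :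
    IsPullback l₁ l₂ l₁' l₂' := by
  -- Each summand's square into `L₁` is the given pullback pasted with a coprojection square, which
  -- is a pullback by disjointness.
  refine h₀.isPullback_desc h₂ hi₂ hj₂ ?_ ?_
  · rw [hi₁, hi₂']
    exact ha.flip.paste_vert (h₁.isPullback_left h₃ hi₁' hj₁').flip |>.flip
  · rw [hj₁, hj₂']
    exact hb.flip.paste_vert (h₁.isPullback_right h₃ hi₁' hj₁').flip |>.flip

lemma IsSum.mono {A B L A' B' L' : E} {i : A ⟶ L} {j : B ⟶ L} {i' : A' ⟶ L'}
    {j' : B' ⟶ L'} (h : IsSum i j) (h' : IsSum i' j') {a : A ⟶ A'} {b : B ⟶ B'} {l : L ⟶ L'}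
    (hi : i ≫ l = a ≫ i') (hj : j ≫ l = b ≫ j') [Mono a] [Mono b] : Mono l := by
  rw [IsPullback.mono_iff_self]
  exact h.isPullback h h h' ((IsPullback.mono_iff_self a).1 inferInstance)
    ((IsPullback.mono_iff_self b).1 inferInstance) (by simp) (by simp) (by simp) (by simp)
    hi hj hi hj

end Sums

/-! ### Colimits of sequences and their commutation with pullbacks -/

section SequentialColimits

variable {E : Type u} [Category.{v} E]

/-- `ι` exhibits `L` as the colimit of the sequence with transition maps `s`. -/
structure IsSeqColim {A : ℕ → E} (s : ∀ n, A n ⟶ A (n + 1)) {L : E} (ι : ∀ n, A n ⟶ L) : Prop where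
  w : ∀ n, s n ≫ ι (n + 1) = ι n
  exists_desc : ∀ {Z : E} (f : ∀ n, A n ⟶ Z), (∀ n, s n ≫ f (n + 1) = f n) →
    ∃ g : L ⟶ Z, ∀ n, ι n ≫ g = f n
  hom_ext : ∀ {Z : E} (g h : L ⟶ Z), (∀ n, ι n ≫ g = ι n ≫ h) → g = h

/-- The cocone on `Functor.ofSequence s` given by a compatible family of maps. -/
def coconeOfSequence {A : ℕ → E} (s : ∀ n, A n ⟶ A (n + 1)) {Z : E} (f : ∀ n, A n ⟶ Z)
    (hf : ∀ n, s n ≫ f (n + 1) = f n) : Cocone (Functor.ofSequence s) where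
  pt := Z
  ι := NatTrans.ofSequence f (fun n => by
    rw [Functor.ofSequence_map_homOfLE_succ]
    exact (hf n).trans (Category.comp_id _).symm)

/-- A compatible family of maps as a natural transformation. -/
def natTransOfSequence {A B : ℕ → E} {s : ∀ n, A n ⟶ A (n + 1)} {t : ∀ n, B n ⟶ B (n + 1)}
    (f : ∀ n, A n ⟶ B n) (hf : ∀ n, s n ≫ f (n + 1) = f n ≫ t n) :
    Functor.ofSequence s ⟶ Functor.ofSequence t :=
  NatTrans.ofSequence f (fun n => by
    rw [Functor.ofSequence_map_homOfLE_succ, Functor.ofSequence_map_homOfLE_succ]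
    exact hf n)

lemma IsSeqColim.of_isColimit {A : ℕ ⥤ E} {c : Cocone A} (h : IsColimit c) :
    IsSeqColim (fun n => A.map (homOfLE n.le_succ)) (fun n => c.ι.app n) where
  w n := c.w _
  exists_desc {Z} f hf := by
    let d : Cocone A := ⟨Z, NatTrans.ofSequence f (fun n => by simpa using hf n)⟩
    exact ⟨h.desc d, fun n => h.fac d n⟩
  hom_ext g g' hg := h.hom_ext hg

lemma IsSeqColim.isColimit {A : ℕ ⥤ E} {c : Cocone A}
    (h : IsSeqColim (fun n => A.map (homOfLE n.le_succ)) (fun n => c.ι.app n)) :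
    Nonempty (IsColimit c) := by
  have key (s : Cocone A) : ∃ g : c.pt ⟶ s.pt, ∀ n, c.ι.app n ≫ g = s.ι.app n :=
    h.exists_desc (fun n => s.ι.app n) (fun n => s.w _)
  exact ⟨{ desc := fun s => (key s).choose
           fac := fun s => (key s).choose_spec
           uniq := fun s m hm => h.hom_ext _ _ fun n => (hm n).trans ((key s).choose_spec n).symm }⟩

lemma ofSequence_map_succ {A : ℕ → E} (s : ∀ n, A n ⟶ A (n + 1)) :
    (fun n => (Functor.ofSequence s).map (homOfLE n.le_succ)) = s := by
  funext n
  exact Functor.ofSequence_map_homOfLE_succ s n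

lemma isSeqColim_iff {A : ℕ → E} (s : ∀ n, A n ⟶ A (n + 1)) {Z : E} (f : ∀ n, A n ⟶ Z)
    (hf : ∀ n, s n ≫ f (n + 1) = f n) :
    IsSeqColim s f ↔ Nonempty (IsColimit (coconeOfSequence s f hf)) := by
  have e := ofSequence_map_succ s
  constructor
  · intro h
    refine IsSeqColim.isColimit ?_
    rw [e]
    exact h
  · rintro ⟨h⟩
    have := IsSeqColim.of_isColimit h
    rw [e] at this
    exact this

lemma IsNested.of_succ {A : ℕ ⥤ E} (h : ∀ n : ℕ, Mono (A.map (homOfLE n.le_succ))) :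
    IsNested A := by
  have key : ∀ (m k : ℕ), Mono (A.map (homOfLE (Nat.le_add_right m k))) := by
    intro m k
    induction k with
    | zero =>
      have : homOfLE (Nat.le_add_right m 0) = 𝟙 m := Subsingleton.elim _ _
      rw [this, A.map_id]
      infer_instance
    | succ k ih =>
      have : homOfLE (Nat.le_add_right m (k + 1)) =
          homOfLE (Nat.le_add_right m k) ≫ homOfLE (m + k).le_succ := Subsingleton.elim _ _
      rw [this, A.map_comp]
      have := h (m + k)
      exact mono_comp _ _
  intro m n f
  obtain ⟨k, rfl⟩ := Nat.exists_eq_add_of_le (leOfHom f)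
  exact key m k

lemma isNested_ofSequence {A : ℕ → E} (s : ∀ n, A n ⟶ A (n + 1)) (hs : ∀ n, Mono (s n)) :
    IsNested (Functor.ofSequence s) :=
  IsNested.of_succ fun n => by
    rw [Functor.ofSequence_map_homOfLE_succ]
    exact hs n

lemma isSeqColim_const (X : E) : IsSeqColim (fun _ : ℕ => 𝟙 X) (fun _ => 𝟙 X) where
  w n := by simp
  exists_desc f hf := ⟨f 0, fun n => by
    induction n with
    | zero => simp
    | succ n ih => simpa [← hf n] using ih⟩
  hom_ext g h H := by simpa using H 0

lemma IsSeqColim.shift {A : ℕ → E} {s : ∀ n, A n ⟶ A (n + 1)} {L : E} {ι : ∀ n, A n ⟶ L}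
    (h : IsSeqColim s ι) : IsSeqColim (fun n => s (n + 1)) (fun n => ι (n + 1)) where
  w n := h.w (n + 1)
  exists_desc {Z} f hf := by
    -- The family `f` starts at stage one of the original sequence; precomposing with `s n` supplies
    -- a value at every stage, including the missing stage zero.
    obtain ⟨g, hg⟩ := h.exists_desc (Z := Z) (fun n => s n ≫ f n) (fun n => by rw [hf])
    refine ⟨g, fun n => ?_⟩
    rw [hg, hf]
  hom_ext g g' H := h.hom_ext _ _ fun n => by rw [← h.w, Category.assoc, H, Category.assoc]

lemma IsSeqColim.iso {A B : ℕ → E} {s : ∀ n, A n ⟶ A (n + 1)} {t : ∀ n, B n ⟶ B (n + 1)}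
    {L : E} {ι : ∀ n, A n ⟶ L} (h : IsSeqColim s ι) (e : ∀ n, B n ⟶ A n) [∀ n, IsIso (e n)]
    (he : ∀ n, t n ≫ e (n + 1) = e n ≫ s n) : IsSeqColim t (fun n => e n ≫ ι n) where
  w n := by rw [reassoc_of% he n, h.w]
  exists_desc f hf := by
    obtain ⟨g, hg⟩ := h.exists_desc (fun n => inv (e n) ≫ f n) (fun n => by
      rw [← cancel_epi (e n), ← reassoc_of% he n, IsIso.hom_inv_id_assoc, IsIso.hom_inv_id_assoc,
        hf])
    exact ⟨g, fun n => by rw [Category.assoc, hg, IsIso.hom_inv_id_assoc]⟩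
  hom_ext g g' H := h.hom_ext _ _ fun n => by
    simpa only [Category.assoc, cancel_epi] using H n

lemma IsSeqColim.of_isIso {A : ℕ → E} {s : ∀ n, A n ⟶ A (n + 1)} {L L' : E}
    {ι : ∀ n, A n ⟶ L} (h : IsSeqColim s ι) (f : L ⟶ L') [IsIso f] {ι' : ∀ n, A n ⟶ L'}
    (hf : ∀ n, ι n ≫ f = ι' n) : IsSeqColim s ι' where
  w n := by rw [← hf, ← hf, ← Category.assoc, h.w]
  exists_desc k hk := by
    obtain ⟨g, hg⟩ := h.exists_desc k hk
    exact ⟨inv f ≫ g, fun n => by rw [← hf, Category.assoc, IsIso.hom_inv_id_assoc, hg]⟩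
  hom_ext g g' H := by
    rw [← cancel_epi f]
    exact h.hom_ext _ _ fun n => by rw [reassoc_of% hf n, reassoc_of% hf n, H]

lemma IsSeqColim.map {F : Type*} [Category F] (T : E ⥤ F) {A : ℕ → E} {s : ∀ n, A n ⟶ A (n + 1)}
    {L : E} {ι : ∀ n, A n ⟶ L} (h : IsSeqColim s ι) [PreservesColimit (Functor.ofSequence s) T] :
    IsSeqColim (fun n => T.map (s n)) (fun n => T.map (ι n)) := by
  obtain ⟨h'⟩ := (isSeqColim_iff s ι h.w).1 h
  have := IsSeqColim.of_isColimit (isColimitOfPreserves T h')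
  have e : (fun n => (Functor.ofSequence s ⋙ T).map (homOfLE n.le_succ)) =
      fun n => T.map (s n) := by
    funext n
    exact congrArg T.map (Functor.ofSequence_map_homOfLE_succ s n)
  rw [e] at this
  exact this

variable [IsSuitableCategory E]

lemma exists_isSeqColim {A : ℕ → E} (s : ∀ n, A n ⟶ A (n + 1)) (hs : ∀ n, Mono (s n)) :
    ∃ (L : E) (ι : ∀ n, A n ⟶ L), IsSeqColim s ι := by
  have := IsSuitableCategory.hasColimit_nested _ (isNested_ofSequence s hs)
  have h := IsSeqColim.of_isColimit (colimit.isColimit (Functor.ofSequence s))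
  refine ⟨colimit (Functor.ofSequence s), fun n => colimit.ι (Functor.ofSequence s) n, ?_⟩
  rw [ofSequence_map_succ] at h
  exact h

variable {A B C P : ℕ → E} {sA : ∀ n, A n ⟶ A (n + 1)} {sB : ∀ n, B n ⟶ B (n + 1)}
  {sC : ∀ n, C n ⟶ C (n + 1)} {sP : ∀ n, P n ⟶ P (n + 1)}
  {p : ∀ n, P n ⟶ A n} {q : ∀ n, P n ⟶ B n} {f : ∀ n, A n ⟶ C n} {g : ∀ n, B n ⟶ C n}
  {LA LB LC LP : E} {ιA : ∀ n, A n ⟶ LA} {ιB : ∀ n, B n ⟶ LB} {ιC : ∀ n, C n ⟶ LC}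
  {ιP : ∀ n, P n ⟶ LP} {p' : LP ⟶ LA} {q' : LP ⟶ LB} {f' : LA ⟶ LC} {g' : LB ⟶ LC}

/-- Colimits of nested sequences commute with pullbacks. -/
lemma IsSeqColim.isPullback (hsA : ∀ n, Mono (sA n)) (hsB : ∀ n, Mono (sB n))
    (hsC : ∀ n, Mono (sC n)) (sq : ∀ n, IsPullback (p n) (q n) (f n) (g n))
    (hp : ∀ n, sP n ≫ p (n + 1) = p n ≫ sA n) (hq : ∀ n, sP n ≫ q (n + 1) = q n ≫ sB n)
    (hf : ∀ n, sA n ≫ f (n + 1) = f n ≫ sC n) (hg : ∀ n, sB n ≫ g (n + 1) = g n ≫ sC n)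
    (hP : IsSeqColim sP ιP) (hA : IsSeqColim sA ιA) (hB : IsSeqColim sB ιB)
    (hC : IsSeqColim sC ιC) (hp' : ∀ n, ιP n ≫ p' = p n ≫ ιA n)
    (hq' : ∀ n, ιP n ≫ q' = q n ≫ ιB n) (hf' : ∀ n, ιA n ≫ f' = f n ≫ ιC n)
    (hg' : ∀ n, ιB n ≫ g' = g n ≫ ιC n) : IsPullback p' q' f' g' := by
  obtain ⟨kP⟩ := (isSeqColim_iff sP ιP hP.w).1 hP
  obtain ⟨kA⟩ := (isSeqColim_iff sA ιA hA.w).1 hA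
  obtain ⟨kB⟩ := (isSeqColim_iff sB ιB hB.w).1 hB
  obtain ⟨kC⟩ := (isSeqColim_iff sC ιC hC.w).1 hC
  have := IsSuitableCategory.nested_commute (Functor.ofSequence sP) (Functor.ofSequence sA)
    (Functor.ofSequence sB) (Functor.ofSequence sC)
    (natTransOfSequence p hp) (natTransOfSequence q hq)
    (natTransOfSequence f hf) (natTransOfSequence g hg)
    (isNested_ofSequence _ hsA) (isNested_ofSequence _ hsB) (isNested_ofSequence _ hsC)
    (fun n => sq n) _ _ _ _ kP kA kB kC
  have ep : p' = kP.map (coconeOfSequence sA ιA hA.w) (natTransOfSequence p hp) :=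
    hP.hom_ext _ _ fun n => (hp' n).trans
      (kP.ι_map (coconeOfSequence sA ιA hA.w) (natTransOfSequence p hp) n).symm
  have eq : q' = kP.map (coconeOfSequence sB ιB hB.w) (natTransOfSequence q hq) :=
    hP.hom_ext _ _ fun n => (hq' n).trans
      (kP.ι_map (coconeOfSequence sB ιB hB.w) (natTransOfSequence q hq) n).symm
  have ef : f' = kA.map (coconeOfSequence sC ιC hC.w) (natTransOfSequence f hf) :=
    hA.hom_ext _ _ fun n => (hf' n).trans
      (kA.ι_map (coconeOfSequence sC ιC hC.w) (natTransOfSequence f hf) n).symm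
  have eg : g' = kB.map (coconeOfSequence sC ιC hC.w) (natTransOfSequence g hg) :=
    hB.hom_ext _ _ fun n => (hg' n).trans
      (kB.ι_map (coconeOfSequence sC ιC hC.w) (natTransOfSequence g hg) n).symm
  rw [ep, eq, ef, eg]
  exact this

/-- The sequence of pullbacks is again nested, so it has a colimit. That colimit and the given
vertex are both pullbacks of the same cospan, hence the comparison between them is invertible. -/
lemma IsSeqColim.of_isPullback (hsA : ∀ n, Mono (sA n)) (hsB : ∀ n, Mono (sB n))
    (hsC : ∀ n, Mono (sC n)) (sq : ∀ n, IsPullback (p n) (q n) (f n) (g n))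
    (hp : ∀ n, sP n ≫ p (n + 1) = p n ≫ sA n) (hq : ∀ n, sP n ≫ q (n + 1) = q n ≫ sB n)
    (hf : ∀ n, sA n ≫ f (n + 1) = f n ≫ sC n) (hg : ∀ n, sB n ≫ g (n + 1) = g n ≫ sC n)
    (hA : IsSeqColim sA ιA) (hB : IsSeqColim sB ιB)
    (hC : IsSeqColim sC ιC) (hp' : ∀ n, ιP n ≫ p' = p n ≫ ιA n)
    (hq' : ∀ n, ιP n ≫ q' = q n ≫ ιB n) (hf' : ∀ n, ιA n ≫ f' = f n ≫ ιC n)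
    (hg' : ∀ n, ιB n ≫ g' = g n ≫ ιC n) (sq' : IsPullback p' q' f' g') :
    IsSeqColim sP ιP := by
  have hsP (n : ℕ) : Mono (sP n) := by
    refine ⟨fun x y hxy => (sq n).hom_ext ?_ ?_⟩
    · rw [← cancel_mono (sA n), Category.assoc, Category.assoc, ← hp, reassoc_of% hxy]
    · rw [← cancel_mono (sB n), Category.assoc, Category.assoc, ← hq, reassoc_of% hxy]
  obtain ⟨L, ι, h⟩ := exists_isSeqColim sP hsP
  have wP (n : ℕ) : sP n ≫ ιP (n + 1) = ιP n := by
    apply sq'.hom_ext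
    · rw [Category.assoc, hp', hp', reassoc_of% hp n, hA.w]
    · rw [Category.assoc, hq', hq', reassoc_of% hq n, hB.w]
  obtain ⟨t, ht⟩ := h.exists_desc ιP wP
  have sq'' : IsPullback (t ≫ p') (t ≫ q') f' g' :=
    IsSeqColim.isPullback hsA hsB hsC sq hp hq hf hg h hA hB hC
      (fun n => by rw [reassoc_of% ht n, hp']) (fun n => by rw [reassoc_of% ht n, hq']) hf' hg'
  have : IsIso t := by
    have e : t = (sq''.isoIsPullback _ _ sq').hom := sq'.hom_ext (by simp) (by simp)
    rw [e]
    infer_instance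
  exact h.of_isIso t ht

end SequentialColimits

/-! ### Transport of suitability along jointly conservative families -/

section JointlyConservative

universe v₁ u₁ t

lemma IsSum.isPullback_of_isInitial {E : Type u} [Category.{v} E] [IsSuitableCategory E]
    {A B L O : E} {i : A ⟶ L} {j : B ⟶ L} (h : IsSum i j) (hO : IsInitial O)
    (a : O ⟶ A) (b : O ⟶ B) : IsPullback a b i j := by
  refine IsPullback.of_exists_lift (hO.hom_ext _ _) (fun {S} x y hxy => ?_) (fun {S} l l' _ _ => ?_)
  · obtain ⟨hS⟩ := h.disjoint x y hxy
    exact ⟨hS.to O, hS.hom_ext _ _, hS.hom_ext _ _⟩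
  · have := hO.isIso_to l
    exact (hO.ofIso (asIso l).symm).hom_ext _ _

variable {C : Type u₁} [Category.{v₁} C] {E : Type u} [Category.{v} E] {I : Type t}

/-- A family of functors that jointly reflects isomorphisms. -/
def JointlyConservative (F : I → C ⥤ E) : Prop :=
  ∀ ⦃X Y : C⦄ (f : X ⟶ Y), (∀ i, IsIso ((F i).map f)) → IsIso f

namespace JointlyConservative

variable {F : I → C ⥤ E}

/-- The comparison map to the chosen pullback is sent by each functor to a comparison between two
pullbacks of the same cospan. -/
lemma isPullback (hF : JointlyConservative F) [HasPullbacks C]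
    [∀ i, PreservesLimitsOfShape WalkingCospan (F i)] {P X Y Z : C} {p : P ⟶ X} {q : P ⟶ Y}
    {f : X ⟶ Z} {g : Y ⟶ Z} (w : p ≫ f = q ≫ g)
    (sq : ∀ i, IsPullback ((F i).map p) ((F i).map q) ((F i).map f) ((F i).map g)) :
    IsPullback p q f g := by
  have : IsIso (pullback.lift p q w) := hF _ fun i => by
    have sq' := (IsPullback.of_hasPullback f g).map (F i)
    have e : (F i).map (pullback.lift p q w) = ((sq i).isoIsPullback _ _ sq').hom :=
      sq'.hom_ext
        (by rw [IsPullback.isoIsPullback_hom_fst, ← Functor.map_comp, pullback.lift_fst])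
        (by rw [IsPullback.isoIsPullback_hom_snd, ← Functor.map_comp, pullback.lift_snd])
    rw [e]
    infer_instance
  exact IsPullback.of_iso_pullback ⟨w⟩ (asIso (pullback.lift p q w))
    (pullback.lift_fst _ _ _) (pullback.lift_snd _ _ _)

lemma mono (hF : JointlyConservative F) [HasPullbacks C]
    [∀ i, PreservesLimitsOfShape WalkingCospan (F i)]
    {X Y : C} (f : X ⟶ Y) (hf : ∀ i, Mono ((F i).map f)) :
    Mono f := by
  rw [IsPullback.mono_iff_self]
  refine hF.isPullback rfl fun i => ?_
  simpa using (IsPullback.mono_iff_self _).1 (hf i)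

lemma isColimit (hF : JointlyConservative F) {K : Type*} [Category K] {D : K ⥤ C}
    [HasColimit D] [∀ i, PreservesColimit D (F i)] (c : Cocone D)
    (hc : ∀ i, Nonempty (IsColimit ((F i).mapCocone c))) : Nonempty (IsColimit c) := by
  have : IsIso ((colimit.isColimit D).desc c) := hF _ fun i => by
    obtain ⟨h⟩ := hc i
    let e := (isColimitOfPreserves (F i) (colimit.isColimit D)).coconePointUniqueUpToIso h
    have : (F i).map ((colimit.isColimit D).desc c) = e.hom := by
      refine (isColimitOfPreserves (F i) (colimit.isColimit D)).hom_ext fun k => ?_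
      rw [IsColimit.comp_coconePointUniqueUpToIso_hom]
      simp [← Functor.map_comp]
    rw [this]
    infer_instance
  exact ⟨IsColimit.ofPointIso (colimit.isColimit D)⟩

/-- The functors preserve the pullbacks that form a test cocone, so its image is a test cocone for
the image of `c`; the colimit property obtained there is then reflected. -/
lemma isUniversalColimit (hF : JointlyConservative F) [HasPullbacks C]
    [∀ i, PreservesLimitsOfShape WalkingCospan (F i)] {K : Type*} [Category K]
    [HasColimitsOfShape K C] [∀ i, PreservesColimitsOfShape K (F i)]
    {D : K ⥤ C} (c : Cocone D) (hc : ∀ i, IsUniversalColimit ((F i).mapCocone c)) :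
    IsUniversalColimit c := by
  intro D' c' α f w hα sq
  refine hF.isColimit c' fun i => ?_
  refine hc i ((F i).mapCocone c') (Functor.whiskerRight α (F i)) ((F i).map f) ?_
    (hα.whiskerRight _) fun j => (sq j).map (F i)
  ext j
  simpa using congrArg (F i).map (congr_app w j)

/-- Apart from existence of limits and colimits, the axioms say that certain maps are monic, certain
squares are pullbacks and certain cocones are colimits. Such statements hold as soon as they hold
after applying every member of the family. -/
theorem isSuitableCategory (hF : JointlyConservative F) [IsSuitableCategory E]
    [HasFiniteLimits C] [HasFiniteCoproducts C]
    (hnest : ∀ A : ℕ ⥤ C, IsNested A → HasColimit A)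
    [∀ i, PreservesLimitsOfShape WalkingCospan (F i)]
    (hcop : ∀ i (J : Type) [Finite J], PreservesColimitsOfShape (Discrete J) (F i))
    (hpres : ∀ i (A : ℕ ⥤ C), IsNested A → PreservesColimit A (F i)) :
    IsSuitableCategory C := by
  have nested {A : ℕ ⥤ C} (hA : IsNested A) (i : I) : IsNested (A ⋙ F i) := fun m n f => by
    have := hA f
    exact inferInstanceAs (Mono ((F i).map (A.map f)))
  exact
  { hasFiniteCoproducts := inferInstance
    mono_coprojection := fun {J} _ D c hc j => hF.mono _ fun i => by
      have := hcop i J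
      exact IsSuitableCategory.mono_coprojection _ _ (isColimitOfPreserves (F i) hc) j
    disjoint := fun A B => hF.isPullback (initialIsInitial.hom_ext _ _) fun i => by
      have := hcop i WalkingPair
      have := hcop i PEmpty
      have h : IsSum ((F i).map (coprod.inl : A ⟶ A ⨿ B)) ((F i).map coprod.inr) :=
        (isSum_iff _ _).2 ⟨mapIsColimitOfPreservesOfIsColimit (F i) _ _ (coprodIsCoprod A B)⟩
      exact h.isPullback_of_isInitial (initialIsInitial.isInitialObj (F i) _) _ _
    coproduct_stable := fun {J} _ D c hc => by
      have := fun i => hcop i J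
      exact hF.isUniversalColimit c fun i =>
        IsSuitableCategory.coproduct_stable _ _ (isColimitOfPreserves (F i) hc)
    hasColimit_nested := hnest
    nested_mono_coprojection := fun A hA c hc n => hF.mono _ fun i => by
      have := hpres i A hA
      exact IsSuitableCategory.nested_mono_coprojection _ (nested hA i) _
        (isColimitOfPreserves (F i) hc) n
    nested_commute := fun P A B X p q f g hA hB hX sq cP cA cB cX hP hA' hB' hX' => by
      -- Nestedness of `P` is not among the data, but is needed for its colimit to be preserved; it
      -- follows because `A` and `B` are nested and the projections are jointly monic.
      have hPn : IsNested P := fun m n k => ⟨fun x y hxy => by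
        have := hA k
        have := hB k
        refine (sq m).hom_ext ?_ ?_
        · rw [← cancel_mono (A.map k), Category.assoc, Category.assoc, ← p.naturality,
            reassoc_of% hxy]
        · rw [← cancel_mono (B.map k), Category.assoc, Category.assoc, ← q.naturality,
            reassoc_of% hxy]⟩
      refine hF.isPullback (hP.hom_ext fun n => ?_) fun i => ?_
      · rw [hP.ι_map_assoc, hP.ι_map_assoc, hA'.ι_map, hB'.ι_map, (sq n).w_assoc]
      · have := hpres i P hPn
        have := hpres i A hA
        have := hpres i B hB
        have := hpres i X hX
        have map {D D' : ℕ ⥤ C} [PreservesColimit D (F i)] {c : Cocone D} (h : IsColimit c)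
            (c' : Cocone D') (α : D ⟶ D') : (F i).map (h.map c' α) =
              (isColimitOfPreserves (F i) h).map ((F i).mapCocone c')
                (Functor.whiskerRight α (F i)) := by
          refine (isColimitOfPreserves (F i) h).hom_ext fun n => ?_
          rw [IsColimit.ι_map]
          simp [← Functor.map_comp, h.ι_map]
        rw [map, map, map, map]
        exact IsSuitableCategory.nested_commute _ _ _ _ _ _ _ _ (nested hA i) (nested hB i)
          (nested hX i) (fun n => (sq n).map (F i)) _ _ _ _ _ _ _
          (isColimitOfPreserves (F i) hX') }

end JointlyConservative

end JointlyConservative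

/-! ### Recognising existence and preservation of pullbacks -/

section PullbackPreservation

universe v₁ u₁

variable {C : Type u₁} [Category.{v₁} C] {E : Type u} [Category.{v} E]

lemma hasPullbacks_of_exists (h : ∀ {X Y Z : C} (f : X ⟶ Z) (g : Y ⟶ Z),
    ∃ (P : C) (p : P ⟶ X) (q : P ⟶ Y), IsPullback p q f g) : HasPullbacks C := by
  have (X Y Z : C) (f : X ⟶ Z) (g : Y ⟶ Z) : HasPullback f g := by
    obtain ⟨P, p, q, sq⟩ := h f g
    exact sq.hasPullback
  exact hasPullbacks_of_hasLimit_cospan C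

/-- Pullbacks of a given cospan are unique up to isomorphism, so it is enough that one of them is
preserved. -/
lemma preservesPullbacks_of_exists (F : C ⥤ E) (h : ∀ {X Y Z : C} (f : X ⟶ Z) (g : Y ⟶ Z),
    ∃ (P : C) (p : P ⟶ X) (q : P ⟶ Y), IsPullback p q f g ∧
      IsPullback (F.map p) (F.map q) (F.map f) (F.map g)) :
    PreservesLimitsOfShape WalkingCospan F := by
  refine ⟨fun {K} => ?_⟩
  obtain ⟨P, p, q, sq, sq'⟩ := h (K.map WalkingCospan.Hom.inl) (K.map WalkingCospan.Hom.inr)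
  have : PreservesLimit (cospan (K.map WalkingCospan.Hom.inl) (K.map WalkingCospan.Hom.inr)) F :=
    preservesLimit_of_preserves_limit_cone sq.isLimit
      ((isLimitMapConePullbackConeEquiv F sq.w).symm sq'.isLimit)
  exact preservesLimit_of_iso_diagram F (diagramIsoCospan K).symm

lemma preservesPullbacks_of_isPullback (F : C ⥤ E) [HasPullbacks C]
    (h : ∀ {P X Y Z : C} {p : P ⟶ X} {q : P ⟶ Y} {f : X ⟶ Z} {g : Y ⟶ Z}, IsPullback p q f g →
      IsPullback (F.map p) (F.map q) (F.map f) (F.map g)) :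
    PreservesLimitsOfShape WalkingCospan F :=
  preservesPullbacks_of_exists F fun f g =>
    ⟨_, _, _, IsPullback.of_hasPullback f g, h (IsPullback.of_hasPullback f g)⟩

end PullbackPreservation

/-! ### Spans with fixed feet form a suitable category -/

namespace TSpan

variable {E : Type u} [Category.{v} E] {T : Monad E} {R S : E}

/-- The functor sending a span to its apex. -/
def apexFunctor (T : Monad E) (R S : E) : TSpan T R S ⥤ E where
  obj M := M.apex
  map f := f.hom

lemma isIso_of_hom {M N : TSpan T R S} (f : M ⟶ N) [IsIso f.hom] : IsIso f :=
  ⟨⟨inv f.hom, by rw [IsIso.inv_comp_eq, f.w_dom], by rw [IsIso.inv_comp_eq, f.w_cod]⟩,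
    hom_ext (IsIso.hom_inv_id f.hom), hom_ext (IsIso.inv_hom_id f.hom)⟩

/-- Spans from `R` to `S` amount to objects over `T R × S`, and the apex functor plays the part of
the forgetful functor of a slice: it reflects isomorphisms and creates pullbacks and colimits. -/
lemma jointlyConservative_apexFunctor :
    JointlyConservative (fun _ : Unit => apexFunctor T R S) := fun _ _ f hf => by
  have : IsIso f.hom := hf ()
  exact isIso_of_hom f

lemma isPullback_of_hom {P M N L : TSpan T R S} {p : P ⟶ M} {q : P ⟶ N} {f : M ⟶ L} {g : N ⟶ L}
    (sq : IsPullback p.hom q.hom f.hom g.hom) : IsPullback p q f g := by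
  refine IsPullback.of_exists_lift (by ext; exact sq.w) (fun {K} x y hxy => ?_)
    (fun l l' h h' => ?_)
  · have e : x.hom ≫ f.hom = y.hom ≫ g.hom := congrArg Hom.hom hxy
    refine ⟨⟨sq.lift x.hom y.hom e, ?_, ?_⟩, by ext; simp, by ext; simp⟩
    · rw [← p.w_dom, sq.lift_fst_assoc, x.w_dom]
    · rw [← p.w_cod, sq.lift_fst_assoc, x.w_cod]
  · ext
    exact sq.hom_ext (congrArg Hom.hom h) (congrArg Hom.hom h')

lemma exists_isPullback [HasPullbacks E] {M N L : TSpan T R S} (f : M ⟶ L) (g : N ⟶ L) :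
    ∃ (P : TSpan T R S) (p : P ⟶ M) (q : P ⟶ N),
      IsPullback p.hom q.hom f.hom g.hom := by
  refine ⟨⟨pullback f.hom g.hom, pullback.fst _ _ ≫ M.dom, pullback.fst _ _ ≫ M.cod⟩,
    ⟨pullback.fst _ _, rfl, rfl⟩, ⟨pullback.snd _ _, ?_, ?_⟩, IsPullback.of_hasPullback _ _⟩
  · rw [← g.w_dom, ← pullback.condition_assoc, f.w_dom]
  · rw [← g.w_cod, ← pullback.condition_assoc, f.w_cod]

instance [HasPullbacks E] : HasPullbacks (TSpan T R S) :=
  hasPullbacks_of_exists fun f g => by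
    obtain ⟨P, p, q, sq⟩ := exists_isPullback f g
    exact ⟨P, p, q, isPullback_of_hom sq⟩

instance [HasPullbacks E] : PreservesLimitsOfShape WalkingCospan (apexFunctor T R S) :=
  preservesPullbacks_of_exists _ fun f g => by
    obtain ⟨P, p, q, sq⟩ := exists_isPullback f g
    exact ⟨P, p, q, isPullback_of_hom sq, sq⟩

instance [HasFiniteLimits E] : HasFiniteLimits (TSpan T R S) := by
  have : HasTerminal (TSpan T R S) := by
    let t : TSpan T R S := ⟨T.obj R ⨯ S, prod.fst, prod.snd⟩
    have h : IsTerminal t := IsTerminal.ofUniqueHom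
      (fun M => ⟨prod.lift M.dom M.cod, prod.lift_fst _ _, prod.lift_snd _ _⟩)
      (fun M m => by
        refine hom_ext (prod.hom_ext ?_ ?_)
        · exact m.w_dom.trans (prod.lift_fst _ _).symm
        · exact m.w_cod.trans (prod.lift_snd _ _).symm)
    exact h.hasTerminal
  exact hasFiniteLimits_of_hasTerminal_and_pullbacks

section Colimits

variable {K : Type*} [Category K] (D : K ⥤ TSpan T R S)

/-- The domain legs of a diagram of spans. -/
def domCocone : Cocone (D ⋙ apexFunctor T R S) where
  pt := T.obj R
  ι :=
    { app := fun k => (D.obj k).dom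
      naturality := fun _ _ f => (D.map f).w_dom.trans (Category.comp_id _).symm }

/-- The codomain legs of a diagram of spans. -/
def codCocone : Cocone (D ⋙ apexFunctor T R S) where
  pt := S
  ι :=
    { app := fun k => (D.obj k).cod
      naturality := fun _ _ f => (D.map f).w_cod.trans (Category.comp_id _).symm }

/-- The colimit of a diagram of spans is formed on apexes. -/
noncomputable def colimitCocone [HasColimit (D ⋙ apexFunctor T R S)] : Cocone D where
  pt :=
    { apex := colimit (D ⋙ apexFunctor T R S)
      dom := colimit.desc (D ⋙ apexFunctor T R S) (domCocone D)
      cod := colimit.desc (D ⋙ apexFunctor T R S) (codCocone D) }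
  ι :=
    { app := fun k => ⟨colimit.ι (D ⋙ apexFunctor T R S) k, colimit.ι_desc (domCocone D) k,
        colimit.ι_desc (codCocone D) k⟩
      naturality := fun k l f => by
        ext
        exact (colimit.w (D ⋙ apexFunctor T R S) f).trans (Category.comp_id _).symm }

noncomputable def colimitCoconeIsColimit [HasColimit (D ⋙ apexFunctor T R S)] :
    IsColimit (colimitCocone D) where
  desc s := ⟨colimit.desc _ ((apexFunctor T R S).mapCocone s),
    colimit.hom_ext fun k => by
      refine (colimit.ι_desc_assoc ((apexFunctor T R S).mapCocone s) k _).trans ?_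
      exact (s.ι.app k).w_dom.trans (colimit.ι_desc (domCocone D) k).symm,
    colimit.hom_ext fun k => by
      refine (colimit.ι_desc_assoc ((apexFunctor T R S).mapCocone s) k _).trans ?_
      exact (s.ι.app k).w_cod.trans (colimit.ι_desc (codCocone D) k).symm⟩
  fac s k := by
    exact hom_ext (colimit.ι_desc ((apexFunctor T R S).mapCocone s) k)
  uniq s m hm := by
    refine hom_ext (colimit.hom_ext fun k => ?_)
    exact (congrArg Hom.hom (hm k)).trans
      (colimit.ι_desc ((apexFunctor T R S).mapCocone s) k).symm

lemma hasColimit [HasColimit (D ⋙ apexFunctor T R S)] : HasColimit D :=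
  ⟨⟨⟨_, colimitCoconeIsColimit D⟩⟩⟩

lemma preservesColimit [HasColimit (D ⋙ apexFunctor T R S)] :
    PreservesColimit D (apexFunctor T R S) :=
  preservesColimit_of_preserves_colimit_cocone (colimitCoconeIsColimit D)
    (colimit.isColimit (D ⋙ apexFunctor T R S))

instance [HasColimitsOfShape K E] : HasColimitsOfShape K (TSpan T R S) :=
  ⟨fun D => hasColimit D⟩

instance [HasColimitsOfShape K E] : PreservesColimitsOfShape K (apexFunctor T R S) :=
  ⟨fun {D} => preservesColimit D⟩

end Colimits

lemma isNested_apex [HasPullbacks E] {A : ℕ ⥤ TSpan T R S} (hA : IsNested A) :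
    IsNested (A ⋙ apexFunctor T R S) := fun m n f => by
  have := hA f
  exact inferInstanceAs (Mono ((apexFunctor T R S).map (A.map f)))

instance isSuitableCategory [IsSuitableCategory E] : IsSuitableCategory (TSpan T R S) := by
  have : HasFiniteCoproducts (TSpan T R S) := ⟨fun n => inferInstance⟩
  refine jointlyConservative_apexFunctor.isSuitableCategory (fun A hA => ?_) ?_ ?_
  · have := IsSuitableCategory.hasColimit_nested _ (isNested_apex hA)
    exact hasColimit A
  · intro _ J _
    infer_instance
  · intro _ A hA
    have := IsSuitableCategory.hasColimit_nested _ (isNested_apex hA)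
    exact preservesColimit A

end TSpan

/-! ### Graphs form a suitable category -/

namespace TGraph

variable {E : Type u} [Category.{v} E] {T : Monad E}

lemma hom_ext {X Y : TGraph T} {f g : X ⟶ Y} (h₀ : f.obj = g.obj) (h₁ : f.arr = g.arr) : f = g :=
  TGraph.Hom.ext h₀ h₁

/-- The object of objects of a graph. -/
def objFunctor (T : Monad E) : TGraph T ⥤ E where
  obj X := X.obj
  map f := f.obj

/-- The object of arrows of a graph. -/
def arrFunctor (T : Monad E) : TGraph T ⥤ E where
  obj X := X.span.apex
  map f := f.arr

/-- The two components of a graph. -/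
def components (T : Monad E) : Bool → TGraph T ⥤ E
  | false => objFunctor T
  | true => arrFunctor T

lemma isIso_of_components {X Y : TGraph T} (f : X ⟶ Y) [IsIso f.obj] [IsIso f.arr] : IsIso f := by
  refine ⟨⟨inv f.obj, inv f.arr, ?_, ?_⟩, hom_ext (IsIso.hom_inv_id _) (IsIso.hom_inv_id _),
    hom_ext (IsIso.inv_hom_id _) (IsIso.inv_hom_id _)⟩
  · rw [IsIso.inv_comp_eq, ← Category.assoc, f.w_dom, Category.assoc, ← T.map_comp,
      IsIso.hom_inv_id, T.map_id, Category.comp_id]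
  · rw [IsIso.inv_comp_eq, ← Category.assoc, f.w_cod, Category.assoc, IsIso.hom_inv_id,
      Category.comp_id]

lemma jointlyConservative_components : JointlyConservative (components T) := fun _ _ f hf => by
  have : IsIso f.obj := hf false
  have : IsIso f.arr := hf true
  exact isIso_of_components f

section Pullbacks

variable [PreservesLimitsOfShape WalkingCospan T.toFunctor]

/-- The domain leg of the induced map lands in `T` of the pullback of objects. Comparing it with the
required leg uses that `T` of this square is still a pullback. -/
lemma isPullback_of_components {P X Y Z : TGraph T} {p : P ⟶ X} {q : P ⟶ Y} {f : X ⟶ Z} {g : Y ⟶ Z}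
    (sq₀ : IsPullback p.obj q.obj f.obj g.obj) (sq₁ : IsPullback p.arr q.arr f.arr g.arr) :
    IsPullback p q f g := by
  refine IsPullback.of_exists_lift (hom_ext sq₀.w sq₁.w) (fun {K} x y hxy => ?_)
    (fun l l' h h' => ?_)
  · have e₀ : x.obj ≫ f.obj = y.obj ≫ g.obj := congrArg Hom.obj hxy
    have e₁ : x.arr ≫ f.arr = y.arr ≫ g.arr := congrArg Hom.arr hxy
    refine ⟨⟨sq₀.lift _ _ e₀, sq₁.lift _ _ e₁, ?_, ?_⟩, hom_ext (sq₀.lift_fst _ _ _)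
      (sq₁.lift_fst _ _ _), hom_ext (sq₀.lift_snd _ _ _) (sq₁.lift_snd _ _ _)⟩
    · apply (sq₀.map T.toFunctor).hom_ext
      · rw [Category.assoc, Category.assoc, ← T.map_comp, sq₀.lift_fst, ← p.w_dom,
          sq₁.lift_fst_assoc, x.w_dom]
      · rw [Category.assoc, Category.assoc, ← T.map_comp, sq₀.lift_snd, ← q.w_dom,
          sq₁.lift_snd_assoc, y.w_dom]
    · apply sq₀.hom_ext
      · rw [Category.assoc, Category.assoc, sq₀.lift_fst, ← p.w_cod, sq₁.lift_fst_assoc, x.w_cod]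
      · rw [Category.assoc, Category.assoc, sq₀.lift_snd, ← q.w_cod, sq₁.lift_snd_assoc, y.w_cod]
  · exact hom_ext (sq₀.hom_ext (congrArg Hom.obj h) (congrArg Hom.obj h'))
      (sq₁.hom_ext (congrArg Hom.arr h) (congrArg Hom.arr h'))

lemma exists_isPullback [HasPullbacks E] {X Y Z : TGraph T} (f : X ⟶ Z) (g : Y ⟶ Z) :
    ∃ (P : TGraph T) (p : P ⟶ X) (q : P ⟶ Y),
      IsPullback p.obj q.obj f.obj g.obj ∧ IsPullback p.arr q.arr f.arr g.arr := by
  have sq₀ := IsPullback.of_hasPullback f.obj g.obj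
  have sq₁ := IsPullback.of_hasPullback f.arr g.arr
  have wd : (pullback.fst f.arr g.arr ≫ X.span.dom) ≫ T.map f.obj =
      (pullback.snd f.arr g.arr ≫ Y.span.dom) ≫ T.map g.obj := by
    rw [Category.assoc, Category.assoc, ← f.w_dom, ← g.w_dom, sq₁.w_assoc]
  have wc : (pullback.fst f.arr g.arr ≫ X.span.cod) ≫ f.obj =
      (pullback.snd f.arr g.arr ≫ Y.span.cod) ≫ g.obj := by
    rw [Category.assoc, Category.assoc, ← f.w_cod, ← g.w_cod, sq₁.w_assoc]
  refine ⟨⟨pullback f.obj g.obj, pullback f.arr g.arr, (sq₀.map T.toFunctor).lift _ _ wd,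
    sq₀.lift _ _ wc⟩, ⟨pullback.fst _ _, pullback.fst _ _, ?_, ?_⟩,
    ⟨pullback.snd _ _, pullback.snd _ _, ?_, ?_⟩, sq₀, sq₁⟩
  · exact ((sq₀.map T.toFunctor).lift_fst _ _ wd).symm
  · exact (sq₀.lift_fst _ _ wc).symm
  · exact ((sq₀.map T.toFunctor).lift_snd _ _ wd).symm
  · exact (sq₀.lift_snd _ _ wc).symm

instance [HasPullbacks E] : HasPullbacks (TGraph T) :=
  hasPullbacks_of_exists fun f g => by
    obtain ⟨P, p, q, sq₀, sq₁⟩ := exists_isPullback f g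
    exact ⟨P, p, q, isPullback_of_components sq₀ sq₁⟩

instance [HasPullbacks E] : PreservesLimitsOfShape WalkingCospan (objFunctor T) :=
  preservesPullbacks_of_exists _ fun f g => by
    obtain ⟨P, p, q, sq₀, sq₁⟩ := exists_isPullback f g
    exact ⟨P, p, q, isPullback_of_components sq₀ sq₁, sq₀⟩

instance [HasPullbacks E] : PreservesLimitsOfShape WalkingCospan (arrFunctor T) :=
  preservesPullbacks_of_exists _ fun f g => by
    obtain ⟨P, p, q, sq₀, sq₁⟩ := exists_isPullback f g
    exact ⟨P, p, q, isPullback_of_components sq₀ sq₁, sq₁⟩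

instance [HasPullbacks E] : ∀ i, PreservesLimitsOfShape WalkingCospan (components T i)
  | false => inferInstanceAs (PreservesLimitsOfShape WalkingCospan (objFunctor T))
  | true => inferInstanceAs (PreservesLimitsOfShape WalkingCospan (arrFunctor T))

instance [HasFiniteLimits E] : HasFiniteLimits (TGraph T) := by
  have : HasTerminal (TGraph T) := by
    -- The terminal graph has a single object and, as arrows, everything its domain and codomain
    -- allow; it is not the terminal object in both components.
    let t : TGraph T := ⟨⊤_ E, T.obj (⊤_ E) ⨯ ⊤_ E, prod.fst, prod.snd⟩
    have h : IsTerminal t := IsTerminal.ofUniqueHom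
      (fun X => ⟨terminal.from _, prod.lift (X.span.dom ≫ T.map (terminal.from _))
        (X.span.cod ≫ terminal.from _), prod.lift_fst _ _, prod.lift_snd _ _⟩)
      (fun X m => by
        have e : m.obj = terminal.from _ := terminal.hom_ext _ _
        refine hom_ext e (prod.hom_ext ?_ (terminal.hom_ext _ _))
        refine m.w_dom.trans (Eq.trans ?_ (prod.lift_fst _ _).symm)
        rw [e])
    exact h.hasTerminal
  exact hasFiniteLimits_of_hasTerminal_and_pullbacks

end Pullbacks

section Colimits

variable {K : Type*} [Category K] (D : K ⥤ TGraph T)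

/-- The domain maps of a diagram of graphs. -/
def domCocone (c : Cocone (D ⋙ objFunctor T)) : Cocone (D ⋙ arrFunctor T) where
  pt := T.obj c.pt
  ι :=
    { app := fun k => (D.obj k).span.dom ≫ T.map (c.ι.app k)
      naturality := fun k l f => by
        refine Eq.trans ?_ (Category.comp_id _).symm
        have e := (D.map f).w_dom
        refine ((Category.assoc _ _ _).symm.trans ((congrArg (· ≫ _) e).trans
          (Category.assoc _ _ _))).trans (congrArg (fun x => (D.obj k).span.dom ≫ x) ?_)
        exact (T.map_comp _ _).symm.trans (congrArg T.map (c.w f)) }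

/-- The codomain maps of a diagram of graphs. -/
def codCocone (c : Cocone (D ⋙ objFunctor T)) : Cocone (D ⋙ arrFunctor T) where
  pt := c.pt
  ι :=
    { app := fun k => (D.obj k).span.cod ≫ c.ι.app k
      naturality := fun k l f => by
        refine Eq.trans ?_ (Category.comp_id _).symm
        have e := (D.map f).w_cod
        refine ((Category.assoc _ _ _).symm.trans ((congrArg (· ≫ _) e).trans
          (Category.assoc _ _ _))).trans ?_
        exact congrArg (fun x => (D.obj k).span.cod ≫ x) (c.w f) }

/-- The colimit of a diagram of graphs is formed componentwise. -/
noncomputable def colimitCocone [HasColimit (D ⋙ objFunctor T)] [HasColimit (D ⋙ arrFunctor T)] :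
    Cocone D where
  pt :=
    { obj := colimit (D ⋙ objFunctor T)
      span :=
        { apex := colimit (D ⋙ arrFunctor T)
          dom := colimit.desc (D ⋙ arrFunctor T) (domCocone D (colimit.cocone _))
          cod := colimit.desc (D ⋙ arrFunctor T) (codCocone D (colimit.cocone _)) } }
  ι :=
    { app := fun k => ⟨colimit.ι (D ⋙ objFunctor T) k, colimit.ι (D ⋙ arrFunctor T) k,
        colimit.ι_desc (domCocone D (colimit.cocone _)) k,
        colimit.ι_desc (codCocone D (colimit.cocone _)) k⟩
      naturality := fun _ _ f => hom_ext
        ((colimit.w (D ⋙ objFunctor T) f).trans (Category.comp_id _).symm)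
        ((colimit.w (D ⋙ arrFunctor T) f).trans (Category.comp_id _).symm) }

/-- No preservation of colimits by `T` is involved: `T` of the colimit of objects occurs only as the
target of the domain leg, which is a map out of the colimit of arrows. -/
noncomputable def colimitCoconeIsColimit [HasColimit (D ⋙ objFunctor T)]
    [HasColimit (D ⋙ arrFunctor T)] : IsColimit (colimitCocone D) where
  desc s := ⟨colimit.desc _ ((objFunctor T).mapCocone s),
    colimit.desc _ ((arrFunctor T).mapCocone s),
    colimit.hom_ext fun k => by
      refine (colimit.ι_desc_assoc ((arrFunctor T).mapCocone s) k _).trans ?_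
      refine (s.ι.app k).w_dom.trans (Eq.trans ?_
        (colimit.ι_desc_assoc (domCocone D (colimit.cocone _)) k _).symm)
      exact ((Category.assoc _ _ _).trans (congrArg (fun x => (D.obj k).span.dom ≫ x)
        ((T.map_comp _ _).symm.trans (congrArg T.map
          (colimit.ι_desc ((objFunctor T).mapCocone s) k))))).symm,
    colimit.hom_ext fun k => by
      refine (colimit.ι_desc_assoc ((arrFunctor T).mapCocone s) k _).trans ?_
      refine (s.ι.app k).w_cod.trans (Eq.trans ?_
        (colimit.ι_desc_assoc (codCocone D (colimit.cocone _)) k _).symm)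
      exact ((Category.assoc _ _ _).trans (congrArg (fun x => (D.obj k).span.cod ≫ x)
        (colimit.ι_desc ((objFunctor T).mapCocone s) k))).symm⟩
  fac s k := hom_ext (colimit.ι_desc ((objFunctor T).mapCocone s) k)
    (colimit.ι_desc ((arrFunctor T).mapCocone s) k)
  uniq s m hm := hom_ext
    (colimit.hom_ext fun k => (congrArg Hom.obj (hm k)).trans
      (colimit.ι_desc ((objFunctor T).mapCocone s) k).symm)
    (colimit.hom_ext fun k => (congrArg Hom.arr (hm k)).trans
      (colimit.ι_desc ((arrFunctor T).mapCocone s) k).symm)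

variable [HasColimit (D ⋙ objFunctor T)] [HasColimit (D ⋙ arrFunctor T)]

lemma hasColimit : HasColimit D :=
  ⟨⟨⟨_, colimitCoconeIsColimit D⟩⟩⟩

lemma preservesColimit_obj : PreservesColimit D (objFunctor T) :=
  preservesColimit_of_preserves_colimit_cocone (colimitCoconeIsColimit D)
    (colimit.isColimit (D ⋙ objFunctor T))

lemma preservesColimit_arr : PreservesColimit D (arrFunctor T) :=
  preservesColimit_of_preserves_colimit_cocone (colimitCoconeIsColimit D)
    (colimit.isColimit (D ⋙ arrFunctor T))

lemma preservesColimit_components : ∀ i, PreservesColimit D (components T i)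
  | false => preservesColimit_obj D
  | true => preservesColimit_arr D

end Colimits

section Suitable

variable [PreservesLimitsOfShape WalkingCospan T.toFunctor]

lemma isNested_obj [HasPullbacks E] {A : ℕ ⥤ TGraph T} (hA : IsNested A) :
    IsNested (A ⋙ objFunctor T) := fun m n f => by
  have := hA f
  exact inferInstanceAs (Mono ((objFunctor T).map (A.map f)))

lemma isNested_arr [HasPullbacks E] {A : ℕ ⥤ TGraph T} (hA : IsNested A) :
    IsNested (A ⋙ arrFunctor T) := fun m n f => by
  have := hA f
  exact inferInstanceAs (Mono ((arrFunctor T).map (A.map f)))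

instance isSuitableCategory [IsSuitableCategory E] : IsSuitableCategory (TGraph T) := by
  have : HasFiniteCoproducts (TGraph T) := ⟨fun n => ⟨fun D => hasColimit D⟩⟩
  refine jointlyConservative_components.isSuitableCategory (fun A hA => ?_) ?_ ?_
  · have := IsSuitableCategory.hasColimit_nested _ (isNested_obj hA)
    have := IsSuitableCategory.hasColimit_nested _ (isNested_arr hA)
    exact hasColimit A
  · exact fun i J _ => ⟨fun {D} => preservesColimit_components D i⟩
  · intro i A hA
    have := IsSuitableCategory.hasColimit_nested _ (isNested_obj hA)
    have := IsSuitableCategory.hasColimit_nested _ (isNested_arr hA)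
    exact preservesColimit_components A i

end Suitable

end TGraph

/-! ### Sets, functor categories and finitary monads -/

section Types

/-- Filtered colimits of sets commute with finite limits, so `colim` preserves the levelwise
pullback. The rest transports this from the chosen colimits to the given ones. -/
lemma Types.isPullback_of_nested_isColimit {P A B C : ℕ ⥤ Type w} {p : P ⟶ A} {q : P ⟶ B}
    {f : A ⟶ C} {g : B ⟶ C} (sq : ∀ n, IsPullback (p.app n) (q.app n) (f.app n) (g.app n))
    {cP : Cocone P} {cA : Cocone A} {cB : Cocone B} {cC : Cocone C}
    (hP : IsColimit cP) (hA : IsColimit cA) (hB : IsColimit cB) (hC : IsColimit cC) :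
    IsPullback (hP.map cA p) (hP.map cB q) (hA.map cC f) (hB.map cC g) := by
  have map {D D' : ℕ ⥤ Type w} {c : Cocone D} {c' : Cocone D'} (h : IsColimit c)
      (h' : IsColimit c') (α : D ⟶ D') : (colimit.isColimit D).map (colimit.cocone D') α ≫
        ((colimit.isColimit D').coconePointUniqueUpToIso h').hom =
        ((colimit.isColimit D).coconePointUniqueUpToIso h).hom ≫ h.map c' α := by
    refine (colimit.isColimit D).hom_ext fun n => ?_
    rw [IsColimit.ι_map_assoc, IsColimit.comp_coconePointUniqueUpToIso_hom,
      IsColimit.comp_coconePointUniqueUpToIso_hom_assoc, IsColimit.ι_map]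
  have sq' : IsPullback p q f g := IsPullback.of_forall_isPullback_app sq
  exact (sq'.map colim).of_iso ((colimit.isColimit P).coconePointUniqueUpToIso hP)
    ((colimit.isColimit A).coconePointUniqueUpToIso hA)
    ((colimit.isColimit B).coconePointUniqueUpToIso hB)
    ((colimit.isColimit C).coconePointUniqueUpToIso hC) (map hP hA p) (map hP hB q) (map hA hC f)
    (map hB hC g)

instance Types.isSuitableCategory : IsSuitableCategory (Type w) where
  hasFiniteCoproducts := inferInstance
  mono_coprojection D c hc j := FinitaryExtensive.mono_ι hc j
  disjoint A B := FinitaryExtensive.isPullback_initial_to_binaryCofan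
    (c := BinaryCofan.mk coprod.inl coprod.inr) (coprodIsCoprod A B)
  coproduct_stable D c hc := FinitaryPreExtensive.isUniversal_finiteCoproducts hc
  hasColimit_nested A _ := inferInstance
  nested_mono_coprojection A hA c hc n := by
    rw [mono_iff_injective]
    intro x y hxy
    -- Elements identified in a filtered colimit are already identified at some stage, and the
    -- transition map to that stage is injective.
    obtain ⟨k, f, g, e⟩ := (Types.FilteredColimit.isColimit_eq_iff A hc).1 hxy
    obtain rfl : f = g := Subsingleton.elim _ _
    have := hA f
    exact (mono_iff_injective _).1 this e
  nested_commute P A B C p q f g _ _ _ sq cP cA cB cC hP hA hB hC :=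
    Types.isPullback_of_nested_isColimit sq hP hA hB hC

variable {J : Type w} [Category.{w} J] {E : Type u} [Category.{v} E]

/-- Evaluations at the objects of `J`, composed with the equivalence, are jointly conservative and
preserve pullbacks and the relevant colimits, so suitability comes from that of sets. -/
theorem isSuitableCategory_of_equivalence (e : E ≌ (J ⥤ Type w)) : IsSuitableCategory E := by
  let F (j : J) : E ⥤ Type w := e.functor ⋙ (evaluation J (Type w)).obj j
  have hF : JointlyConservative F := fun X Y f hf => by
    have : IsIso (e.functor.map f) := by
      rw [NatTrans.isIso_iff_isIso_app]
      exact hf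
    exact isIso_of_reflects_iso f e.functor
  have : HasFiniteLimits E := ⟨fun K _ _ => Adjunction.hasLimitsOfShape_of_equivalence e.functor⟩
  have hcolim (K : Type) [SmallCategory K] : HasColimitsOfShape K E :=
    Adjunction.hasColimitsOfShape_of_equivalence e.functor
  have : HasFiniteCoproducts E := ⟨fun n => hcolim _⟩
  have hlim (j : J) : PreservesLimitsOfShape WalkingCospan (F j) := by
    unfold F
    infer_instance
  refine hF.isSuitableCategory (fun A _ => inferInstance) (fun j K _ => ?_) (fun j A _ => ?_)
  · unfold F
    infer_instance
  · unfold F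
    infer_instance

theorem isSuitableMonad_of_finitary (T : Monad E) (hT : IsCartesianMonad T)
    [PreservesFilteredColimitsOfSize.{w, w} T.toFunctor] : IsSuitableMonad T := by
  refine ⟨hT, fun A _ => ?_⟩
  -- The index category of a nested sequence lives in universe zero, and preservation in universe
  -- `w` includes it.
  have : PreservesFilteredColimitsOfSize.{0, 0} T.toFunctor :=
    preservesSmallestFilteredColimits_of_preservesFilteredColimits.{w, w} T.toFunctor
  infer_instance

end Types

/-! ### Composition of spans: projections and coherence laws -/

namespace TSpan

variable {E : Type u} [Category.{v} E] {T : Monad E}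

lemma T_map_comp_assoc {A B C D : E} (f : A ⟶ B) (g : B ⟶ C) (k : T.obj C ⟶ D) :
    T.map f ≫ T.map g ≫ k = T.map (f ≫ g) ≫ k := by
  rw [T.map_comp, Category.assoc]

section Composition

variable [HasPullbacks E] {R S Q O R' S' Q' : E}

/-- The projection of a composite `N ∘ M` to `T M`. -/
noncomputable def fst (N : TSpan T S Q) (M : TSpan T R S) : (N.comp M).apex ⟶ T.obj M.apex :=
  pullback.fst _ _

/-- The projection of a composite `N ∘ M` to `N`. -/
noncomputable def snd (N : TSpan T S Q) (M : TSpan T R S) : (N.comp M).apex ⟶ N.apex :=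
  pullback.snd _ _

lemma isPullback_comp (N : TSpan T S Q) (M : TSpan T R S) :
    IsPullback (fst N M) (snd N M) (T.map M.cod) N.dom :=
  IsPullback.of_hasPullback _ _

lemma comp_dom (N : TSpan T S Q) (M : TSpan T R S) :
    (N.comp M).dom = fst N M ≫ T.map M.dom ≫ T.μ.app R := rfl

lemma comp_cod (N : TSpan T S Q) (M : TSpan T R S) : (N.comp M).cod = snd N M ≫ N.cod := rfl

/-- Every coherence law below is checked on these two projections, where it becomes a monad law or a
naturality square of `T`. -/
lemma comp_hom_ext {N : TSpan T S Q} {M : TSpan T R S} {K : E} {f g : K ⟶ (N.comp M).apex}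
    (h : f ≫ fst N M = g ≫ fst N M) (h' : f ≫ snd N M = g ≫ snd N M) : f = g :=
  (isPullback_comp N M).hom_ext h h'

section

variable {N N' : TSpan T S Q} {M M' : TSpan T R S} (g : N ⟶ N') (f : M ⟶ M')

@[simp] lemma hcomp_fst : (hcomp g f).hom ≫ fst N' M' = fst N M ≫ T.map f.hom :=
  pullback.lift_fst _ _ _

@[simp] lemma hcomp_snd : (hcomp g f).hom ≫ snd N' M' = snd N M ≫ g.hom :=
  pullback.lift_snd _ _ _

@[simp] lemma hcomp_fst_assoc {K : E} (k : T.obj M'.apex ⟶ K) :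
    (hcomp g f).hom ≫ fst N' M' ≫ k = fst N M ≫ T.map f.hom ≫ k := by
  rw [← Category.assoc, hcomp_fst, Category.assoc]

@[simp] lemma hcomp_snd_assoc {K : E} (k : N'.apex ⟶ K) :
    (hcomp g f).hom ≫ snd N' M' ≫ k = snd N M ≫ g.hom ≫ k := by
  rw [← Category.assoc, hcomp_snd, Category.assoc]

end

section

variable (P : TSpan T Q O) (N : TSpan T S Q) (M : TSpan T R S)

@[simp] lemma assoc_fst : (assoc P N M).hom ≫ fst (P.comp N) M =
    fst P (N.comp M) ≫ T.map (fst N M) ≫ T.μ.app M.apex :=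
  pullback.lift_fst _ _ _

@[simp] lemma assoc_snd_fst : (assoc P N M).hom ≫ snd (P.comp N) M ≫ fst P N =
    fst P (N.comp M) ≫ T.map (snd N M) := by
  rw [← Category.assoc]
  exact (congrArg (· ≫ _) (pullback.lift_snd _ _ _)).trans (pullback.lift_fst _ _ _)

@[simp] lemma assoc_snd_snd : (assoc P N M).hom ≫ snd (P.comp N) M ≫ snd P N =
    snd P (N.comp M) := by
  rw [← Category.assoc]
  exact (congrArg (· ≫ _) (pullback.lift_snd _ _ _)).trans (pullback.lift_snd _ _ _)

@[simp] lemma assoc_fst_assoc {K : E} (k : T.obj M.apex ⟶ K) :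
    (assoc P N M).hom ≫ fst (P.comp N) M ≫ k =
    fst P (N.comp M) ≫ T.map (fst N M) ≫ T.μ.app M.apex ≫ k := by
  rw [← Category.assoc, assoc_fst, Category.assoc, Category.assoc]

@[simp] lemma assoc_snd_fst_assoc {K : E} (k : T.obj N.apex ⟶ K) :
    (assoc P N M).hom ≫ snd (P.comp N) M ≫ fst P N ≫ k =
    fst P (N.comp M) ≫ T.map (snd N M) ≫ k := by
  have := assoc_snd_fst P N M
  rw [reassoc_of% this]

@[simp] lemma assoc_snd_snd_assoc {K : E} (k : P.apex ⟶ K) :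
    (assoc P N M).hom ≫ snd (P.comp N) M ≫ snd P N ≫ k = snd P (N.comp M) ≫ k := by
  have := assoc_snd_snd P N M
  rw [reassoc_of% this]

@[simp] lemma rightUnit_fst : M.rightUnit.hom ≫ fst M (unit T R) = M.dom :=
  pullback.lift_fst _ _ _

@[simp] lemma rightUnit_snd : M.rightUnit.hom ≫ snd M (unit T R) = 𝟙 M.apex :=
  pullback.lift_snd _ _ _

@[simp] lemma leftUnit_fst : M.leftUnit.hom ≫ fst (unit T S) M = T.η.app M.apex :=
  pullback.lift_fst _ _ _

@[simp] lemma leftUnit_snd : M.leftUnit.hom ≫ snd (unit T S) M = M.cod :=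
  pullback.lift_snd _ _ _

@[simp] lemma rightUnit_fst_assoc {K : E} (k : T.obj R ⟶ K) :
    M.rightUnit.hom ≫ fst M (unit T R) ≫ k = M.dom ≫ k := by
  have := rightUnit_fst M
  rw [reassoc_of% this]

@[simp] lemma rightUnit_snd_assoc {K : E} (k : M.apex ⟶ K) :
    M.rightUnit.hom ≫ snd M (unit T R) ≫ k = k := by
  have := rightUnit_snd M
  rw [reassoc_of% this]

@[simp] lemma leftUnit_fst_assoc {K : E} (k : T.obj M.apex ⟶ K) :
    M.leftUnit.hom ≫ fst (unit T S) M ≫ k = T.η.app M.apex ≫ k := by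
  have := leftUnit_fst M
  rw [reassoc_of% this]

@[simp] lemma leftUnit_snd_assoc {K : E} (k : S ⟶ K) :
    M.leftUnit.hom ≫ snd (unit T S) M ≫ k = M.cod ≫ k := by
  have := leftUnit_snd M
  rw [reassoc_of% this]

end

lemma assoc_naturality {P P' : TSpan T Q O} {N N' : TSpan T S Q} {M M' : TSpan T R S}
    (p : P ⟶ P') (n : N ⟶ N') (m : M ⟶ M') :
    hcomp p (hcomp n m) ≫ assoc P' N' M' = assoc P N M ≫ hcomp (hcomp p n) m := by
  apply hom_ext
  apply comp_hom_ext
  · have := T.μ.naturality m.hom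
    simp only [Functor.comp_map] at this
    simp only [comp_hom, Category.assoc, assoc_fst, hcomp_fst, hcomp_fst_assoc, assoc_fst_assoc,
      T_map_comp_assoc]
    simp only [T.map_comp, Category.assoc, this]
  · apply comp_hom_ext
    · simp only [comp_hom, Category.assoc, assoc_snd_fst, hcomp_snd, hcomp_fst,
        hcomp_fst_assoc, assoc_snd_fst_assoc, ← T.map_comp]
    · simp only [comp_hom, Category.assoc, assoc_snd_snd, hcomp_snd,
        assoc_snd_snd_assoc]

lemma rightUnit_naturality {M M' : TSpan T R S} (m : M ⟶ M') :
    m ≫ M'.rightUnit = M.rightUnit ≫ hcomp m (𝟙 _) := by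
  apply hom_ext
  apply comp_hom_ext
  · simp only [comp_hom, Category.assoc, rightUnit_fst, hcomp_fst, m.w_dom,
      id_hom, T.map_id, Category.comp_id]
  · simp only [comp_hom, Category.assoc, rightUnit_snd, hcomp_snd, rightUnit_snd_assoc,
      Category.comp_id]

lemma leftUnit_naturality {M M' : TSpan T R S} (m : M ⟶ M') :
    m ≫ M'.leftUnit = M.leftUnit ≫ hcomp (𝟙 _) m := by
  apply hom_ext
  apply comp_hom_ext
  · simp only [comp_hom, Category.assoc, leftUnit_fst, hcomp_fst, leftUnit_fst_assoc]
    exact T.η.naturality m.hom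
  · simp only [comp_hom, Category.assoc, leftUnit_snd, hcomp_snd, m.w_cod,
      id_hom, Category.comp_id]

lemma leftUnit_assoc (N : TSpan T S Q) (M : TSpan T R S) :
    (N.comp M).leftUnit ≫ assoc (unit T Q) N M = hcomp N.leftUnit (𝟙 M) := by
  apply hom_ext
  apply comp_hom_ext
  · have := T.η.naturality (fst N M)
    simp only [Functor.id_map] at this
    simp only [comp_hom, Category.assoc, assoc_fst, leftUnit_fst_assoc, hcomp_fst,
      ← reassoc_of% this, T.left_unit, id_hom, T.map_id]
    rfl
  · apply comp_hom_ext
    · have := T.η.naturality (snd N M)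
      simp only [Functor.id_map] at this
      simp only [comp_hom, Category.assoc, assoc_snd_fst, leftUnit_fst_assoc, hcomp_snd_assoc,
        leftUnit_fst, this]
    · rw [Category.assoc, Category.assoc, hcomp_snd_assoc, leftUnit_snd, comp_hom]
      exact (Category.assoc _ _ _).trans ((congrArg _ (assoc_snd_snd _ _ _)).trans
        (leftUnit_snd _))

/-- On the projection to `T M` this is associativity of `μ`. No cartesianness is needed, since the
associativity cells are used only in the direction in which they exist for every monad. -/
lemma pentagon {U : E} (K : TSpan T O U) (P : TSpan T Q O) (N : TSpan T S Q) (M : TSpan T R S) :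
    assoc K P (N.comp M) ≫ assoc (K.comp P) N M =
      hcomp (𝟙 K) (assoc P N M) ≫ assoc K (P.comp N) M ≫ hcomp (assoc K P N) (𝟙 M) := by
  apply hom_ext
  apply comp_hom_ext
  · have := T.μ.naturality (fst N M)
    simp only [Functor.comp_map] at this
    simp only [comp_hom, Category.assoc, assoc_fst, assoc_fst_assoc, hcomp_fst, hcomp_fst_assoc,
      id_hom, T.map_id, Category.comp_id, T_map_comp_assoc, ← reassoc_of% this]
    simp only [T.map_comp, Category.assoc, T.assoc]
  · apply comp_hom_ext
    · have := T.μ.naturality (snd N M)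
      simp only [Functor.comp_map] at this
      simp only [comp_hom, Category.assoc, assoc_snd_fst, assoc_fst_assoc, hcomp_snd_assoc,
        assoc_fst, hcomp_fst_assoc, T_map_comp_assoc, ← this, assoc_snd_fst_assoc]
    · apply comp_hom_ext
      · simp only [comp_hom, Category.assoc, assoc_snd_snd, assoc_snd_fst, hcomp_snd_assoc,
          assoc_snd_fst_assoc, hcomp_fst_assoc, ← T.map_comp]
      · simp only [comp_hom, Category.assoc, assoc_snd_snd, hcomp_snd,
          id_hom, Category.comp_id]

end Composition

end TSpan

/-! ### Maps of spans over maps of their feet, and invertibility of the coherence cells -/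

namespace TSpan

variable {E : Type u} [Category.{v} E] {T : Monad E}

section OverHom

variable {R S Q R' S' Q' : E}

/-- A map of spans over given maps of their feet. -/
@[ext]
structure OverHom (g : R ⟶ R') (f : S ⟶ S') (M : TSpan T R S) (N : TSpan T R' S') where
  hom : M.apex ⟶ N.apex
  w_dom : hom ≫ N.dom = M.dom ≫ T.map g
  w_cod : hom ≫ N.cod = M.cod ≫ f

/-- Postcomposition of a map over given maps of feet with a 2-cell. -/
@[simps]
def OverHom.postcomp {g : R ⟶ R'} {f : S ⟶ S'} {M : TSpan T R S} {N L : TSpan T R' S'}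
    (φ : OverHom g f M N) (h : N ⟶ L) : OverHom g f M L where
  hom := φ.hom ≫ h.hom
  w_dom := by rw [Category.assoc, h.w_dom, φ.w_dom]
  w_cod := by rw [Category.assoc, h.w_cod, φ.w_cod]

/-- Precomposition of a map over given maps of feet with a 2-cell. -/
@[simps]
def OverHom.precomp {g : R ⟶ R'} {f : S ⟶ S'} {M L : TSpan T R S} {N : TSpan T R' S'}
    (φ : OverHom g f M N) (h : L ⟶ M) : OverHom g f L N where
  hom := h.hom ≫ φ.hom
  w_dom := by rw [Category.assoc, φ.w_dom, ← Category.assoc, h.w_dom]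
  w_cod := by rw [Category.assoc, φ.w_cod, ← Category.assoc, h.w_cod]

/-- The map of spans underlying a map of graphs. -/
def _root_.TGraph.Hom.over {X Y : TGraph T} (k : X ⟶ Y) : OverHom k.obj k.obj X.span Y.span where
  hom := k.arr
  w_dom := k.w_dom
  w_cod := k.w_cod

/-- The map of identity spans induced by a map of feet. -/
def unitOver (f : S ⟶ S') : OverHom f f (unit T S) (unit T S') where
  hom := f
  w_dom := T.η.naturality f
  w_cod := (Category.comp_id _).trans (Category.id_comp _).symm

variable [HasPullbacks E]

/-- Horizontal composition of maps over given maps of feet. -/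
noncomputable def cmp {g : R ⟶ R'} {f : S ⟶ S'} {h : Q ⟶ Q'} {N : TSpan T S Q} {N' : TSpan T S' Q'}
    {M : TSpan T R S} {M' : TSpan T R' S'} (θ : OverHom f h N N') (φ : OverHom g f M M') :
    OverHom g h (N.comp M) (N'.comp M') where
  hom := pullback.map _ _ _ _ (T.map φ.hom) θ.hom (T.map f)
    (by rw [← T.map_comp, ← T.map_comp, φ.w_cod]) θ.w_dom.symm
  w_dom := by
    have n := T.μ.naturality g
    simp only [Functor.comp_map] at n
    refine (pullback.lift_fst_assoc _ _ _ _).trans ?_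
    simp only [Category.assoc]
    rw [← n, T_map_comp_assoc, φ.w_dom, T.map_comp, Category.assoc]
  w_cod := by
    refine (pullback.lift_snd_assoc _ _ _ _).trans ?_
    rw [Category.assoc, Category.assoc, θ.w_cod]

section

variable {g : R ⟶ R'} {f : S ⟶ S'} {h : Q ⟶ Q'} {N : TSpan T S Q} {N' : TSpan T S' Q'}
    {M : TSpan T R S} {M' : TSpan T R' S'} (θ : OverHom f h N N') (φ : OverHom g f M M')

@[simp] lemma cmp_fst : (cmp θ φ).hom ≫ fst N' M' = fst N M ≫ T.map φ.hom :=
  pullback.lift_fst _ _ _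

@[simp] lemma cmp_snd : (cmp θ φ).hom ≫ snd N' M' = snd N M ≫ θ.hom :=
  pullback.lift_snd _ _ _

@[simp] lemma cmp_fst_assoc {K : E} (k : T.obj M'.apex ⟶ K) :
    (cmp θ φ).hom ≫ fst N' M' ≫ k = fst N M ≫ T.map φ.hom ≫ k := by
  rw [← Category.assoc, cmp_fst, Category.assoc]

@[simp] lemma cmp_snd_assoc {K : E} (k : N'.apex ⟶ K) :
    (cmp θ φ).hom ≫ snd N' M' ≫ k = snd N M ≫ θ.hom ≫ k := by
  rw [← Category.assoc, cmp_snd, Category.assoc]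

end

/-- Interchange of horizontal composites with commuting squares between 2-cells and maps over feet.
-/
lemma hcomp_cmp {g : R ⟶ R'} {f : S ⟶ S'} {h : Q ⟶ Q'} {N N₁ : TSpan T S Q}
    {N' N₁' : TSpan T S' Q'} {M M₁ : TSpan T R S} {M' M₁' : TSpan T R' S'}
    {θ : OverHom f h N N'} {φ : OverHom g f M M'} {θ₁ : OverHom f h N₁ N₁'}
    {φ₁ : OverHom g f M₁ M₁'} {n : N ⟶ N₁} {m : M ⟶ M₁} {n' : N' ⟶ N₁'} {m' : M' ⟶ M₁'}
    (hN : n.hom ≫ θ₁.hom = θ.hom ≫ n'.hom) (hM : m.hom ≫ φ₁.hom = φ.hom ≫ m'.hom) :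
    (hcomp n m).hom ≫ (cmp θ₁ φ₁).hom = (cmp θ φ).hom ≫ (hcomp n' m').hom := by
  apply comp_hom_ext
  · simp only [Category.assoc, cmp_fst, hcomp_fst, hcomp_fst_assoc, cmp_fst_assoc, ← T.map_comp, hM]
  · simp only [Category.assoc, cmp_snd, hcomp_snd, hcomp_snd_assoc, cmp_snd_assoc, hN]

section

variable {g : R ⟶ R'} {f : S ⟶ S'} {h : Q ⟶ Q'} {N N₁ : TSpan T S Q} {N' N₁' : TSpan T S' Q'}
    {M M₁ : TSpan T R S} {M' M₁' : TSpan T R' S'} (θ : OverHom f h N N') (φ : OverHom g f M M')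

lemma hcomp_id_cmp (m : M₁ ⟶ M) :
    (hcomp (𝟙 N) m).hom ≫ (cmp θ φ).hom = (cmp θ (φ.precomp m)).hom := by
  apply comp_hom_ext
  · rw [Category.assoc, cmp_fst, cmp_fst, hcomp_fst_assoc, ← T.map_comp]
    rfl
  · rw [Category.assoc, cmp_snd, cmp_snd, hcomp_snd_assoc]
    exact congrArg _ (Category.id_comp _)

lemma hcomp_cmp_id (n : N₁ ⟶ N) :
    (hcomp n (𝟙 M)).hom ≫ (cmp θ φ).hom = (cmp (θ.precomp n) φ).hom := by
  apply comp_hom_ext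
  · rw [Category.assoc, cmp_fst, cmp_fst, hcomp_fst_assoc, ← T.map_comp]
    exact congrArg (fun t => _ ≫ T.map t) (Category.id_comp _)
  · rw [Category.assoc, cmp_snd, cmp_snd, hcomp_snd_assoc]
    rfl

lemma cmp_hcomp_id (m : M' ⟶ M₁') :
    (cmp θ φ).hom ≫ (hcomp (𝟙 N') m).hom = (cmp θ (φ.postcomp m)).hom := by
  apply comp_hom_ext
  · rw [Category.assoc, hcomp_fst, cmp_fst_assoc, cmp_fst, ← T.map_comp]
    rfl
  · rw [Category.assoc, hcomp_snd, cmp_snd_assoc, cmp_snd]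
    exact congrArg _ (Category.comp_id _)

lemma cmp_hcomp_left (n : N' ⟶ N₁') :
    (cmp θ φ).hom ≫ (hcomp n (𝟙 M')).hom = (cmp (θ.postcomp n) φ).hom := by
  apply comp_hom_ext
  · rw [Category.assoc, hcomp_fst, cmp_fst_assoc, cmp_fst, ← T.map_comp]
    exact congrArg (fun t => _ ≫ T.map t) (Category.comp_id _)
  · rw [Category.assoc, hcomp_snd, cmp_snd_assoc, cmp_snd]
    rfl

end

lemma leftUnit_cmp {g : R ⟶ R'} {f : S ⟶ S'} {M : TSpan T R S} {M' : TSpan T R' S'}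
    (φ : OverHom g f M M') :
    M.leftUnit.hom ≫ (cmp (unitOver f) φ).hom = φ.hom ≫ M'.leftUnit.hom := by
  apply comp_hom_ext
  · rw [Category.assoc, Category.assoc, cmp_fst, leftUnit_fst, leftUnit_fst_assoc]
    exact (T.η.naturality φ.hom).symm
  · rw [Category.assoc, Category.assoc, cmp_snd, leftUnit_snd, leftUnit_snd_assoc, φ.w_cod]
    rfl

lemma rightUnit_cmp {g : R ⟶ R'} {f : S ⟶ S'} {M : TSpan T R S} {M' : TSpan T R' S'}
    (φ : OverHom g f M M') :
    M.rightUnit.hom ≫ (cmp φ (unitOver g)).hom = φ.hom ≫ M'.rightUnit.hom := by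
  apply comp_hom_ext
  · rw [Category.assoc, Category.assoc, cmp_fst, rightUnit_fst, rightUnit_fst_assoc, φ.w_dom]
    rfl
  · rw [Category.assoc, Category.assoc, cmp_snd, rightUnit_snd, rightUnit_snd_assoc,
      Category.comp_id]

lemma assoc_cmp {O O' : E} {g : R ⟶ R'} {f : S ⟶ S'} {h : Q ⟶ Q'} {k : O ⟶ O'}
    {P : TSpan T Q O} {P' : TSpan T Q' O'}
    {N : TSpan T S Q} {N' : TSpan T S' Q'} {M : TSpan T R S} {M' : TSpan T R' S'}
    (π : OverHom h k P P') (θ : OverHom f h N N') (φ : OverHom g f M M') :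
    (assoc P N M).hom ≫ (cmp (cmp π θ) φ).hom = (cmp π (cmp θ φ)).hom ≫ (assoc P' N' M').hom := by
  apply comp_hom_ext
  · have := T.μ.naturality φ.hom
    simp only [Functor.comp_map] at this
    simp only [Category.assoc, assoc_fst, cmp_fst, cmp_fst_assoc, assoc_fst_assoc,
      T_map_comp_assoc]
    simp only [T.map_comp, Category.assoc, this]
  · apply comp_hom_ext
    · simp only [Category.assoc, assoc_snd_fst, cmp_fst,
        cmp_fst_assoc, assoc_snd_fst_assoc, ← T.map_comp, cmp_snd]
    · simp only [Category.assoc, assoc_snd_snd, cmp_snd, assoc_snd_snd_assoc]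

end OverHom

section Isomorphisms

variable {R S Q O : E}

instance {M N : TSpan T R S} (f : M ⟶ N) [IsIso f] : IsIso f.hom :=
  inferInstanceAs (IsIso ((apexFunctor T R S).map f))

variable [HasPullbacks E]

instance {N N' : TSpan T S Q} {M M' : TSpan T R S} (g : N ⟶ N') (f : M ⟶ M') [IsIso g] [IsIso f] :
    IsIso (hcomp g f) :=
  ⟨hcomp (inv g) (inv f), by rw [← hcomp_comp, IsIso.hom_inv_id, IsIso.hom_inv_id, hcomp_id],
    by rw [← hcomp_comp, IsIso.inv_hom_id, IsIso.inv_hom_id, hcomp_id]⟩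

lemma isIso_of_isPullback {N : TSpan T S Q} {M : TSpan T R S} {L : TSpan T R Q}
    (f : L ⟶ N.comp M)
    (sq : IsPullback (f.hom ≫ fst N M) (f.hom ≫ snd N M) (T.map M.cod) N.dom) : IsIso f := by
  have e : f.hom = (sq.isoIsPullback _ _ (isPullback_comp N M)).hom :=
    comp_hom_ext (sq.isoIsPullback_hom_fst _ _ _).symm (sq.isoIsPullback_hom_snd _ _ _).symm
  have : IsIso f.hom := by
    rw [e]
    infer_instance
  exact isIso_of_hom f

/-- The right unit composite is a pullback along `T` of an identity, so invertibility needs nothing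
of `T`. -/
instance isIso_rightUnit (M : TSpan T R S) : IsIso M.rightUnit := by
  apply isIso_of_isPullback
  rw [rightUnit_fst, rightUnit_snd]
  exact IsPullback.of_vert_isIso ⟨by simp⟩

lemma isIso_leftUnit (hT : IsCartesianMonad T) (M : TSpan T R S) : IsIso M.leftUnit := by
  apply isIso_of_isPullback
  rw [leftUnit_fst, leftUnit_snd]
  exact hT.unit M.cod

/-- A map into `(P ∘ N) ∘ M` can be lifted through three pullbacks in turn: the naturality square of
`μ` at `M.cod`, then `T` of the square defining `N ∘ M`, then the square defining `P ∘ (N ∘ M)`.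
Both parts of cartesianness, for `μ` and for `T`, are used. -/
lemma isIso_assoc (hT : IsCartesianMonad T) (P : TSpan T Q O) (N : TSpan T S Q) (M : TSpan T R S) :
    IsIso (assoc P N M) := by
  have := hT.preserves_pullbacks
  have sqT := (isPullback_comp N M).map T.toFunctor
  have sqμ := hT.mult M.cod
  have sqP := isPullback_comp P (N.comp M)
  apply isIso_of_isPullback
  refine IsPullback.of_exists_lift ?_ ?_ ?_
  · rw [Category.assoc, Category.assoc, (isPullback_comp (P.comp N) M).w]
  · intro K x y hxy
    rw [comp_dom] at hxy
    let t := sqμ.lift x (y ≫ fst P N ≫ T.map N.dom) (by simpa using hxy)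
    let t' := sqT.lift t (y ≫ fst P N) (by
      rw [sqμ.lift_snd, Category.assoc])
    let l := sqP.lift t' (y ≫ snd P N) (by
      rw [comp_cod, T.map_comp, sqT.lift_snd_assoc, Category.assoc, Category.assoc,
        (isPullback_comp P N).w])
    refine ⟨l, ?_, comp_hom_ext ?_ ?_⟩
    · rw [assoc_fst, sqP.lift_fst_assoc, sqT.lift_fst_assoc, sqμ.lift_fst]
    · rw [Category.assoc, Category.assoc, assoc_snd_fst, sqP.lift_fst_assoc, sqT.lift_snd]
    · rw [Category.assoc, Category.assoc, assoc_snd_snd, sqP.lift_snd]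
  · intro K l l' h₁ h₂
    have e₁ := congrArg (· ≫ fst P N) h₂
    have e₂ := congrArg (· ≫ snd P N) h₂
    simp only [Category.assoc, assoc_snd_fst, assoc_snd_snd, assoc_fst] at e₁ e₂ h₁
    refine comp_hom_ext (sqT.hom_ext (sqμ.hom_ext ?_ ?_) ?_) e₂
    · simpa only [Category.assoc] using h₁
    · rw [Category.assoc, Category.assoc, Category.assoc, Category.assoc, sqT.w, reassoc_of% e₁]
    · rw [Category.assoc, Category.assoc, e₁]

end Isomorphisms

section Sequences

variable [IsSuitableCategory E] {R S Q : E}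

lemma mono_hcomp [PreservesLimitsOfShape WalkingCospan T.toFunctor] {N N' : TSpan T S Q}
    {M M' : TSpan T R S} (g : N ⟶ N') (f : M ⟶ M') [Mono g.hom] [Mono f.hom] :
    Mono (hcomp g f).hom := by
  refine ⟨fun x y hxy => comp_hom_ext ?_ ?_⟩
  · rw [← cancel_mono (T.map f.hom), Category.assoc, Category.assoc, ← hcomp_fst g f,
      reassoc_of% hxy]
  · rw [← cancel_mono g.hom, Category.assoc, Category.assoc, ← hcomp_snd g f,
      reassoc_of% hxy]

/-- The composites are pullbacks of `T (M n)` and `N n` over `T S`. With `T S` viewed as a constant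
nested sequence, this is commutation of nested colimits with pullbacks, after `T` has been applied
to the colimit of the `M n`. -/
lemma isSeqColim_hcomp (hT : IsSuitableMonad T) {N : ℕ → TSpan T S Q} {M : ℕ → TSpan T R S}
    {sN : ∀ n, N n ⟶ N (n + 1)} {sM : ∀ n, M n ⟶ M (n + 1)} {N' : TSpan T S Q} {M' : TSpan T R S}
    {ιN : ∀ n, N n ⟶ N'} {ιM : ∀ n, M n ⟶ M'} (hsN : ∀ n, Mono (sN n).hom)
    (hsM : ∀ n, Mono (sM n).hom) (hN : IsSeqColim (fun n => (sN n).hom) (fun n => (ιN n).hom))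
    (hM : IsSeqColim (fun n => (sM n).hom) (fun n => (ιM n).hom)) :
    IsSeqColim (fun n => (hcomp (sN n) (sM n)).hom) (fun n => (hcomp (ιN n) (ιM n)).hom) := by
  have := hT.preserves_pullbacks
  have := hT.preserves_nested _ (isNested_ofSequence _ hsM)
  refine IsSeqColim.of_isPullback (fun n => inferInstanceAs (Mono (T.map (sM n).hom))) hsN
    (fun n => inferInstanceAs (Mono (𝟙 _))) (fun n => isPullback_comp (N n) (M n))
    (fun n => hcomp_fst _ _) (fun n => hcomp_snd _ _) (fun n => ?_) (fun n => ?_)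
    (hM.map T.toFunctor) hN (isSeqColim_const (T.obj S)) (fun n => hcomp_fst _ _)
    (fun n => hcomp_snd _ _) (fun n => ?_) (fun n => ?_) (isPullback_comp N' M')
  · rw [← T.map_comp, (sM n).w_cod, Category.comp_id]
  · rw [(sN n).w_dom, Category.comp_id]
  · rw [← T.map_comp, (ιM n).w_cod, Category.comp_id]
  · rw [(ιN n).w_dom, Category.comp_id]

end Sequences

end TSpan

/-! ### Sums of spans -/

namespace TSpan

variable {E : Type u} [Category.{v} E] {T : Monad E} {R S : E}

section Sums

variable [HasFiniteCoproducts E]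

/-- The coproduct of two spans. -/
noncomputable def sum (M N : TSpan T R S) : TSpan T R S where
  apex := M.apex ⨿ N.apex
  dom := coprod.desc M.dom N.dom
  cod := coprod.desc M.cod N.cod

/-- The first coprojection. -/
noncomputable def sumInl (M N : TSpan T R S) : M ⟶ sum M N :=
  ⟨coprod.inl, coprod.inl_desc _ _, coprod.inl_desc _ _⟩

/-- The second coprojection. -/
noncomputable def sumInr (M N : TSpan T R S) : N ⟶ sum M N :=
  ⟨coprod.inr, coprod.inr_desc _ _, coprod.inr_desc _ _⟩

lemma isSum_sum (M N : TSpan T R S) : IsSum (sumInl M N).hom (sumInr M N).hom :=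
  isSum_coprod _ _

/-- The copairing of maps of spans over given maps of feet. -/
noncomputable def OverHom.sumDesc {R' S' : E} {g : R ⟶ R'} {f : S ⟶ S'} {M N : TSpan T R S}
    {L : TSpan T R' S'} (p : OverHom g f M L) (q : OverHom g f N L) : OverHom g f (sum M N) L where
  hom := coprod.desc p.hom q.hom
  w_dom := (isSum_sum M N).hom_ext _ _
    ((coprod.inl_desc_assoc _ _ _).trans (p.w_dom.trans (coprod.inl_desc_assoc _ _ _).symm))
    ((coprod.inr_desc_assoc _ _ _).trans (q.w_dom.trans (coprod.inr_desc_assoc _ _ _).symm))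
  w_cod := (isSum_sum M N).hom_ext _ _
    ((coprod.inl_desc_assoc _ _ _).trans (p.w_cod.trans (coprod.inl_desc_assoc _ _ _).symm))
    ((coprod.inr_desc_assoc _ _ _).trans (q.w_cod.trans (coprod.inr_desc_assoc _ _ _).symm))

/-- The copairing of 2-cells. -/
noncomputable def sumDesc {M N L : TSpan T R S} (p : M ⟶ L) (q : N ⟶ L) : sum M N ⟶ L where
  hom := coprod.desc p.hom q.hom
  w_dom := (isSum_sum M N).hom_ext _ _
    ((coprod.inl_desc_assoc _ _ _).trans (p.w_dom.trans (coprod.inl_desc _ _).symm))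
    ((coprod.inr_desc_assoc _ _ _).trans (q.w_dom.trans (coprod.inr_desc _ _).symm))
  w_cod := (isSum_sum M N).hom_ext _ _
    ((coprod.inl_desc_assoc _ _ _).trans (p.w_cod.trans (coprod.inl_desc _ _).symm))
    ((coprod.inr_desc_assoc _ _ _).trans (q.w_cod.trans (coprod.inr_desc _ _).symm))

section

variable {R' S' : E} {g : R ⟶ R'} {f : S ⟶ S'} {M N : TSpan T R S} {L : TSpan T R' S'}
  (p : OverHom g f M L) (q : OverHom g f N L)

@[simp] lemma sumInl_overDesc : (sumInl M N).hom ≫ (OverHom.sumDesc p q).hom = p.hom :=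
  coprod.inl_desc _ _

@[simp] lemma sumInr_overDesc : (sumInr M N).hom ≫ (OverHom.sumDesc p q).hom = q.hom :=
  coprod.inr_desc _ _

end

section

variable {M N L : TSpan T R S} (p : M ⟶ L) (q : N ⟶ L)

@[simp] lemma sumInl_desc : sumInl M N ≫ sumDesc p q = p := hom_ext (coprod.inl_desc _ _)

@[simp] lemma sumInr_desc : sumInr M N ≫ sumDesc p q = q := hom_ext (coprod.inr_desc _ _)

end

lemma sum_hom_ext {M N L : TSpan T R S} {f g : sum M N ⟶ L} (h : sumInl M N ≫ f = sumInl M N ≫ g)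
    (h' : sumInr M N ≫ f = sumInr M N ≫ g) : f = g :=
  hom_ext ((isSum_sum M N).hom_ext _ _ (congrArg Hom.hom h) (congrArg Hom.hom h'))

end Sums

end TSpan

open TSpan

/-! ### Free actions of a graph as colimits of finite approximations -/

section FreeActions

variable {E : Type u} [Category.{v} E] [IsSuitableCategory E] {T : Monad E} {R R' : E}

/-- The finite approximations to the free `X`-action on `B`. -/
noncomputable def approx (X : TGraph T) (B : TSpan T R X.obj) : ℕ → TSpan T R X.obj
  | 0 => B
  | n + 1 => sum B (X.span.comp (approx X B n))

/-- The inclusions of the finite approximations. -/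
noncomputable def approxStep (X : TGraph T) (B : TSpan T R X.obj) :
    ∀ n, approx X B n ⟶ approx X B (n + 1)
  | 0 => sumInl B (X.span.comp B)
  | n + 1 => sumDesc (sumInl _ _) (hcomp (𝟙 _) (approxStep X B n) ≫ sumInr _ _)

/-- The maps from the finite approximations induced by an action. -/
noncomputable def tower {X : TGraph T} {B W : TSpan T R X.obj} (u : B ⟶ W)
    (a : X.span.comp W ⟶ W) : ∀ n, approx X B n ⟶ W
  | 0 => u
  | n + 1 => sumDesc u (hcomp (𝟙 _) (tower u a n) ≫ a)

/-- Functoriality of the finite approximations. -/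
noncomputable def approxMap {X Y : TGraph T} {g : R ⟶ R'} {B : TSpan T R X.obj}
    {B' : TSpan T R' Y.obj} (k : X ⟶ Y) (β : OverHom g k.obj B B') :
    ∀ n, OverHom g k.obj (approx X B n) (approx Y B' n)
  | 0 => β
  | n + 1 => OverHom.sumDesc (β.postcomp (sumInl _ _))
      ((cmp k.over (approxMap k β n)).postcomp (sumInr _ _))

/-- `u` and `a` exhibit `W` as the free `X`-action on `B`, in that `W` is the colimit of the finite
approximations. -/
def IsFreeAct {X : TGraph T} {B W : TSpan T R X.obj} (u : B ⟶ W) (a : X.span.comp W ⟶ W) : Prop :=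
  IsSeqColim (fun n => (approxStep X B n).hom) (fun n => (tower u a n).hom)

/-- The inclusion of the generators in an approximation. -/
noncomputable def approxInl (X : TGraph T) (B : TSpan T R X.obj) (n : ℕ) :
    B ⟶ approx X B (n + 1) :=
  sumInl B (X.span.comp (approx X B n))

/-- The inclusion of the composites with an approximation in the next one. -/
noncomputable def approxInr (X : TGraph T) (B : TSpan T R X.obj) (n : ℕ) :
    X.span.comp (approx X B n) ⟶ approx X B (n + 1) :=
  sumInr B (X.span.comp (approx X B n))

lemma isSum_approx (X : TGraph T) (B : TSpan T R X.obj) (n : ℕ) :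
    IsSum (approxInl X B n).hom (approxInr X B n).hom :=
  isSum_sum _ _

lemma approx_hom_ext {X : TGraph T} {B L : TSpan T R X.obj} {n : ℕ} {f g : approx X B (n + 1) ⟶ L}
    (h : approxInl X B n ≫ f = approxInl X B n ≫ g)
    (h' : approxInr X B n ≫ f = approxInr X B n ≫ g) : f = g :=
  sum_hom_ext h h'

section

variable (X : TGraph T) (B : TSpan T R X.obj)

lemma approxInl_step (n : ℕ) : approxInl X B n ≫ approxStep X B (n + 1) = approxInl X B (n + 1) :=
  sumInl_desc _ _

lemma approxInr_step (n : ℕ) : approxInr X B n ≫ approxStep X B (n + 1) =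
    hcomp (𝟙 _) (approxStep X B n) ≫ approxInr X B (n + 1) :=
  sumInr_desc _ _

end

section

variable {X : TGraph T} {B W : TSpan T R X.obj} (u : B ⟶ W) (a : X.span.comp W ⟶ W)

lemma approxInl_tower (n : ℕ) : approxInl X B n ≫ tower u a (n + 1) = u :=
  sumInl_desc _ _

lemma approxInr_tower (n : ℕ) : approxInr X B n ≫ tower u a (n + 1) =
    hcomp (𝟙 _) (tower u a n) ≫ a :=
  sumInr_desc _ _

lemma approxInl_tower_hom (n : ℕ) : (approxInl X B n).hom ≫ (tower u a (n + 1)).hom = u.hom :=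
  congrArg Hom.hom (approxInl_tower u a n)

lemma approxInr_tower_hom (n : ℕ) : (approxInr X B n).hom ≫ (tower u a (n + 1)).hom =
    (hcomp (𝟙 _) (tower u a n)).hom ≫ a.hom :=
  congrArg Hom.hom (approxInr_tower u a n)

lemma approxStep_tower (n : ℕ) : approxStep X B n ≫ tower u a (n + 1) = tower u a n := by
  induction n with
  | zero => exact sumInl_desc _ _
  | succ n ih =>
    refine approx_hom_ext ?_ ?_
    · rw [← Category.assoc, approxInl_step, approxInl_tower, approxInl_tower]
    · rw [← Category.assoc, approxInr_step, Category.assoc, approxInr_tower, approxInr_tower,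
        ← Category.assoc, ← hcomp_comp, Category.comp_id, ih]

lemma approxStep_tower_hom (n : ℕ) :
    (approxStep X B n).hom ≫ (tower u a (n + 1)).hom = (tower u a n).hom :=
  congrArg Hom.hom (approxStep_tower u a n)

end

section

variable {X Y : TGraph T} {g : R ⟶ R'} {B : TSpan T R X.obj}
    {B' : TSpan T R' Y.obj} (k : X ⟶ Y) (β : OverHom g k.obj B B') (n : ℕ)

lemma approxInl_map : (approxInl X B n).hom ≫ (approxMap k β (n + 1)).hom =
    β.hom ≫ (approxInl Y B' n).hom :=
  sumInl_overDesc _ _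

lemma approxInr_map : (approxInr X B n).hom ≫ (approxMap k β (n + 1)).hom =
    (cmp k.over (approxMap k β n)).hom ≫ (approxInr Y B' n).hom :=
  sumInr_overDesc _ _

lemma hcomp_cmp_over {M M₁ : TSpan T R X.obj} {M' M₁' : TSpan T R' Y.obj}
    {φ : OverHom g k.obj M M'} {φ₁ : OverHom g k.obj M₁ M₁'} {m : M ⟶ M₁} {m' : M' ⟶ M₁'}
    (h : m.hom ≫ φ₁.hom = φ.hom ≫ m'.hom) : (hcomp (𝟙 X.span) m).hom ≫ (cmp k.over φ₁).hom =
      (cmp k.over φ).hom ≫ (hcomp (𝟙 Y.span) m').hom :=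
  hcomp_cmp ((Category.id_comp _).trans (Category.comp_id _).symm) h

lemma approxStep_approxMap :
    (approxStep X B n).hom ≫ (approxMap k β (n + 1)).hom =
      (approxMap k β n).hom ≫ (approxStep Y B' n).hom := by
  induction n with
  | zero => exact sumInl_overDesc _ _
  | succ n ih =>
    refine (isSum_approx _ _ _).hom_ext _ _ ?_ ?_
    · rw [← Category.assoc, ← comp_hom, approxInl_step, approxInl_map, ← Category.assoc,
        approxInl_map, Category.assoc, ← comp_hom, approxInl_step]
    · rw [← Category.assoc, ← comp_hom, approxInr_step, comp_hom, Category.assoc, approxInr_map,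
        ← Category.assoc, hcomp_cmp_over k ih, ← Category.assoc, approxInr_map, Category.assoc,
        Category.assoc, ← comp_hom, ← comp_hom, approxInr_step]

end

/-- A map of actions commutes with the maps from the finite approximations. -/
lemma tower_comp {X Y : TGraph T} {g : R ⟶ R'} {B W : TSpan T R X.obj}
    {B' W' : TSpan T R' Y.obj} {u : B ⟶ W} {a : X.span.comp W ⟶ W} {u' : B' ⟶ W'}
    {a' : Y.span.comp W' ⟶ W'} {k : X ⟶ Y} {β : OverHom g k.obj B B'} {φ : OverHom g k.obj W W'}
    (hu : u.hom ≫ φ.hom = β.hom ≫ u'.hom) (ha : a.hom ≫ φ.hom = (cmp k.over φ).hom ≫ a'.hom)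
    (n : ℕ) : (tower u a n).hom ≫ φ.hom = (approxMap k β n).hom ≫ (tower u' a' n).hom := by
  induction n with
  | zero => exact hu
  | succ n ih =>
    refine (isSum_approx _ _ _).hom_ext _ _ ?_ ?_
    · rw [← Category.assoc, approxInl_tower_hom, hu, ← Category.assoc, approxInl_map,
        Category.assoc, approxInl_tower_hom]
    · rw [← Category.assoc, approxInr_tower_hom, Category.assoc, ha, ← Category.assoc,
        hcomp_cmp_over k ih, ← Category.assoc, approxInr_map,
        Category.assoc, Category.assoc, approxInr_tower_hom]

/-- The first step is a coprojection; each later one is the sum of an identity with the composite of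
`X` and the previous step. -/
lemma mono_approxStep [PreservesLimitsOfShape WalkingCospan T.toFunctor] (X : TGraph T)
    (B : TSpan T R X.obj) (n : ℕ) : Mono (approxStep X B n).hom := by
  induction n with
  | zero => exact (isSum_sum _ _).mono_left
  | succ n ih =>
    have : Mono (hcomp (𝟙 X.span) (approxStep X B n)).hom := by
      have : Mono (𝟙 X.span : X.span ⟶ X.span).hom := inferInstanceAs (Mono (𝟙 X.span.apex))
      exact mono_hcomp _ _
    exact (isSum_approx X B n).mono (isSum_approx X B (n + 1))
      ((congrArg Hom.hom (approxInl_step X B n)).trans (Category.id_comp _).symm)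
      (congrArg Hom.hom (approxInr_step X B n))

section

variable {X : TGraph T} {B W : TSpan T R X.obj}

lemma isSeqColim_hcomp_id_left (hT : IsSuitableMonad T) {M : ℕ → TSpan T R X.obj}
    {s : ∀ n, M n ⟶ M (n + 1)}
    {ι : ∀ n, M n ⟶ W} (hs : ∀ n, Mono (s n).hom)
    (h : IsSeqColim (fun n => (s n).hom) (fun n => (ι n).hom)) :
    IsSeqColim (fun n => (hcomp (𝟙 X.span) (s n)).hom) (fun n => (hcomp (𝟙 X.span) (ι n)).hom) :=
  isSeqColim_hcomp hT (fun _ => inferInstanceAs (Mono (𝟙 _))) hs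
    (isSeqColim_const X.span.apex) h

lemma isSeqColim_hcomp_id_right (hT : IsSuitableMonad T) {S : E} (B : TSpan T R S)
    {M : ℕ → TSpan T S X.obj}
    {s : ∀ n, M n ⟶ M (n + 1)} {W : TSpan T S X.obj}
    {ι : ∀ n, M n ⟶ W} (hs : ∀ n, Mono (s n).hom)
    (h : IsSeqColim (fun n => (s n).hom) (fun n => (ι n).hom)) :
    IsSeqColim (fun n => (hcomp (s n) (𝟙 B)).hom) (fun n => (hcomp (ι n) (𝟙 B)).hom) :=
  isSeqColim_hcomp hT hs (fun _ => inferInstanceAs (Mono (𝟙 _))) h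
    (isSeqColim_const B.apex)

/-- Composition with `X` preserves the colimit that presents `W`. -/
lemma IsFreeAct.act_hom_ext (hT : IsSuitableMonad T) {u : B ⟶ W} {a : X.span.comp W ⟶ W}
    (h : IsFreeAct u a) {Z : E}
    {f g : (X.span.comp W).apex ⟶ Z}
    (hfg : ∀ n, (hcomp (𝟙 X.span) (tower u a n)).hom ≫ f =
      (hcomp (𝟙 X.span) (tower u a n)).hom ≫ g) : f = g := by
  have := hT.preserves_pullbacks
  exact (isSeqColim_hcomp_id_left hT (mono_approxStep X B) h).hom_ext _ _ hfg

/-- The free action on `B` is the coproduct of `B` and its composite with `X`. -/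
lemma IsFreeAct.isSum (hT : IsSuitableMonad T) {u : B ⟶ W} {a : X.span.comp W ⟶ W}
    (h : IsFreeAct u a) :
    IsSum u.hom a.hom where
  exists_desc {Z} f g := by
    -- A map is defined on each stage `n + 1` as the copairing of `f` with the restriction of `g`;
    -- the colimit is then taken over the shifted sequence, where every stage is a sum.
    choose k hk hk' using fun n =>
      (isSum_approx X B n).exists_desc f ((hcomp (𝟙 X.span) (tower u a n)).hom ≫ g)
    obtain ⟨d, hd⟩ := h.shift.exists_desc k (fun n => by
      refine (isSum_approx X B n).hom_ext _ _ ?_ ?_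
      · rw [← Category.assoc, ← comp_hom, approxInl_step, hk, hk]
      · rw [← Category.assoc, ← comp_hom, approxInr_step, comp_hom, Category.assoc, hk', hk',
          ← Category.assoc, ← comp_hom, ← hcomp_comp, Category.comp_id, approxStep_tower])
    refine ⟨d, ?_, h.act_hom_ext hT fun n => ?_⟩
    · rw [← approxInl_tower_hom u a 0, Category.assoc, hd, hk]
    · rw [← Category.assoc, ← approxInr_tower_hom u a n, Category.assoc, hd, hk']
  hom_ext f g hu ha := h.shift.hom_ext _ _ fun n => (isSum_approx X B n).hom_ext _ _
    (by rw [← Category.assoc, approxInl_tower_hom, hu, ← Category.assoc, approxInl_tower_hom])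
    (by rw [← Category.assoc, approxInr_tower_hom, ← Category.assoc, approxInr_tower_hom,
      Category.assoc, ha, Category.assoc])

lemma exists_isFreeAct (hT : IsSuitableMonad T) (X : TGraph T) (B : TSpan T R X.obj) :
    ∃ (W : TSpan T R X.obj) (u : B ⟶ W) (a : X.span.comp W ⟶ W), IsFreeAct u a := by
  have := hT.preserves_pullbacks
  have hs := mono_approxStep X B
  have hs' (n : ℕ) : Mono (approxStep X B n) := by
    have := hs n
    exact ⟨fun f g hfg => hom_ext ((cancel_mono (approxStep X B n).hom).1
      (congrArg Hom.hom hfg))⟩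
  -- The colimit is formed among spans, so that the coprojections are 2-cells; it becomes a colimit
  -- of apexes afterwards.
  obtain ⟨W, ι, hι⟩ := exists_isSeqColim (approxStep X B) hs'
  have := IsSuitableCategory.hasColimit_nested _
    (isNested_apex (isNested_ofSequence (approxStep X B) hs'))
  have := preservesColimit (Functor.ofSequence (approxStep X B))
  have h : IsSeqColim (fun n => (approxStep X B n).hom) (fun n => (ι n).hom) :=
    hι.map (apexFunctor T R X.obj)
  have hX := isSeqColim_hcomp_id_left hT hs h
  -- `X ∘ W` is the colimit of the `X ∘ Aₙ`, and each of these includes in the next approximation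
  -- `Aₙ₊₁`; this is the action.
  obtain ⟨a, ha⟩ := hX.exists_desc (fun n => (approxInr X B n ≫ ι (n + 1)).hom) (fun n => by
    rw [← comp_hom, ← Category.assoc, ← approxInr_step, Category.assoc, hι.w])
  have ha_dom : a ≫ W.dom = (X.span.comp W).dom := hX.hom_ext _ _ fun n => by
    rw [← Category.assoc, ha, Hom.w_dom, Hom.w_dom]
  have ha_cod : a ≫ W.cod = (X.span.comp W).cod := hX.hom_ext _ _ fun n => by
    rw [← Category.assoc, ha, Hom.w_cod, Hom.w_cod]
  obtain ⟨u, hu⟩ : ∃ u : B ⟶ W, u = ι 0 := ⟨ι 0, rfl⟩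
  have inl_eq (n : ℕ) : approxInl X B n ≫ ι (n + 1) = u := by
    induction n with
    | zero => exact (hι.w 0).trans hu.symm
    | succ n ih => rw [← ih, ← hι.w (n + 1), ← Category.assoc, approxInl_step]
  -- The maps generated by this action are the original coprojections, so the colimit just formed is
  -- of the form that `IsFreeAct` requires.
  have key (n : ℕ) : tower u (⟨a, ha_dom, ha_cod⟩ : X.span.comp W ⟶ W) n = ι n := by
    induction n with
    | zero => exact hu
    | succ n ih =>
      refine approx_hom_ext ?_ ?_
      · rw [approxInl_tower, inl_eq]
      · rw [approxInr_tower, ih]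
        exact hom_ext (ha n)
  refine ⟨W, u, ⟨a, ha_dom, ha_cod⟩, ?_⟩
  have e : ι = tower u (⟨a, ha_dom, ha_cod⟩ : X.span.comp W ⟶ W) :=
    funext fun n => (key n).symm
  rw [e] at h
  exact h

/-- The universal property of the free action, with respect to actions of graphs on other
objects. -/
lemma IsFreeAct.exists_lift (hT : IsSuitableMonad T) {u : B ⟶ W} {a : X.span.comp W ⟶ W}
    (h : IsFreeAct u a)
    {Y : TGraph T} {g : R ⟶ R'} {B' W' : TSpan T R' Y.obj} (u' : B' ⟶ W')
    (a' : Y.span.comp W' ⟶ W') (k : X ⟶ Y) (β : OverHom g k.obj B B') :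
    ∃ φ : OverHom g k.obj W W', u.hom ≫ φ.hom = β.hom ≫ u'.hom ∧
      a.hom ≫ φ.hom = (cmp k.over φ).hom ≫ a'.hom := by
  -- On each approximation the only possible value is to map generators and labels forward and then
  -- evaluate in the target action.
  obtain ⟨d, hd⟩ := h.exists_desc (fun n => (approxMap k β n).hom ≫ (tower u' a' n).hom)
    (fun n => by
      rw [← Category.assoc, approxStep_approxMap, Category.assoc, approxStep_tower_hom])
  have hd_dom : d ≫ W'.dom = W.dom ≫ T.map g := h.hom_ext _ _ fun n => by
    rw [← Category.assoc, hd, Category.assoc, (tower u' a' n).w_dom, (approxMap k β n).w_dom,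
      ← Category.assoc, (tower u a n).w_dom]
  have hd_cod : d ≫ W'.cod = W.cod ≫ k.obj := h.hom_ext _ _ fun n => by
    rw [← Category.assoc, hd, Category.assoc, (tower u' a' n).w_cod, (approxMap k β n).w_cod,
      ← Category.assoc, (tower u a n).w_cod]
  refine ⟨⟨d, hd_dom, hd_cod⟩, hd 0, h.act_hom_ext hT fun n => ?_⟩
  have e := hcomp_cmp_over k (φ := approxMap k β n)
    (φ₁ := (⟨d, hd_dom, hd_cod⟩ : OverHom g k.obj W W'))
    (m := tower u a n) (m' := tower u' a' n) (hd n)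
  rw [← Category.assoc, ← Category.assoc, e, ← approxInr_tower_hom u a n, Category.assoc, hd,
    Category.assoc, ← approxInr_tower_hom u' a' n, ← Category.assoc, approxInr_map,
    Category.assoc]

lemma IsFreeAct.lift_ext {u : B ⟶ W} {a : X.span.comp W ⟶ W} (h : IsFreeAct u a)
    {Y : TGraph T} {g : R ⟶ R'} {W' : TSpan T R' Y.obj}
    {a' : Y.span.comp W' ⟶ W'} {k : X ⟶ Y} {φ ψ : OverHom g k.obj W W'}
    (hu : u.hom ≫ φ.hom = u.hom ≫ ψ.hom) (ha : a.hom ≫ φ.hom = (cmp k.over φ).hom ≫ a'.hom)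
    (hb : a.hom ≫ ψ.hom = (cmp k.over ψ).hom ≫ a'.hom) : φ.hom = ψ.hom := by
  refine h.hom_ext _ _ fun n => ?_
  -- With generators mapped directly into `W'`, both maps have the same restriction to every
  -- approximation: evaluation starting from the identity inclusion of `W'`.
  let β : OverHom g k.obj B W' := ⟨u.hom ≫ φ.hom, by
    rw [Category.assoc, φ.w_dom, ← Category.assoc, u.w_dom], by
    rw [Category.assoc, φ.w_cod, ← Category.assoc, u.w_cod]⟩
  have e₁ := tower_comp (u := u) (u' := 𝟙 W') (β := β) (Category.comp_id _).symm ha n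
  have e₂ := tower_comp (u := u) (u' := 𝟙 W') (β := β)
    (hu.symm.trans (Category.comp_id _).symm) hb n
  rw [e₁, e₂]

end

end FreeActions

/-! ### Further unit and exchange laws -/

namespace TSpan

section Units

variable {E : Type u} [Category.{v} E] {T : Monad E} [HasPullbacks E] {R S Q : E}

lemma rightUnit_assoc (N : TSpan T S Q) (M : TSpan T R S) :
    hcomp (𝟙 N) M.rightUnit ≫ assoc N M (unit T R) = (N.comp M).rightUnit := by
  apply hom_ext
  apply comp_hom_ext
  · rw [comp_hom, Category.assoc, assoc_fst, hcomp_fst_assoc, rightUnit_fst, T_map_comp_assoc,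
      rightUnit_fst]
    rfl
  · apply comp_hom_ext
    · rw [comp_hom, Category.assoc, Category.assoc, assoc_snd_fst, hcomp_fst_assoc,
        ← T.map_comp, rightUnit_snd, T.map_id, rightUnit_snd, Category.comp_id,
        Category.id_comp]
    · rw [comp_hom, Category.assoc, Category.assoc, assoc_snd_snd, hcomp_snd,
        id_hom, rightUnit_snd, Category.comp_id, Category.id_comp]

lemma leftUnit_unit (S : E) : (unit T S).leftUnit = (unit T S).rightUnit := by
  apply hom_ext
  apply comp_hom_ext
  · rw [leftUnit_fst, rightUnit_fst]
  · rw [leftUnit_snd, rightUnit_snd]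

lemma hcomp_id_comp {N : TSpan T S Q} {M M' M'' : TSpan T R S} (f : M ⟶ M') (g : M' ⟶ M'') :
    hcomp (𝟙 N) (f ≫ g) = hcomp (𝟙 N) f ≫ hcomp (𝟙 N) g := by
  rw [← hcomp_comp, Category.comp_id]

lemma hcomp_comp_id {N N' N'' : TSpan T S Q} {M : TSpan T R S} (f : N ⟶ N') (g : N' ⟶ N'') :
    hcomp (f ≫ g) (𝟙 M) = hcomp f (𝟙 M) ≫ hcomp g (𝟙 M) := by
  rw [← hcomp_comp, Category.comp_id]

lemma hcomp_exchange {N N' : TSpan T S Q} {M M' : TSpan T R S} (g : N ⟶ N') (f : M ⟶ M') :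
    hcomp g (𝟙 M) ≫ hcomp (𝟙 N') f = hcomp (𝟙 N) f ≫ hcomp g (𝟙 M') := by
  rw [← hcomp_comp, ← hcomp_comp, Category.id_comp, Category.comp_id, Category.id_comp,
    Category.comp_id]

lemma hcomp_exchange_assoc {N N' : TSpan T S Q} {M M' : TSpan T R S} (g : N ⟶ N') (f : M ⟶ M')
    {L : TSpan T R Q} (k : N'.comp M' ⟶ L) :
    hcomp g (𝟙 M) ≫ hcomp (𝟙 N') f ≫ k = hcomp (𝟙 N) f ≫ hcomp g (𝟙 M') ≫ k := by
  rw [← Category.assoc, hcomp_exchange, Category.assoc]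

lemma assoc_naturality_left {O : E} {P P' : TSpan T Q O} (p : P ⟶ P') (N : TSpan T S Q)
    (M : TSpan T R S) : hcomp p (𝟙 (N.comp M)) ≫ assoc P' N M =
      assoc P N M ≫ hcomp (hcomp p (𝟙 N)) (𝟙 M) := by
  rw [← hcomp_id, assoc_naturality]

lemma assoc_naturality_right {O : E} (P : TSpan T Q O) (N : TSpan T S Q)
    {M M' : TSpan T R S} (m : M ⟶ M') : hcomp (𝟙 P) (hcomp (𝟙 N) m) ≫ assoc P N M' =
      assoc P N M ≫ hcomp (𝟙 (P.comp N)) m := by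
  rw [assoc_naturality, hcomp_id]

lemma hcomp_leftUnit_assoc (N : TSpan T S Q) (M : TSpan T R S) :
    hcomp (𝟙 N) M.leftUnit ≫ assoc N (unit T S) M = hcomp N.rightUnit (𝟙 M) := by
  apply hom_ext
  apply comp_hom_ext
  · rw [comp_hom, Category.assoc, assoc_fst, hcomp_fst_assoc, T_map_comp_assoc, leftUnit_fst,
      T.right_unit, hcomp_fst, id_hom, T.map_id]
    rfl
  · apply comp_hom_ext
    · rw [comp_hom, Category.assoc, Category.assoc, assoc_snd_fst, hcomp_fst_assoc,
        ← T.map_comp, leftUnit_snd, hcomp_snd, Category.assoc, rightUnit_fst,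
        (isPullback_comp N M).w]
    · rw [comp_hom, Category.assoc, Category.assoc, assoc_snd_snd, hcomp_snd, id_hom,
        Category.comp_id, hcomp_snd, Category.assoc, rightUnit_snd, Category.comp_id]

/-- Composing with `M` on the right is base change along `T M.cod`. Sums being universal, this
functor therefore preserves them. -/
lemma isPullback_hcomp_snd {N N' : TSpan T S Q} (f : N ⟶ N') (M : TSpan T R S) :
    IsPullback (hcomp f (𝟙 M)).hom (snd N M) (snd N' M) f.hom := by
  refine (IsPullback.of_bot (v₂₁ := fst N' M) (v₂₂ := N'.dom) (h₃₁ := T.map M.cod) ?_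
    (hcomp_snd f (𝟙 M)).symm (isPullback_comp N' M).flip).flip
  have := (isPullback_comp N M).flip
  rw [hcomp_fst, f.w_dom, id_hom, T.map_id, Category.comp_id]
  exact this

end Units

end TSpan

/-! ### Composites of free actions are free -/

section FreeActions

variable {E : Type u} [Category.{v} E] [IsSuitableCategory E] {T : Monad E} {R R' S : E}

/-- The finite approximations to the free action on `I ∘ B` are composites of those to the free
action on `I` with `B`. -/
noncomputable def approxComp (X : TGraph T) (I : TSpan T S X.obj) (B : TSpan T R S) :
    ∀ n, approx X (I.comp B) n ⟶ (approx X I n).comp B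
  | 0 => 𝟙 _
  | n + 1 => sumDesc (hcomp (approxInl X I n) (𝟙 B))
      (hcomp (𝟙 X.span) (approxComp X I B n) ≫ assoc X.span (approx X I n) B ≫
        hcomp (approxInr X I n) (𝟙 B))

section

variable (X : TGraph T) (I : TSpan T S X.obj) (B : TSpan T R S)

lemma approxInl_comp (n : ℕ) : approxInl X (I.comp B) n ≫ approxComp X I B (n + 1) =
    hcomp (approxInl X I n) (𝟙 B) :=
  sumInl_desc _ _

lemma approxInr_comp (n : ℕ) : approxInr X (I.comp B) n ≫ approxComp X I B (n + 1) =
    hcomp (𝟙 X.span) (approxComp X I B n) ≫ assoc X.span (approx X I n) B ≫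
      hcomp (approxInr X I n) (𝟙 B) :=
  sumInr_desc _ _

lemma isIso_approxComp (hT : IsCartesianMonad T) (n : ℕ) : IsIso (approxComp X I B n) := by
  induction n with
  | zero => exact inferInstanceAs (IsIso (𝟙 _))
  | succ n ih =>
    have := isIso_assoc hT X.span (approx X I n) B
    -- Right composition with `B` carries the sum at stage `n + 1` to a sum; its second summand is
    -- identified with the one for `I ∘ B` by associativity and the previous stage.
    have h : IsSum (hcomp (approxInl X I n) (𝟙 B)).hom (hcomp (approxInr X I n) (𝟙 B)).hom :=
      (isSum_approx X I n).universal (isPullback_hcomp_snd _ B) (isPullback_hcomp_snd _ B)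
    have h' := h.iso_comp (𝟙 _)
      (hcomp (𝟙 X.span) (approxComp X I B n) ≫ assoc X.span (approx X I n) B).hom
    rw [Category.id_comp, ← comp_hom, Category.assoc] at h'
    have := (isSum_approx X (I.comp B) n).isIso_of_comp h' (approxComp X I B (n + 1)).hom
      (congrArg Hom.hom (approxInl_comp X I B n)) (congrArg Hom.hom (approxInr_comp X I B n))
    exact isIso_of_hom _

lemma approxStep_comp (n : ℕ) : approxStep X (I.comp B) n ≫ approxComp X I B (n + 1) =
    approxComp X I B n ≫ hcomp (approxStep X I n) (𝟙 B) := by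
  induction n with
  | zero => exact (approxInl_comp X I B 0).trans (Category.id_comp _).symm
  | succ n ih =>
    refine approx_hom_ext ?_ ?_
    · rw [← Category.assoc, approxInl_step, approxInl_comp, ← Category.assoc, approxInl_comp,
        ← hcomp_comp_id, approxInl_step]
    · rw [← Category.assoc, approxInr_step, Category.assoc, approxInr_comp,
        ← Category.assoc (approxInr X (I.comp B) n), approxInr_comp, ← Category.assoc, ← hcomp_id_comp,
        ih, Category.assoc, Category.assoc,
        ← hcomp_comp_id, approxInr_step, hcomp_comp_id, hcomp_id_comp, Category.assoc,
        ← Category.assoc (assoc _ _ _), ← assoc_naturality, Category.assoc]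

lemma tower_approxComp {X : TGraph T} {I W : TSpan T S X.obj} (B : TSpan T R S) (u : I ⟶ W)
    (a : X.span.comp W ⟶ W) (n : ℕ) :
    approxComp X I B n ≫ hcomp (tower u a n) (𝟙 B) =
      tower (hcomp u (𝟙 B)) (assoc X.span W B ≫ hcomp a (𝟙 B)) n := by
  induction n with
  | zero => exact Category.id_comp _
  | succ n ih =>
    refine approx_hom_ext ?_ ?_
    · rw [← Category.assoc, approxInl_comp, ← hcomp_comp_id, approxInl_tower, approxInl_tower]
    · rw [← Category.assoc, approxInr_comp, Category.assoc, Category.assoc, ← hcomp_comp_id,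
        approxInr_tower, approxInr_tower, ← ih, hcomp_comp_id, hcomp_id_comp, Category.assoc,
        ← Category.assoc (assoc _ _ _), ← assoc_naturality, Category.assoc]

end

/-- Composites of free actions with spans are free actions. -/
lemma IsFreeAct.hcomp (hT : IsSuitableMonad T) {X : TGraph T} {I W : TSpan T S X.obj} {u : I ⟶ W}
    {a : X.span.comp W ⟶ W} (h : IsFreeAct u a) (B : TSpan T R S) :
    IsFreeAct (TSpan.hcomp u (𝟙 B)) (assoc X.span W B ≫ TSpan.hcomp a (𝟙 B)) := by
  have := hT.preserves_pullbacks
  have := fun n => isIso_approxComp X I B hT.toIsCartesianMonad n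
  -- Right composition with `B` also preserves the colimit of approximations, which is then
  -- transported along the stagewise isomorphisms.
  have h' := (isSeqColim_hcomp_id_right hT B (mono_approxStep X I) h).iso
    (t := fun n => (approxStep X (I.comp B) n).hom)
    (fun n => (approxComp X I B n).hom) (fun n => congrArg Hom.hom (approxStep_comp X I B n))
  have e : (fun n => (approxComp X I B n).hom ≫ (TSpan.hcomp (tower u a n) (𝟙 B)).hom) =
      fun n => (tower (TSpan.hcomp u (𝟙 B)) (assoc X.span W B ≫ TSpan.hcomp a (𝟙 B)) n).hom :=
    funext fun n => congrArg Hom.hom (tower_approxComp B u a n)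
  rw [e] at h'
  exact h'

namespace TSpan

/-- A 2-cell as a map over identities. -/
def Hom.over {M N : TSpan T R S} (f : M ⟶ N) : OverHom (𝟙 R) (𝟙 S) M N where
  hom := f.hom
  w_dom := by rw [f.w_dom, T.map_id, Category.comp_id]
  w_cod := by rw [f.w_cod, Category.comp_id]

/-- A map over identities as a 2-cell. -/
def OverHom.toHom {M N : TSpan T R S} (f : OverHom (𝟙 R) (𝟙 S) M N) : M ⟶ N where
  hom := f.hom
  w_dom := by rw [f.w_dom, T.map_id, Category.comp_id]
  w_cod := by rw [f.w_cod, Category.comp_id]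

end TSpan

section

variable {X : TGraph T} {B W W' : TSpan T R X.obj} {u : B ⟶ W} {a : X.span.comp W ⟶ W}

lemma cmp_id_over (φ : OverHom (𝟙 R) (𝟙 X.obj) W W') :
    (cmp (TGraph.Hom.over (𝟙 X)) φ).hom = (hcomp (𝟙 X.span) φ.toHom).hom :=
  comp_hom_ext ((cmp_fst _ _).trans (hcomp_fst (𝟙 X.span) φ.toHom).symm)
    ((cmp_snd _ _).trans (hcomp_snd (𝟙 X.span) φ.toHom).symm)

lemma IsFreeAct.exists_desc (hT : IsSuitableMonad T) (h : IsFreeAct u a) (u' : B ⟶ W')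
    (a' : X.span.comp W' ⟶ W') : ∃ φ : W ⟶ W', u ≫ φ = u' ∧
      a ≫ φ = TSpan.hcomp (𝟙 X.span) φ ≫ a' := by
  obtain ⟨φ, h₁, h₂⟩ := h.exists_lift hT (Y := X) u' a' (𝟙 X) (Hom.over (𝟙 B))
  refine ⟨φ.toHom, hom_ext (h₁.trans (Category.id_comp _)), hom_ext (h₂.trans ?_)⟩
  rw [cmp_id_over]
  rfl

lemma IsFreeAct.hom_ext (h : IsFreeAct u a) {a' : X.span.comp W' ⟶ W'} {φ ψ : W ⟶ W'}
    (hu : u ≫ φ = u ≫ ψ) (ha : a ≫ φ = TSpan.hcomp (𝟙 X.span) φ ≫ a')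
    (hb : a ≫ ψ = TSpan.hcomp (𝟙 X.span) ψ ≫ a') : φ = ψ := by
  refine TSpan.hom_ext (h.lift_ext (Y := X) (k := 𝟙 X) (φ := φ.over) (ψ := ψ.over) (a' := a')
    (congrArg Hom.hom hu) ?_ ?_)
  · exact (congrArg Hom.hom ha).trans (congrArg (· ≫ a'.hom) (cmp_id_over φ.over).symm)
  · exact (congrArg Hom.hom hb).trans (congrArg (· ≫ a'.hom) (cmp_id_over ψ.over).symm)

end

end FreeActions

/-! ### The free multicategory and its universal property -/

section FreeMulticategory

variable {E : Type u} [Category.{v} E] [IsSuitableCategory E] {T : Monad E}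

section

variable (hT : IsSuitableMonad T) (X : TGraph T)

/-- The span of arrows of the free multicategory on a graph. -/
noncomputable def freeSpan : TSpan T X.obj X.obj :=
  (exists_isFreeAct hT X (unit T X.obj)).choose

/-- The identities of the free multicategory on a graph. -/
noncomputable def freeIds : unit T X.obj ⟶ freeSpan hT X :=
  (exists_isFreeAct hT X (unit T X.obj)).choose_spec.choose

/-- The action of a graph on the arrows of the free multicategory on it. -/
noncomputable def freeAct : X.span.comp (freeSpan hT X) ⟶ freeSpan hT X :=
  (exists_isFreeAct hT X (unit T X.obj)).choose_spec.choose_spec.choose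

lemma isFreeAct_free : IsFreeAct (freeIds hT X) (freeAct hT X) :=
  (exists_isFreeAct hT X (unit T X.obj)).choose_spec.choose_spec.choose_spec

/-- `W ∘ W` is the free action on `1 ∘ W`, so the isomorphism `1 ∘ W ≅ W` extends to a map of
actions. The two equations are the left unit law and the compatibility with the action. -/
lemma exists_freeComp : ∃ m : (freeSpan hT X).comp (freeSpan hT X) ⟶ freeSpan hT X,
    (freeSpan hT X).leftUnit ≫ hcomp (freeIds hT X) (𝟙 _) ≫ m = 𝟙 _ ∧
    assoc X.span (freeSpan hT X) (freeSpan hT X) ≫ hcomp (freeAct hT X) (𝟙 _) ≫ m =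
      hcomp (𝟙 _) m ≫ freeAct hT X := by
  have := isIso_leftUnit hT.toIsCartesianMonad (freeSpan hT X)
  obtain ⟨m, h₁, h₂⟩ := ((isFreeAct_free hT X).hcomp hT (freeSpan hT X)).exists_desc hT
    (inv (freeSpan hT X).leftUnit) (freeAct hT X)
  exact ⟨m, by rw [h₁, IsIso.hom_inv_id], by rw [← h₂, Category.assoc]⟩

/-- The composition of the free multicategory on a graph. -/
noncomputable def freeComp : (freeSpan hT X).comp (freeSpan hT X) ⟶ freeSpan hT X :=
  (exists_freeComp hT X).choose

lemma freeIds_comp :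
    (freeSpan hT X).leftUnit ≫ hcomp (freeIds hT X) (𝟙 _) ≫ freeComp hT X = 𝟙 _ :=
  (exists_freeComp hT X).choose_spec.1

lemma freeAct_comp :
    assoc X.span (freeSpan hT X) (freeSpan hT X) ≫ hcomp (freeAct hT X) (𝟙 _) ≫ freeComp hT X =
      hcomp (𝟙 _) (freeComp hT X) ≫ freeAct hT X :=
  (exists_freeComp hT X).choose_spec.2

/-- Both sides are endomorphisms of the action `W`, free on the identities, and they agree there. -/
lemma freeComp_ids :
    (freeSpan hT X).rightUnit ≫ hcomp (𝟙 _) (freeIds hT X) ≫ freeComp hT X = 𝟙 _ := by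
  refine (isFreeAct_free hT X).hom_ext (a' := freeAct hT X) ?_ ?_ ?_
  · rw [← Category.assoc, rightUnit_naturality, Category.assoc, hcomp_exchange_assoc,
      ← leftUnit_unit, ← Category.assoc, ← leftUnit_naturality, Category.assoc, freeIds_comp]
  · rw [← Category.assoc, rightUnit_naturality, Category.assoc, hcomp_exchange_assoc,
      ← rightUnit_assoc, Category.assoc, ← Category.assoc (assoc _ _ _),
      ← assoc_naturality_right, Category.assoc, freeAct_comp, hcomp_id_comp, hcomp_id_comp,
      Category.assoc, Category.assoc]
  · rw [Category.comp_id, hcomp_id, Category.id_comp]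

/-- `W ∘ (W ∘ W)` is the free action on `1 ∘ (W ∘ W)`. Both sides are maps of actions out of it; on
generators they agree by the left unit law, and the pentagon is what makes the right-hand side a map
of actions. -/
lemma freeComp_assoc :
    hcomp (𝟙 _) (freeComp hT X) ≫ freeComp hT X =
      assoc (freeSpan hT X) (freeSpan hT X) (freeSpan hT X) ≫
        hcomp (freeComp hT X) (𝟙 _) ≫ freeComp hT X := by
  have := isIso_leftUnit hT.toIsCartesianMonad ((freeSpan hT X).comp (freeSpan hT X))
  refine ((isFreeAct_free hT X).hcomp hT ((freeSpan hT X).comp (freeSpan hT X))).hom_ext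
    (a' := freeAct hT X) ?_ ?_ ?_
  · rw [← cancel_epi ((freeSpan hT X).comp (freeSpan hT X)).leftUnit, hcomp_exchange_assoc,
      ← Category.assoc, ← leftUnit_naturality, Category.assoc, freeIds_comp, Category.comp_id,
      ← Category.assoc (hcomp (freeIds hT X) _), assoc_naturality_left, Category.assoc,
      ← Category.assoc, leftUnit_assoc, ← Category.assoc (hcomp (hcomp _ _) _),
      ← hcomp_comp_id, ← Category.assoc, ← hcomp_comp_id, freeIds_comp, hcomp_id,
      Category.id_comp]
  · rw [Category.assoc, hcomp_exchange_assoc, ← Category.assoc, ← assoc_naturality_right,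
      Category.assoc, freeAct_comp, hcomp_id_comp, Category.assoc]
  · rw [Category.assoc, ← Category.assoc (hcomp (freeAct hT X) _), assoc_naturality_left,
      Category.assoc, ← Category.assoc, pentagon, Category.assoc, Category.assoc,
      ← Category.assoc (hcomp (hcomp _ _) _), ← hcomp_comp_id,
      ← Category.assoc (hcomp (assoc _ _ _) _), ← hcomp_comp_id, freeAct_comp, hcomp_comp_id,
      Category.assoc, ← Category.assoc (assoc _ _ _) (hcomp (hcomp _ _) _), ← assoc_naturality,
      Category.assoc, freeAct_comp, hcomp_id_comp, hcomp_id_comp, Category.assoc, Category.assoc]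

/-- The free multicategory on a graph, as a multicategory on its object of objects. -/
noncomputable def freeOn : TMulticatOn T X.obj where
  span := freeSpan hT X
  ids := freeIds hT X
  comp := freeComp hT X
  comp_ids := freeComp_ids hT X
  ids_comp := freeIds_comp hT X
  assoc := freeComp_assoc hT X

/-- The free multicategory on a graph. -/
noncomputable def free : TMulticat T where
  obj := X.obj
  on := freeOn hT X

/-- The inclusion of a graph in the free multicategory on it, as a 2-cell. -/
noncomputable def freeUnitOn : X.span ⟶ freeSpan hT X :=
  X.span.rightUnit ≫ hcomp (𝟙 _) (freeIds hT X) ≫ freeAct hT X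

/-- The action is recovered as composition with generating arrows; consequently a multicategory map
out of the free multicategory is determined as a map of actions. -/
lemma freeUnitOn_comp : hcomp (freeUnitOn hT X) (𝟙 _) ≫ freeComp hT X = freeAct hT X := by
  rw [freeUnitOn, hcomp_comp_id, hcomp_comp_id, ← hcomp_leftUnit_assoc, Category.assoc,
    Category.assoc, Category.assoc, ← Category.assoc (assoc _ _ _), ← assoc_naturality,
    Category.assoc, freeAct_comp, ← Category.assoc, ← hcomp_id_comp, ← Category.assoc,
    ← hcomp_id_comp, Category.assoc, freeIds_comp, hcomp_id, Category.id_comp]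

/-- The inclusion of a graph in the free multicategory on it. -/
noncomputable def freeUnit : X ⟶ (free hT X).graph where
  obj := 𝟙 X.obj
  arr := (freeUnitOn hT X).hom
  w_dom := (freeUnitOn hT X).over.w_dom
  w_cod := (freeUnitOn hT X).over.w_cod

end

section Lift

variable (hT : IsSuitableMonad T) {X : TGraph T} {C : TMulticat T}

/-- The underlying map of spans of a multicategory map out of the free multicategory. -/
noncomputable def freeLiftOver (k : X ⟶ C.graph) :
    OverHom k.obj k.obj (freeSpan hT X) C.on.span :=
  ((isFreeAct_free hT X).exists_lift hT (Y := C.graph) C.on.ids C.on.comp k (unitOver k.obj)).choose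

lemma freeIds_liftOver (k : X ⟶ C.graph) :
    (freeIds hT X).hom ≫ (freeLiftOver hT k).hom = k.obj ≫ C.on.ids.hom :=
  ((isFreeAct_free hT X).exists_lift hT (Y := C.graph) C.on.ids C.on.comp k
    (unitOver k.obj)).choose_spec.1

lemma freeAct_liftOver (k : X ⟶ C.graph) :
    (freeAct hT X).hom ≫ (freeLiftOver hT k).hom =
      (cmp k.over (freeLiftOver hT k)).hom ≫ C.on.comp.hom :=
  ((isFreeAct_free hT X).exists_lift hT (Y := C.graph) C.on.ids C.on.comp k
    (unitOver k.obj)).choose_spec.2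

lemma freeUnitOn_liftOver (k : X ⟶ C.graph) :
    (freeUnitOn hT X).hom ≫ (freeLiftOver hT k).hom = k.arr := by
  have e : (hcomp (𝟙 X.span) (freeIds hT X)).hom ≫ (cmp k.over (freeLiftOver hT k)).hom =
      (cmp k.over (unitOver k.obj)).hom ≫ (hcomp (𝟙 C.on.span) C.on.ids).hom :=
    hcomp_cmp_over k (freeIds_liftOver hT k)
  have e' := congrArg Hom.hom C.on.comp_ids
  simp only [comp_hom] at e'
  rw [freeUnitOn, comp_hom, comp_hom, Category.assoc, Category.assoc, freeAct_liftOver,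
    ← Category.assoc (hcomp _ _).hom, e, Category.assoc, ← Category.assoc, rightUnit_cmp,
    Category.assoc, e']
  exact Category.comp_id _

/-- Two maps out of `W ∘ W`, a free action on `1 ∘ W`, into the action of `X` on `C` through `k`.
They agree on generators by the left unit laws, and respect the actions by compatibility of
composition with the action in `W` and by associativity in `C`. -/
lemma freeComp_liftOver (k : X ⟶ C.graph) :
    (freeComp hT X).hom ≫ (freeLiftOver hT k).hom =
      (cmp (freeLiftOver hT k) (freeLiftOver hT k)).hom ≫ C.on.comp.hom := by
  have := isIso_leftUnit hT.toIsCartesianMonad (freeSpan hT X)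
  refine ((isFreeAct_free hT X).hcomp hT (freeSpan hT X)).lift_ext (Y := C.graph) (k := k)
    (φ := (freeLiftOver hT k).precomp (freeComp hT X))
    (ψ := (cmp (freeLiftOver hT k) (freeLiftOver hT k)).postcomp C.on.comp) (a' := C.on.comp)
    ?_ ?_ ?_
  · have e₁ := congrArg Hom.hom (freeIds_comp hT X)
    have e₂ := congrArg Hom.hom C.on.ids_comp
    have e₃ : (hcomp (freeIds hT X) (𝟙 _)).hom ≫
        (cmp (freeLiftOver hT k) (freeLiftOver hT k)).hom =
        (cmp (unitOver k.obj) (freeLiftOver hT k)).hom ≫ (hcomp C.on.ids (𝟙 _)).hom :=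
      hcomp_cmp (freeIds_liftOver hT k) ((Category.id_comp _).trans (Category.comp_id _).symm)
    simp only [comp_hom] at e₁ e₂
    rw [← cancel_epi (freeSpan hT X).leftUnit.hom, OverHom.precomp_hom, OverHom.postcomp_hom,
      reassoc_of% e₁, reassoc_of% e₃, ← Category.assoc, leftUnit_cmp, Category.assoc, e₂]
    exact (Category.id_comp _).trans (Category.comp_id _).symm
  · have e₁ := congrArg Hom.hom (freeAct_comp hT X)
    simp only [comp_hom] at e₁
    rw [OverHom.precomp_hom, comp_hom, Category.assoc, reassoc_of% e₁, freeAct_liftOver,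
      ← Category.assoc, hcomp_id_cmp]
  · have e₂ := congrArg Hom.hom C.on.assoc
    have e₃ : (hcomp (freeAct hT X) (𝟙 _)).hom ≫
        (cmp (freeLiftOver hT k) (freeLiftOver hT k)).hom =
        (cmp (cmp k.over (freeLiftOver hT k)) (freeLiftOver hT k)).hom ≫
          (hcomp C.on.comp (𝟙 _)).hom :=
      hcomp_cmp (freeAct_liftOver hT k) ((Category.id_comp _).trans (Category.comp_id _).symm)
    simp only [comp_hom] at e₂
    rw [OverHom.postcomp_hom, comp_hom, Category.assoc, reassoc_of% e₃, ← Category.assoc,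
      assoc_cmp, Category.assoc, ← e₂, ← Category.assoc, cmp_hcomp_id]

/-- The multicategory map out of the free multicategory induced by a map of graphs. -/
noncomputable def freeLift (k : X ⟶ C.graph) : free hT X ⟶ C where
  map := ⟨k.obj, (freeLiftOver hT k).hom, (freeLiftOver hT k).w_dom, (freeLiftOver hT k).w_cod⟩
  map_ids := freeIds_liftOver hT k
  map_comp := freeComp_liftOver hT k

lemma freeUnit_lift (k : X ⟶ C.graph) :
    freeUnit hT X ≫ (TMulticat.forget T).map (freeLift hT k) = k :=
  TGraph.Hom.ext (Category.id_comp _) (freeUnitOn_liftOver hT k)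

/-- Respecting composition and extending `k` on generators makes `φ` a map of actions, so uniqueness
for free actions applies. -/
lemma freeLiftOver_uniq (k : X ⟶ C.graph) (φ : OverHom k.obj k.obj (freeSpan hT X) C.on.span)
    (hk : (freeUnitOn hT X).hom ≫ φ.hom = k.arr)
    (hids : (freeIds hT X).hom ≫ φ.hom = k.obj ≫ C.on.ids.hom)
    (hcomp : (freeComp hT X).hom ≫ φ.hom = (cmp φ φ).hom ≫ C.on.comp.hom) :
    (freeLiftOver hT k).hom = φ.hom := by
  refine (isFreeAct_free hT X).lift_ext (Y := C.graph) (k := k) (a' := C.on.comp)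
    ((freeIds_liftOver hT k).trans hids.symm) (freeAct_liftOver hT k) ?_
  have e : φ.precomp (freeUnitOn hT X) = k.over := OverHom.ext hk
  rw [← freeUnitOn_comp, comp_hom, Category.assoc, hcomp, ← Category.assoc, hcomp_cmp_id, e]

lemma freeLift_freeUnit (f : free hT X ⟶ C) :
    freeLift hT (freeUnit hT X ≫ (TMulticat.forget T).map f) = f := by
  -- Composition with the unit gives the object part `𝟙 ≫ obj`. Replacing it by `obj` itself puts
  -- `φ` and `k` over literally the same map of feet.
  obtain ⟨⟨obj, arr, w_dom, w_cod⟩, map_ids, map_comp⟩ := f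
  let φ : OverHom obj obj (freeSpan hT X) C.on.span := ⟨arr, w_dom, w_cod⟩
  let k : X ⟶ C.graph := ⟨obj, (freeUnitOn hT X).hom ≫ arr, (φ.precomp (freeUnitOn hT X)).w_dom,
    (φ.precomp (freeUnitOn hT X)).w_cod⟩
  have e : freeUnit hT X ≫ (TMulticat.forget T).map ⟨⟨obj, arr, w_dom, w_cod⟩, map_ids, map_comp⟩ =
      k := TGraph.Hom.ext (Category.id_comp obj) rfl
  exact (congrArg (freeLift hT) e).trans (TMulticat.Hom.ext (TGraph.Hom.ext rfl
    (freeLiftOver_uniq hT k φ rfl map_ids map_comp)))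

/-- The universal property of the free multicategory. -/
noncomputable def freeEquiv (X : TGraph T) (C : TMulticat T) :
    (free hT X ⟶ C) ≃ (X ⟶ (TMulticat.forget T).obj C) where
  toFun f := freeUnit hT X ≫ (TMulticat.forget T).map f
  invFun k := freeLift hT k
  left_inv f := freeLift_freeUnit hT f
  right_inv k := freeUnit_lift hT k

/-- The free multicategory functor. -/
noncomputable def freeFunctor : TGraph T ⥤ TMulticat T :=
  Adjunction.leftAdjointOfEquiv (freeEquiv hT) fun X _ _ g h =>
    (congrArg (freeUnit hT X ≫ ·) (Functor.map_comp _ h g)).trans (Category.assoc _ _ _).symm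

/-- The free multicategory adjunction. -/
noncomputable def freeAdjunction : freeFunctor hT ⊣ TMulticat.forget T :=
  Adjunction.adjunctionOfEquivLeft (freeEquiv hT) fun X _ _ g h =>
    (congrArg (freeUnit hT X ≫ ·) (Functor.map_comp _ h g)).trans (Category.assoc _ _ _).symm

end Lift

/-! ### The free multicategory over a fixed object of objects -/

section FixedObjects

variable {S : E}

/-- A graph on a fixed object of objects, as a graph. -/
abbrev TSpan.graph (X : TSpan T S S) : TGraph T := ⟨S, X⟩

/-- A map of graphs on a fixed object of objects, as a map of graphs. -/
def TSpan.Hom.graph {X Y : TSpan T S S} (k : X ⟶ Y) : X.graph ⟶ Y.graph where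
  obj := 𝟙 S
  arr := k.hom
  w_dom := k.over.w_dom
  w_cod := k.over.w_cod

/-- A multicategory on a fixed object of objects, as a multicategory. -/
abbrev TMulticatOn.total (C : TMulticatOn T S) : TMulticat T := ⟨S, C⟩

lemma TSpan.Hom.arrArr_graph {X Y : TSpan T S S} (k : X ⟶ Y) :
    TGraph.Hom.arrArr k.graph = (hcomp k k).hom :=
  comp_hom_ext ((cmp_fst k.graph.over k.graph.over).trans (hcomp_fst k k).symm)
    ((cmp_snd k.graph.over k.graph.over).trans (hcomp_snd k k).symm)

/-- A map of multicategories on a fixed object of objects, as a map of multicategories. -/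
def TMulticatOn.Hom.total {C D : TMulticatOn T S} (f : C ⟶ D) : C.total ⟶ D.total where
  map := f.map.graph
  map_ids := (congrArg TSpan.Hom.hom f.map_ids).trans (Category.id_comp _).symm
  map_comp := (congrArg TSpan.Hom.hom f.map_comp).trans
    (congrArg (· ≫ D.comp.hom) f.map.arrArr_graph.symm)

/-- A map of multicategories that is the identity on objects, as a map of multicategories on a
fixed object of objects. -/
def TMulticatOn.Hom.ofTotal {C D : TMulticatOn T S} (f : C.total ⟶ D.total)
    (hf : f.map.obj = 𝟙 S) : C ⟶ D :=
  let m : C.span ⟶ D.span := ⟨f.map.arr, f.map.w_dom.trans (by rw [hf]; simp),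
    f.map.w_cod.trans (by rw [hf]; simp)⟩
  have e : f.map = m.graph := TGraph.Hom.ext hf rfl
  { map := m
    map_ids := TSpan.hom_ext (f.map_ids.trans (by rw [hf]; exact Category.id_comp _))
    map_comp := TSpan.hom_ext (f.map_comp.trans (by rw [e, m.arrArr_graph]; rfl)) }

variable (hT : IsSuitableMonad T)

/-- The universal property of the free multicategory on a graph with a fixed object of objects. -/
noncomputable def freeOnEquiv (X : TGraphOn T S) (C : TMulticatOn T S) :
    (freeOn hT X.graph ⟶ C) ≃ (X ⟶ (TMulticatOn.forget T S).obj C) where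
  toFun f := freeUnitOn hT X.graph ≫ (TMulticatOn.forget T S).map f
  invFun k := TMulticatOn.Hom.ofTotal (freeLift hT (C := C.total) (TSpan.Hom.graph k)) rfl
  left_inv f := by
    have e : TSpan.Hom.graph (freeUnitOn hT X.graph ≫ (TMulticatOn.forget T S).map f) =
        freeUnit hT X.graph ≫ (TMulticat.forget T).map (TMulticatOn.Hom.total f) :=
      TGraph.Hom.ext (Category.id_comp (𝟙 S)).symm rfl
    have := freeLift_freeUnit hT (TMulticatOn.Hom.total f)
    have := (congrArg (freeLift hT) e).trans this
    exact TMulticatOn.Hom.ext (TSpan.hom_ext (congrArg (fun g => g.map.arr) this))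
  right_inv k := TSpan.hom_ext (freeUnitOn_liftOver hT (C := C.total) (TSpan.Hom.graph k))

/-- The free multicategory functor for a fixed object of objects. -/
noncomputable def freeOnFunctor (S : E) : TGraphOn T S ⥤ TMulticatOn T S :=
  Adjunction.leftAdjointOfEquiv (freeOnEquiv hT) fun X _ _ g h =>
    (congrArg (freeUnitOn hT X.graph ≫ ·) (Functor.map_comp _ h g)).trans
      (Category.assoc _ _ _).symm

/-- The free multicategory adjunction for a fixed object of objects. -/
noncomputable def freeOnAdjunction (S : E) : freeOnFunctor hT S ⊣ TMulticatOn.forget T S :=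
  Adjunction.adjunctionOfEquivLeft (freeOnEquiv hT) fun X _ _ g h =>
    (congrArg (freeUnitOn hT X.graph ≫ ·) (Functor.map_comp _ h g)).trans
      (Category.assoc _ _ _).symm

end FixedObjects

end FreeMulticategory

/-! ### Descent of multicategory structure along split epimorphisms of graphs -/

section Transfer

variable {E : Type u} [Category.{v} E] [HasPullbacks E] {T : Monad E}

/-- Transfer of the structure of a multicategory along a split epimorphism. -/
noncomputable def TMulticatOn.transfer {S : E} (A : TMulticatOn T S) {X : TSpan T S S}
    (s : X ⟶ A.span) (h : A.span ⟶ X) (hs : s ≫ h = 𝟙 X)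
    (hc : A.comp ≫ h = hcomp (h ≫ s) (h ≫ s) ≫ A.comp ≫ h) : TMulticatOn T S :=
  -- The hypothesis `hc` says that the class under `h` of a composite depends only on the classes of
  -- its factors. Thus `h` respects composition, and the laws for `X` are those for `A` after
  -- cancelling `h`.
  have hm : A.comp ≫ h = hcomp h h ≫ hcomp s s ≫ A.comp ≫ h := by
    rw [← Category.assoc, ← hcomp_comp]
    exact hc
  have cancel {M : TSpan T S S} {f g : X ⟶ M} (e : h ≫ f = h ≫ g) : f = g := by
    rw [← Category.id_comp f, ← hs, Category.assoc, e, ← Category.assoc, hs, Category.id_comp]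
  { span := X
    ids := A.ids ≫ h
    comp := hcomp s s ≫ A.comp ≫ h
    comp_ids := by
      apply cancel
      have e := congrArg (· ≫ h) A.comp_ids
      simp only [Category.assoc, Category.id_comp] at e
      rw [← Category.assoc, rightUnit_naturality, Category.assoc, hcomp_exchange_assoc,
        hcomp_id_comp, Category.assoc, ← Category.assoc (hcomp (𝟙 _) h), ← hcomp_exchange,
        ← hcomp_comp, Category.comp_id, Category.id_comp, ← hm, e]
    ids_comp := by
      apply cancel
      have e := congrArg (· ≫ h) A.ids_comp
      simp only [Category.assoc, Category.id_comp] at e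
      rw [← Category.assoc, leftUnit_naturality, Category.assoc, ← hcomp_exchange_assoc,
        hcomp_comp_id, Category.assoc, ← Category.assoc (hcomp h (𝟙 _)), hcomp_exchange,
        ← hcomp_comp, Category.comp_id, Category.id_comp, ← hm, e]
    assoc := by
      have e : hcomp s (hcomp s s) ≫ hcomp h (hcomp h h) = 𝟙 (X.comp (X.comp X)) := by
        rw [← hcomp_comp, ← hcomp_comp, hs, hcomp_id, hcomp_id]
      -- Associativity involves three factors, so it is the threefold composite of `h`, split by
      -- that of `s`, that has to be cancelled.
      have key {M : TSpan T S S} {f g : X.comp (X.comp X) ⟶ M}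
          (k : hcomp h (hcomp h h) ≫ f = hcomp h (hcomp h h) ≫ g) : f = g := by
        rw [← Category.id_comp f, ← e, Category.assoc, k, ← Category.assoc, e, Category.id_comp]
      have a := congrArg (· ≫ h) A.assoc
      simp only [Category.assoc] at a
      apply key
      set m := hcomp s s ≫ A.comp ≫ h with hmdef
      have l : hcomp h (hcomp h h) ≫ hcomp (𝟙 X) m = hcomp (𝟙 _) A.comp ≫ hcomp h h := by
        rw [← hcomp_comp, ← hcomp_comp, ← hm, Category.comp_id, Category.id_comp]
      have r : hcomp (hcomp h h) h ≫ hcomp m (𝟙 X) = hcomp A.comp (𝟙 _) ≫ hcomp h h := by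
        rw [← hcomp_comp, ← hcomp_comp, ← hm, Category.comp_id, Category.id_comp]
      rw [← Category.assoc, l, ← Category.assoc (hcomp h _), assoc_naturality, Category.assoc,
        Category.assoc, ← Category.assoc (hcomp (hcomp h h) h), r, Category.assoc, ← hm, a] }

namespace TMulticat

lemma comp_of_split {P C : TMulticat T} (p : P ⟶ C) (s : C.graph ⟶ P.graph)
    (hs : s ≫ p.map = 𝟙 C.graph) :
    C.on.comp.hom = TGraph.Hom.arrArr s ≫ P.on.comp.hom ≫ p.map.arr := by
  rw [p.map_comp, ← Category.assoc, ← TGraph.arrArr_comp, hs, TGraph.arrArr_id, Category.id_comp]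

/-- If `h` coequalizes two multicategory maps, one of which splits on graphs, then lifting along the
splitting and moving from `p` to `q` replaces each factor by its image under `s ≫ q`. Applied to an
algebra, this is the congruence condition needed for transfer. -/
lemma comp_of_fork {P C : TMulticat T} (p q : P ⟶ C) (s : C.graph ⟶ P.graph)
    (hs : s ≫ p.map = 𝟙 C.graph) {X : TGraph T} (h : C.graph ⟶ X)
    (hpq : p.map ≫ h = q.map ≫ h) :
    C.on.comp.hom ≫ h.arr = TGraph.Hom.arrArr (s ≫ q.map) ≫ C.on.comp.hom ≫ h.arr := by
  have e : p.map.arr ≫ h.arr = q.map.arr ≫ h.arr := congrArg TGraph.Hom.arr hpq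
  have c := comp_of_split p s hs
  calc C.on.comp.hom ≫ h.arr = s.arrArr ≫ P.on.comp.hom ≫ p.map.arr ≫ h.arr := by
        rw [c, Category.assoc, Category.assoc]
    _ = s.arrArr ≫ (P.on.comp.hom ≫ q.map.arr) ≫ h.arr := by rw [e, Category.assoc]
    _ = _ := by rw [q.map_comp, TGraph.arrArr_comp, Category.assoc, Category.assoc]

/-- A map of graphs is a map of multicategories if its composite with a split epimorphism is. -/
def homOfSplit {P C D : TMulticat T} (p : P ⟶ C) (s : C.graph ⟶ P.graph)
    (hs : s ≫ p.map = 𝟙 C.graph) (q : P ⟶ D) (f : C.graph ⟶ D.graph) (hf : p.map ≫ f = q.map) :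
    C ⟶ D :=
  have e : s ≫ q.map = f := by rw [← hf, ← Category.assoc, hs, Category.id_comp]
  have e' : p.map.arr ≫ f.arr = q.map.arr := congrArg TGraph.Hom.arr hf
  { map := f
    map_ids := by
      have e₁ : s.obj ≫ p.map.obj = 𝟙 _ := congrArg TGraph.Hom.obj hs
      have e₂ : s.obj ≫ q.map.obj = f.obj := congrArg TGraph.Hom.obj e
      have : C.on.ids.hom = s.obj ≫ P.on.ids.hom ≫ p.map.arr := by
        rw [p.map_ids, reassoc_of% e₁]
      rw [this, Category.assoc, Category.assoc, e', q.map_ids, reassoc_of% e₂]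
    map_comp := by
      rw [comp_of_split p s hs, Category.assoc, Category.assoc, e', q.map_comp, ← Category.assoc,
        ← TGraph.arrArr_comp, e] }

end TMulticat

namespace TMulticatOn

variable {S : E}

lemma comp_of_split {P C : TMulticatOn T S} (p : P ⟶ C) (s : C.span ⟶ P.span)
    (hs : s ≫ p.map = 𝟙 C.span) : C.comp = hcomp s s ≫ P.comp ≫ p.map := by
  rw [p.map_comp, ← Category.assoc, ← hcomp_comp, hs, hcomp_id, Category.id_comp]

lemma comp_of_fork {P C : TMulticatOn T S} (p q : P ⟶ C) (s : C.span ⟶ P.span)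
    (hs : s ≫ p.map = 𝟙 C.span) {X : TSpan T S S} (h : C.span ⟶ X)
    (hpq : p.map ≫ h = q.map ≫ h) :
    C.comp ≫ h = hcomp (s ≫ q.map) (s ≫ q.map) ≫ C.comp ≫ h := by
  have c := comp_of_split p s hs
  calc C.comp ≫ h = hcomp s s ≫ P.comp ≫ p.map ≫ h := by
        rw [c, Category.assoc, Category.assoc]
    _ = hcomp s s ≫ (P.comp ≫ q.map) ≫ h := by rw [hpq, Category.assoc]
    _ = _ := by rw [q.map_comp, hcomp_comp, Category.assoc, Category.assoc]

/-- A map of graphs is a map of multicategories if its composite with a split epimorphism is. -/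
def homOfSplit {P C D : TMulticatOn T S} (p : P ⟶ C) (s : C.span ⟶ P.span)
    (hs : s ≫ p.map = 𝟙 C.span) (q : P ⟶ D) (f : C.span ⟶ D.span) (hf : p.map ≫ f = q.map) :
    C ⟶ D :=
  have e : s ≫ q.map = f := by rw [← hf, ← Category.assoc, hs, Category.id_comp]
  { map := f
    map_ids := by rw [← p.map_ids, Category.assoc, hf, q.map_ids]
    map_comp := by
      rw [comp_of_split p s hs, Category.assoc, Category.assoc, hf, q.map_comp, ← Category.assoc,
        ← hcomp_comp, e] }

end TMulticatOn

end Transfer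

/-! ### Monadicity: the comparison functors are equivalences -/

section Monadicity

variable {E : Type u} [Category.{v} E] [IsSuitableCategory E] {T : Monad E}
  (hT : IsSuitableMonad T)

lemma freeAdjunction_unit (X : TGraph T) :
    (freeAdjunction hT).unit.app X = freeUnit hT X :=
  (congrArg (freeUnit hT X ≫ ·) ((TMulticat.forget T).map_id (free hT X))).trans
    (Category.comp_id _)

lemma freeOnAdjunction_unit {S : E} (X : TGraphOn T S) :
    (freeOnAdjunction hT S).unit.app X = freeUnitOn hT X.graph :=
  (congrArg (freeUnitOn hT X.graph ≫ ·)
    ((TMulticatOn.forget T S).map_id (freeOn hT X.graph))).trans (Category.comp_id _)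

instance faithful_forget : (TMulticat.forget T).Faithful where
  map_injective h := TMulticat.Hom.ext h

instance faithful_forgetOn (S : E) : (TMulticatOn.forget T S).Faithful where
  map_injective h := TMulticatOn.Hom.ext h

/-- The counit at `C` is split on graphs by the unit, and an algebra map composed with it is a
multicategory map; hence the algebra map already preserves identities and composition. -/
instance full_comparison : (Monad.comparison (freeAdjunction hT)).Full where
  map_surjective {C D} f := by
    let adj := freeAdjunction hT
    refine ⟨TMulticat.homOfSplit (adj.counit.app C) (adj.unit.app C.graph)
      (adj.right_triangle_components C) ((freeFunctor hT).map f.f ≫ adj.counit.app D) f.f ?_, ?_⟩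
    · exact f.h.symm
    · ext : 1
      rfl

instance full_comparisonOn (S : E) : (Monad.comparison (freeOnAdjunction hT S)).Full where
  map_surjective {C D} f := by
    let adj := freeOnAdjunction hT S
    refine ⟨TMulticatOn.homOfSplit (adj.counit.app C) (adj.unit.app C.span)
      (adj.right_triangle_components C) ((freeOnFunctor hT S).map f.f ≫ adj.counit.app D)
        f.f ?_, ?_⟩
    · exact f.h.symm
    · ext : 1
      rfl

instance essSurj_comparisonOn (S : E) : (Monad.comparison (freeOnAdjunction hT S)).EssSurj where
  mem_essImage A := by
    let adj := freeOnAdjunction hT S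
    let h : freeSpan hT A.A.graph ⟶ A.A := A.a
    have hs : freeUnitOn hT A.A.graph ≫ h = 𝟙 A.A :=
      (congrArg (· ≫ h) (freeOnAdjunction_unit hT A.A).symm).trans A.unit
    have hn : adj.unit.app (freeSpan hT A.A.graph) ≫ ((freeOnFunctor hT S).map A.a).map =
        h ≫ freeUnitOn hT A.A.graph :=
      (adj.unit.naturality A.a).symm.trans (congrArg (h ≫ ·) (freeOnAdjunction_unit hT A.A))
    have hc : freeComp hT A.A.graph ≫ h = hcomp (h ≫ freeUnitOn hT A.A.graph)
        (h ≫ freeUnitOn hT A.A.graph) ≫ freeComp hT A.A.graph ≫ h := by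
      -- The fork consists of the counit at the free multicategory and the free map on the structure
      -- map; the associativity law of the algebra says that the structure map coequalizes them.
      have e := TMulticatOn.comp_of_fork (adj.counit.app (freeOn hT A.A.graph))
        ((freeOnFunctor hT S).map A.a) (adj.unit.app (freeSpan hT A.A.graph))
        (adj.right_triangle_components (freeOn hT A.A.graph)) h A.assoc
      exact e.trans (congrArg (fun t => hcomp t t ≫ freeComp hT A.A.graph ≫ h) hn)
    let C := (freeOn hT A.A.graph).transfer (freeUnitOn hT A.A.graph) h hs hc
    let q : freeOn hT A.A.graph ⟶ C := ⟨h, rfl, by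
      refine hc.trans ?_
      rw [hcomp_comp, Category.assoc]
      rfl⟩
    -- By the triangle identity the counit restricts to the identity on generators, as `h` does.
    -- Hence the algebra induced by `C` has the original structure map.
    have e : adj.counit.app C = q := by
      apply (freeOnEquiv hT A.A C).injective
      exact (congrArg (· ≫ _) (freeOnAdjunction_unit hT A.A).symm).trans
        ((adj.right_triangle_components C).trans hs.symm)
    refine ⟨C, ⟨Monad.Algebra.isoMk (Iso.refl A.A) ?_⟩⟩
    have e' : adj.toMonad.map (𝟙 A.A) ≫ A.a = (adj.counit.app C).map ≫ 𝟙 A.A := by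
      rw [e]
      exact (congrArg (· ≫ A.a) (adj.toMonad.map_id A.A)).trans
        ((Category.id_comp _).trans (Category.comp_id h).symm)
    exact e'

instance essSurj_comparison : (Monad.comparison (freeAdjunction hT)).EssSurj where
  mem_essImage A := by
    let adj := freeAdjunction hT
    let h : (free hT A.A).graph ⟶ A.A := A.a
    have hs : freeUnit hT A.A ≫ h = 𝟙 A.A :=
      (congrArg (· ≫ h) (freeAdjunction_unit hT A.A).symm).trans A.unit
    -- The unit is the identity on objects, so the unit law forces the structure map to be so too;
    -- the transfer can then take place over fixed objects.
    have hobj : h.obj = 𝟙 A.A.obj :=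
      (Category.id_comp _).symm.trans (congrArg TGraph.Hom.obj hs)
    let h' : freeSpan hT A.A ⟶ A.A.span := ⟨h.arr,
      h.w_dom.trans ((congrArg (fun t => (freeSpan hT A.A).dom ≫ T.map t) hobj).trans
        ((congrArg _ (T.map_id _)).trans (Category.comp_id _))),
      h.w_cod.trans (by rw [hobj]; exact Category.comp_id _)⟩
    have hh' : h = TSpan.Hom.graph h' := TGraph.Hom.ext hobj rfl
    have hs' : freeUnitOn hT A.A ≫ h' = 𝟙 A.A.span :=
      TSpan.hom_ext (congrArg TGraph.Hom.arr hs)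
    have hn : adj.unit.app (free hT A.A).graph ≫ ((freeFunctor hT).map A.a).map =
        TSpan.Hom.graph (h' ≫ freeUnitOn hT A.A) := by
      refine ((adj.unit.naturality A.a).symm.trans
        (congrArg (h ≫ ·) (freeAdjunction_unit hT A.A))).trans ?_
      rw [hh']
      exact TGraph.Hom.ext (Category.id_comp _) rfl
    have hc : freeComp hT A.A ≫ h' = hcomp (h' ≫ freeUnitOn hT A.A)
        (h' ≫ freeUnitOn hT A.A) ≫ freeComp hT A.A ≫ h' := by
      have e := TMulticat.comp_of_fork (adj.counit.app (free hT A.A))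
        ((freeFunctor hT).map A.a) (adj.unit.app (free hT A.A).graph)
        (adj.right_triangle_components (free hT A.A)) h A.assoc
      refine TSpan.hom_ext (e.trans ?_)
      refine (congrArg (fun t => TGraph.Hom.arrArr t ≫ (freeComp hT A.A).hom ≫ h.arr) hn).trans ?_
      exact congrArg (· ≫ _) (TSpan.Hom.arrArr_graph _)
    let C : TMulticat T := ⟨A.A.obj, (freeOn hT A.A).transfer (freeUnitOn hT A.A) h' hs' hc⟩
    have hc' : freeComp hT A.A ≫ h' = hcomp h' h' ≫ C.on.comp := by
      refine hc.trans ?_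
      rw [hcomp_comp, Category.assoc]
      rfl
    let q : free hT A.A ⟶ C := ⟨TSpan.Hom.graph h', (Category.id_comp _).symm,
      (congrArg TSpan.Hom.hom hc').trans
        (congrArg (· ≫ C.on.comp.hom) (TSpan.Hom.arrArr_graph h').symm)⟩
    have e : adj.counit.app C = q := by
      apply (freeEquiv hT A.A C).injective
      exact (congrArg (· ≫ _) (freeAdjunction_unit hT A.A).symm).trans
        ((adj.right_triangle_components C).trans
          (hs.symm.trans (congrArg (freeUnit hT A.A ≫ ·) hh')))
    refine ⟨C, ⟨Monad.Algebra.isoMk (Iso.refl A.A) ?_⟩⟩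
    have e' : adj.toMonad.map (𝟙 A.A) ≫ A.a = (adj.counit.app C).map ≫ 𝟙 A.A := by
      rw [e]
      exact (congrArg (· ≫ A.a) (adj.toMonad.map_id A.A)).trans
        ((Category.id_comp _).trans (hh'.trans (Category.comp_id (TSpan.Hom.graph h')).symm))
    exact e'

lemma isEquivalence_comparison : (Monad.comparison (freeAdjunction hT)).IsEquivalence where

lemma isEquivalence_comparisonOn (S : E) :
    (Monad.comparison (freeOnAdjunction hT S)).IsEquivalence where

end Monadicity

/-! ### Composites of pullback squares of spans -/

namespace TSpan

variable {E : Type u} [Category.{v} E] {T : Monad E} [HasPullbacks E]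

/-- The composites of two pullback squares of spans form a pullback square. -/
lemma isPullback_cmp [PreservesLimitsOfShape WalkingCospan T.toFunctor]
    {R₀ R₁ R₂ R₃ S₀ S₁ S₂ S₃ Q₀ Q₁ Q₂ Q₃ : E}
    {r₁ : R₀ ⟶ R₁} {r₂ : R₀ ⟶ R₂} {r₁' : R₁ ⟶ R₃} {r₂' : R₂ ⟶ R₃}
    {s₁ : S₀ ⟶ S₁} {s₂ : S₀ ⟶ S₂} {s₁' : S₁ ⟶ S₃} {s₂' : S₂ ⟶ S₃}
    {q₁ : Q₀ ⟶ Q₁} {q₂ : Q₀ ⟶ Q₂} {q₁' : Q₁ ⟶ Q₃} {q₂' : Q₂ ⟶ Q₃}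
    {N₀ : TSpan T S₀ Q₀} {N₁ : TSpan T S₁ Q₁} {N₂ : TSpan T S₂ Q₂} {N₃ : TSpan T S₃ Q₃}
    {M₀ : TSpan T R₀ S₀} {M₁ : TSpan T R₁ S₁} {M₂ : TSpan T R₂ S₂} {M₃ : TSpan T R₃ S₃}
    {n₁ : OverHom s₁ q₁ N₀ N₁} {n₂ : OverHom s₂ q₂ N₀ N₂} {n₁' : OverHom s₁' q₁' N₁ N₃}
    {n₂' : OverHom s₂' q₂' N₂ N₃}
    {m₁ : OverHom r₁ s₁ M₀ M₁} {m₂ : OverHom r₂ s₂ M₀ M₂} {m₁' : OverHom r₁' s₁' M₁ M₃}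
    {m₂' : OverHom r₂' s₂' M₂ M₃} (hs : IsPullback s₁ s₂ s₁' s₂')
    (hn : IsPullback n₁.hom n₂.hom n₁'.hom n₂'.hom)
    (hm : IsPullback m₁.hom m₂.hom m₁'.hom m₂'.hom) :
    IsPullback (cmp n₁ m₁).hom (cmp n₂ m₂).hom (cmp n₁' m₁').hom (cmp n₂' m₂').hom := by
  have w {R S R' S' : E} {r : R ⟶ R'} {s : S ⟶ S'} {M : TSpan T R S} {M' : TSpan T R' S'}
      (m : OverHom r s M M') : T.map M.cod ≫ T.map s = T.map m.hom ≫ T.map M'.cod := by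
    rw [← T.map_comp, ← T.map_comp, m.w_cod]
  exact IsPullback.cube (isPullback_comp N₀ M₀) (isPullback_comp N₁ M₁) (isPullback_comp N₂ M₂)
    (isPullback_comp N₃ M₃) (hm.map T.toFunctor) hn (hs.map T.toFunctor)
    (w m₁) (w m₂) n₁.w_dom.symm n₂.w_dom.symm (cmp_fst _ _) (cmp_fst _ _) (cmp_fst _ _)
    (cmp_fst _ _) (cmp_snd _ _) (cmp_snd _ _) (cmp_snd _ _) (cmp_snd _ _)

lemma cmp_over {R S Q : E} {N N' : TSpan T S Q} {M M' : TSpan T R S} (g : N ⟶ N') (f : M ⟶ M') :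
    (cmp g.over f.over).hom = (hcomp g f).hom :=
  comp_hom_ext ((cmp_fst g.over f.over).trans (hcomp_fst g f).symm)
    ((cmp_snd g.over f.over).trans (hcomp_snd g f).symm)

lemma isPullback_hcomp_cmp [PreservesLimitsOfShape WalkingCospan T.toFunctor]
    {R S Q R' S' Q' : E} {g : R ⟶ R'} {f : S ⟶ S'} {h : Q ⟶ Q'} {N N₁ : TSpan T S Q}
    {N' N₁' : TSpan T S' Q'} {M M₁ : TSpan T R S} {M' M₁' : TSpan T R' S'}
    {θ : OverHom f h N N'} {φ : OverHom g f M M'} {θ₁ : OverHom f h N₁ N₁'}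
    {φ₁ : OverHom g f M₁ M₁'} {n : N ⟶ N₁} {m : M ⟶ M₁} {n' : N' ⟶ N₁'} {m' : M' ⟶ M₁'}
    (hN : IsPullback n.hom θ.hom θ₁.hom n'.hom) (hM : IsPullback m.hom φ.hom φ₁.hom m'.hom) :
    IsPullback (hcomp n m).hom (cmp θ φ).hom (cmp θ₁ φ₁).hom (hcomp n' m').hom := by
  have := isPullback_cmp (n₁ := n.over) (n₂ := θ) (n₁' := θ₁) (n₂' := n'.over) (m₁ := m.over)
    (m₂ := φ) (m₁' := φ₁) (m₂' := m'.over)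
    (IsPullback.of_horiz_isIso ⟨(Category.id_comp f).trans (Category.comp_id f).symm⟩) hN hM
  rwa [cmp_over, cmp_over] at this

end TSpan

/-! ### Cartesian maps out of free actions -/

section Cartesian

variable {E : Type u} [Category.{v} E] [IsSuitableCategory E] {T : Monad E} {R R' : E}

lemma tower_hom {X : TGraph T} {B W Z : TSpan T R X.obj} {u : B ⟶ W} {a : X.span.comp W ⟶ W}
    {φ : W ⟶ Z} {b : X.span.comp Z ⟶ Z} (hφ : a ≫ φ = hcomp (𝟙 X.span) φ ≫ b) (n : ℕ) :
    tower u a n ≫ φ = tower (u ≫ φ) b n := by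
  induction n with
  | zero => rfl
  | succ n ih =>
    refine approx_hom_ext ?_ ?_
    · rw [← Category.assoc, approxInl_tower, approxInl_tower]
    · rw [← Category.assoc, approxInr_tower, approxInr_tower, Category.assoc, hφ,
        ← Category.assoc, ← hcomp_id_comp, ih]

variable {X Y : TGraph T} {g : R ⟶ R'} {B W Z : TSpan T R X.obj} {B' W' Z' : TSpan T R' Y.obj}

/-- At stage `n + 1` the square is the copairing of the square on generators and of the previous
square composed with `X` and pasted with the square of the action; copairings of pullback squares
over the same map are pullbacks. -/
lemma isPullback_tower [PreservesLimitsOfShape WalkingCospan T.toFunctor] (p : X ⟶ Y)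
    {β : OverHom g p.obj B B'} {ζ : OverHom g p.obj Z Z'} {b : B ⟶ Z} {b' : B' ⟶ Z'}
    {a : X.span.comp Z ⟶ Z} {a' : Y.span.comp Z' ⟶ Z'} (hb : IsPullback b.hom β.hom ζ.hom b'.hom)
    (ha : IsPullback a.hom (cmp p.over ζ).hom ζ.hom a'.hom) (n : ℕ) :
    IsPullback (tower b a n).hom (approxMap p β n).hom ζ.hom (tower b' a' n).hom := by
  induction n with
  | zero => exact hb
  | succ n ih =>
    refine (isSum_approx X B n).isPullback_desc (isSum_approx Y B' n) (approxInl_map p β n)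
      (approxInr_map p β n) ?_ ?_
    · rwa [approxInl_tower_hom, approxInl_tower_hom]
    · rw [approxInr_tower_hom, approxInr_tower_hom]
      exact (isPullback_hcomp_cmp (θ := p.over) (θ₁ := p.over) (n := 𝟙 X.span) (n' := 𝟙 Y.span)
        (IsPullback.of_horiz_isIso ⟨(Category.id_comp _).trans (Category.comp_id _).symm⟩)
        ih).paste_horiz ha

/-- A map out of a free action is cartesian if it is on generators and its target action is. -/
lemma IsFreeAct.isPullback {p : X ⟶ Y} {u : B ⟶ W} {a : X.span.comp W ⟶ W} {u' : B' ⟶ W'}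
    {a' : Y.span.comp W' ⟶ W'} [PreservesLimitsOfShape WalkingCospan T.toFunctor]
    (h : IsFreeAct u a) (h' : IsFreeAct u' a')
    {β : OverHom g p.obj B B'} {ω : OverHom g p.obj W W'} (hu : u.hom ≫ ω.hom = β.hom ≫ u'.hom)
    (ha : a.hom ≫ ω.hom = (cmp p.over ω).hom ≫ a'.hom)
    {ζ : OverHom g p.obj Z Z'} {φ : W ⟶ Z} {φ' : W' ⟶ Z'} {c : X.span.comp Z ⟶ Z}
    {c' : Y.span.comp Z' ⟶ Z'} (hφ : a ≫ φ = TSpan.hcomp (𝟙 X.span) φ ≫ c)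
    (hφ' : a' ≫ φ' = TSpan.hcomp (𝟙 Y.span) φ' ≫ c')
    (hb : IsPullback (u ≫ φ).hom β.hom ζ.hom (u' ≫ φ').hom)
    (hc : IsPullback c.hom (cmp p.over ζ).hom ζ.hom c'.hom) :
    IsPullback φ.hom ω.hom ζ.hom φ'.hom :=
  -- The stagewise squares have `Z` and `Z'` fixed. Treating these as constant nested sequences, the
  -- colimit of the squares is again a pullback.
  IsSeqColim.isPullback (fun _ => inferInstanceAs (Mono (𝟙 Z.apex))) (mono_approxStep Y B')
    (fun _ => inferInstanceAs (Mono (𝟙 Z'.apex))) (isPullback_tower p hb hc)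
    (fun n => by rw [approxStep_tower_hom]; exact (Category.comp_id _).symm)
    (approxStep_approxMap p β)
    (fun n => (Category.id_comp _).trans (Category.comp_id _).symm)
    (fun n => by rw [approxStep_tower_hom]; exact (Category.comp_id _).symm) h
    (isSeqColim_const _) h' (isSeqColim_const _)
    (fun n => (congrArg Hom.hom (tower_hom hφ n)).trans (Category.comp_id _).symm)
    (tower_comp hu ha) (fun n => (Category.id_comp _).trans (Category.comp_id _).symm)
    (fun n => (congrArg Hom.hom (tower_hom hφ' n)).trans (Category.comp_id _).symm)

end Cartesian

/-! ### Cartesianness of the unit, composition and multiplication -/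

section FreeMap

variable {E : Type u} [Category.{v} E] [IsSuitableCategory E] {T : Monad E}
  (hT : IsSuitableMonad T) {X Y : TGraph T} (p : X ⟶ Y)

/-- The map of spans underlying the map of free multicategories induced by a map of graphs. -/
noncomputable def freeMapOver : OverHom p.obj p.obj (freeSpan hT X) (freeSpan hT Y) :=
  ((isFreeAct_free hT X).exists_lift hT (freeIds hT Y) (freeAct hT Y) p (unitOver p.obj)).choose

lemma freeIds_map : (freeIds hT X).hom ≫ (freeMapOver hT p).hom = p.obj ≫ (freeIds hT Y).hom :=
  ((isFreeAct_free hT X).exists_lift hT (freeIds hT Y) (freeAct hT Y) p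
    (unitOver p.obj)).choose_spec.1

lemma freeAct_map : (freeAct hT X).hom ≫ (freeMapOver hT p).hom =
    (cmp p.over (freeMapOver hT p)).hom ≫ (freeAct hT Y).hom :=
  ((isFreeAct_free hT X).exists_lift hT (freeIds hT Y) (freeAct hT Y) p
    (unitOver p.obj)).choose_spec.2

lemma tower_freeMap (n : ℕ) :
    (tower (freeIds hT X) (freeAct hT X) n).hom ≫ (freeMapOver hT p).hom =
      (approxMap p (unitOver p.obj) n).hom ≫ (tower (freeIds hT Y) (freeAct hT Y) n).hom :=
  tower_comp (freeIds_map hT p) (freeAct_map hT p) n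

/-- The composite of a map of graphs with the inclusion in the free multicategory. -/
noncomputable def freeUnitMap : X ⟶ (free hT Y).graph where
  obj := p.obj
  arr := p.arr ≫ (freeUnitOn hT Y).hom
  w_dom := (p.over.postcomp (freeUnitOn hT Y)).w_dom
  w_cod := (p.over.postcomp (freeUnitOn hT Y)).w_cod

/-- The map defined by the universal property of actions agrees with the functorial one defined by
that of multicategories, since composing with a generator is the action. The former is easier to
follow through the approximations. -/
lemma freeMapOver_eq : (freeMapOver hT p).hom = (freeLiftOver hT (freeUnitMap hT p)).hom := by
  refine (isFreeAct_free hT X).lift_ext (Y := Y) (k := p) (a' := freeAct hT Y)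
    (ψ := freeLiftOver hT (freeUnitMap hT p))
    ((freeIds_map hT p).trans (freeIds_liftOver hT (freeUnitMap hT p)).symm) (freeAct_map hT p) ?_
  refine (freeAct_liftOver hT (freeUnitMap hT p)).trans ?_
  rw [← freeUnitOn_comp, comp_hom, ← Category.assoc]
  exact congrArg (· ≫ (freeComp hT Y).hom) (cmp_hcomp_left p.over
    (freeLiftOver hT (freeUnitMap hT p)) (freeUnitOn hT Y)).symm

lemma freeFunctor_map : (freeFunctor hT).map p = freeLift hT (freeUnitMap hT p) := by
  refine congrArg (freeLift hT) (TGraph.Hom.ext ?_ ?_)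
  · exact (congrArg (p.obj ≫ ·) (Category.comp_id (𝟙 Y.obj))).trans (Category.comp_id _)
  · exact congrArg (p.arr ≫ ·) (Category.comp_id (freeUnitOn hT Y).hom)

lemma freeFunctor_map_obj : ((freeFunctor hT).map p).map.obj = p.obj :=
  congrArg (fun f => f.map.obj) (freeFunctor_map hT p)

lemma freeFunctor_map_arr : ((freeFunctor hT).map p).map.arr = (freeMapOver hT p).hom :=
  (congrArg (fun f => f.map.arr) (freeFunctor_map hT p)).trans (freeMapOver_eq hT p).symm

lemma freeOnFunctor_map_hom {S : E} {X Y : TGraphOn T S} (p : X ⟶ Y) :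
    ((freeOnFunctor hT S).map p).map.hom = (freeMapOver hT (TSpan.Hom.graph p)).hom := by
  have e : TSpan.Hom.graph (p ≫ freeUnitOn hT Y.graph ≫
      (TMulticatOn.forget T S).map (𝟙 (freeOn hT Y.graph))) =
      freeUnitMap hT (TSpan.Hom.graph p) :=
    TGraph.Hom.ext rfl (congrArg (p.hom ≫ ·) (Category.comp_id (freeUnitOn hT Y.graph).hom))
  exact (congrArg (fun k => (freeLift hT (C := free hT Y.graph) k).map.arr) e).trans
    (freeMapOver_eq hT (TSpan.Hom.graph p)).symm

/-- Identities and action present `W` as the sum `1 + X ∘ W`, functorially, and coprojections are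
cartesian for sums of maps. -/
lemma isPullback_freeIds :
    IsPullback (freeIds hT X).hom p.obj (freeMapOver hT p).hom (freeIds hT Y).hom :=
  ((isFreeAct_free hT X).isSum hT).isPullback_left ((isFreeAct_free hT Y).isSum hT)
    (freeIds_map hT p) (freeAct_map hT p)

lemma isPullback_freeAct : IsPullback (freeAct hT X).hom (cmp p.over (freeMapOver hT p)).hom
    (freeMapOver hT p).hom (freeAct hT Y).hom :=
  ((isFreeAct_free hT X).isSum hT).isPullback_right ((isFreeAct_free hT Y).isSum hT)
    (freeIds_map hT p) (freeAct_map hT p)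

/-- The unit of the free multicategory monad is cartesian. -/
lemma isPullback_freeUnitOn :
    IsPullback (freeUnitOn hT X).hom p.arr (freeMapOver hT p).hom (freeUnitOn hT Y).hom := by
  have := hT.preserves_pullbacks
  have sq₁ : IsPullback X.span.rightUnit.hom p.arr (cmp p.over (unitOver p.obj)).hom
      Y.span.rightUnit.hom :=
    IsPullback.of_horiz_isIso ⟨rightUnit_cmp p.over⟩
  have sq₂ : IsPullback (hcomp (𝟙 X.span) (freeIds hT X)).hom (cmp p.over (unitOver p.obj)).hom
      (cmp p.over (freeMapOver hT p)).hom (hcomp (𝟙 Y.span) (freeIds hT Y)).hom :=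
    isPullback_hcomp_cmp
      (IsPullback.of_horiz_isIso ⟨(Category.id_comp _).trans (Category.comp_id _).symm⟩)
      (isPullback_freeIds hT p)
  -- The unit is `X ≅ X ∘ 1 → X ∘ W → W`, and each of the three factors is cartesian.
  exact sq₁.paste_horiz (sq₂.paste_horiz (isPullback_freeAct hT p))

/-- The composition of free multicategories is cartesian. -/
lemma isPullback_freeComp :
    IsPullback (freeComp hT X).hom (cmp (freeMapOver hT p) (freeMapOver hT p)).hom
      (freeMapOver hT p).hom (freeComp hT Y).hom := by
  have := hT.preserves_pullbacks
  have (X : TGraph T) := isIso_leftUnit hT.toIsCartesianMonad (freeSpan hT X)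
  have eu (X : TGraph T) : hcomp (freeIds hT X) (𝟙 (freeSpan hT X)) ≫
      freeComp hT X = inv (freeSpan hT X).leftUnit := by
    rw [← cancel_epi (freeSpan hT X).leftUnit, freeIds_comp, IsIso.hom_inv_id]
  refine ((isFreeAct_free hT X).hcomp hT (freeSpan hT X)).isPullback
    ((isFreeAct_free hT Y).hcomp hT (freeSpan hT Y)) (p := p)
    (β := cmp (unitOver p.obj) (freeMapOver hT p))
    (ω := cmp (freeMapOver hT p) (freeMapOver hT p)) ?_ ?_
    (c := freeAct hT X) (c' := freeAct hT Y) ?_ ?_ ?_ (isPullback_freeAct hT p)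
  · exact hcomp_cmp (freeIds_map hT p) ((Category.id_comp _).trans (Category.comp_id _).symm)
  · have e : (hcomp (freeAct hT X) (𝟙 _)).hom ≫ (cmp (freeMapOver hT p) (freeMapOver hT p)).hom =
        (cmp (cmp p.over (freeMapOver hT p)) (freeMapOver hT p)).hom ≫
          (hcomp (freeAct hT Y) (𝟙 _)).hom :=
      hcomp_cmp (freeAct_map hT p) ((Category.id_comp _).trans (Category.comp_id _).symm)
    rw [comp_hom, Category.assoc, e, ← Category.assoc, assoc_cmp, Category.assoc, comp_hom]
  · rw [Category.assoc, freeAct_comp]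
  · rw [Category.assoc, freeAct_comp]
  -- On the generators `1 ∘ W` the composition is the inverse of the left unit isomorphism, so the
  -- square there is trivially a pullback.
  · rw [eu X, eu Y]
    refine IsPullback.of_horiz_isIso ⟨?_⟩
    have e₁ : (freeSpan hT X).leftUnit.hom ≫ (inv (freeSpan hT X).leftUnit).hom = 𝟙 _ :=
      congrArg Hom.hom (IsIso.hom_inv_id (freeSpan hT X).leftUnit)
    have e₂ : (freeSpan hT Y).leftUnit.hom ≫ (inv (freeSpan hT Y).leftUnit).hom = 𝟙 _ :=
      congrArg Hom.hom (IsIso.hom_inv_id (freeSpan hT Y).leftUnit)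
    rw [← cancel_epi (freeSpan hT X).leftUnit.hom, reassoc_of% e₁, ← Category.assoc,
      leftUnit_cmp, Category.assoc, e₂, Category.comp_id]

/-- The map of graphs underlying the map of free multicategories induced by a map of graphs. -/
noncomputable def freeMap : (free hT X).graph ⟶ (free hT Y).graph where
  obj := p.obj
  arr := (freeMapOver hT p).hom
  w_dom := (freeMapOver hT p).w_dom
  w_cod := (freeMapOver hT p).w_cod

lemma freeAdjunction_map : (freeAdjunction hT).toMonad.map p = freeMap hT p :=
  TGraph.Hom.ext (freeFunctor_map_obj hT p) (freeFunctor_map_arr hT p)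

/-- The multiplication of the free multicategory monad. -/
noncomputable def freeMult (X : TGraph T) :
    OverHom (𝟙 X.obj) (𝟙 X.obj) (freeSpan hT (free hT X).graph) (freeSpan hT X) :=
  freeLiftOver hT (C := free hT X) (𝟙 (free hT X).graph)

/-- The multiplication of the free multicategory monad is cartesian. -/
lemma isPullback_freeMult : IsPullback (freeMult hT X).hom (freeMapOver hT (freeMap hT p)).hom
    (freeMapOver hT p).hom (freeMult hT Y).hom := by
  have := hT.preserves_pullbacks
  have hids (X : TGraph T) : freeIds hT (free hT X).graph ≫ (freeMult hT X).toHom =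
      freeIds hT X :=
    hom_ext ((freeIds_liftOver hT (C := free hT X) (𝟙 (free hT X).graph)).trans
      (Category.id_comp _))
  have hact (X : TGraph T) : freeAct hT (free hT X).graph ≫ (freeMult hT X).toHom =
      hcomp (𝟙 (freeSpan hT X)) (freeMult hT X).toHom ≫ freeComp hT X :=
    hom_ext ((freeAct_liftOver hT (C := free hT X) (𝟙 (free hT X).graph)).trans
      (congrArg (· ≫ (freeComp hT X).hom)
        (cmp_id_over (X := (free hT X).graph) (freeMult hT X))))
  -- The multiplication is a map out of the free action of the graph underlying the free
  -- multicategory. Its target action is the composition, already known to be cartesian, and on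
  -- generators it is the identities.
  refine (isFreeAct_free hT (free hT X).graph).isPullback (isFreeAct_free hT (free hT Y).graph)
    (p := freeMap hT p) (β := unitOver p.obj) (freeIds_map hT (freeMap hT p))
    (freeAct_map hT (freeMap hT p))
    (φ := (freeMult hT X).toHom) (φ' := (freeMult hT Y).toHom) (hact X) (hact Y) ?_
    (isPullback_freeComp hT p)
  rw [hids, hids]
  exact isPullback_freeIds hT p

end FreeMap

/-! ### The free multicategory monad is cartesian -/

section Pullbacks

variable {E : Type u} [Category.{v} E] [IsSuitableCategory E] {T : Monad E}

lemma isPullback_approxMap [PreservesLimitsOfShape WalkingCospan T.toFunctor]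
    {P X Y Z : TGraph T} {p : P ⟶ X} {q : P ⟶ Y} {f : X ⟶ Z} {g : Y ⟶ Z}
    (sq₀ : IsPullback p.obj q.obj f.obj g.obj) (sq₁ : IsPullback p.arr q.arr f.arr g.arr) (n : ℕ) :
    IsPullback (approxMap p (unitOver p.obj) n).hom (approxMap q (unitOver q.obj) n).hom
      (approxMap f (unitOver f.obj) n).hom (approxMap g (unitOver g.obj) n).hom := by
  induction n with
  | zero => exact sq₀
  | succ n ih =>
    exact (isSum_approx P _ n).isPullback (isSum_approx X _ n) (isSum_approx Y _ n)
      (isSum_approx Z _ n) sq₀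
      (isPullback_cmp (n₁ := p.over) (n₂ := q.over) (n₁' := f.over) (n₂' := g.over) sq₀ sq₁ ih)
      (approxInl_map _ _ _) (approxInr_map _ _ _) (approxInl_map _ _ _) (approxInr_map _ _ _)
      (approxInl_map _ _ _) (approxInr_map _ _ _) (approxInl_map _ _ _) (approxInr_map _ _ _)

/-- Each approximation preserves the pullback, by induction through composites and sums; the nested
colimit of these squares is again a pullback. -/
lemma isPullback_freeMapOver (hT : IsSuitableMonad T)
    {P X Y Z : TGraph T} {p : P ⟶ X} {q : P ⟶ Y} {f : X ⟶ Z} {g : Y ⟶ Z}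
    (sq₀ : IsPullback p.obj q.obj f.obj g.obj) (sq₁ : IsPullback p.arr q.arr f.arr g.arr) :
    IsPullback (freeMapOver hT p).hom (freeMapOver hT q).hom (freeMapOver hT f).hom
      (freeMapOver hT g).hom :=
  have := hT.preserves_pullbacks
  IsSeqColim.isPullback (mono_approxStep _ _) (mono_approxStep _ _) (mono_approxStep _ _)
    (isPullback_approxMap sq₀ sq₁) (approxStep_approxMap _ _) (approxStep_approxMap _ _)
    (approxStep_approxMap _ _) (approxStep_approxMap _ _) (isFreeAct_free hT P)
    (isFreeAct_free hT X) (isFreeAct_free hT Y) (isFreeAct_free hT Z)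
    (tower_freeMap hT p) (tower_freeMap hT q) (tower_freeMap hT f) (tower_freeMap hT g)

theorem isCartesianMonad_free (hT : IsSuitableMonad T) :
    IsCartesianMonad (freeAdjunction hT).toMonad := by
  have := hT.preserves_pullbacks
  refine ⟨fun X Y p => ?_, fun X Y p => ?_, ?_⟩
  · have sq : IsPullback (freeUnit hT X) p (freeMap hT p) (freeUnit hT Y) :=
      TGraph.isPullback_of_components
        (IsPullback.of_horiz_isIso ⟨(Category.id_comp p.obj).trans (Category.comp_id _).symm⟩ :
          IsPullback (𝟙 X.obj) p.obj p.obj (𝟙 Y.obj))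
        (isPullback_freeUnitOn hT p)
    rw [← freeAdjunction_unit, ← freeAdjunction_unit, ← freeAdjunction_map] at sq
    exact sq
  · have sq : IsPullback ((freeAdjunction hT).toMonad.μ.app X) (freeMap hT (freeMap hT p))
        (freeMap hT p) ((freeAdjunction hT).toMonad.μ.app Y) :=
      TGraph.isPullback_of_components
        (IsPullback.of_horiz_isIso ⟨(Category.id_comp p.obj).trans (Category.comp_id _).symm⟩ :
          IsPullback (𝟙 X.obj) p.obj p.obj (𝟙 Y.obj))
        (isPullback_freeMult hT p)
    have e : ∀ {a b}, a = freeMap hT (freeMap hT p) → b = freeMap hT p →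
        IsPullback ((freeAdjunction hT).toMonad.μ.app X) a b
          ((freeAdjunction hT).toMonad.μ.app Y) := by
      rintro _ _ rfl rfl
      exact sq
    exact e ((freeAdjunction_map hT _).trans (congrArg (freeMap hT) (freeAdjunction_map hT p)))
      (freeAdjunction_map hT p)
  · refine preservesPullbacks_of_isPullback _ fun {P X Y Z p q f g} sq => ?_
    have sq' : IsPullback (freeMap hT p) (freeMap hT q) (freeMap hT f) (freeMap hT g) :=
      TGraph.isPullback_of_components (sq.map (TGraph.objFunctor T))
        (isPullback_freeMapOver hT (sq.map (TGraph.objFunctor T)) (sq.map (TGraph.arrFunctor T)))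
    simp only [← freeAdjunction_map] at sq'
    exact sq'

end Pullbacks

/-! ### Cartesianness over a fixed object of objects -/

section FixedObjects

variable {E : Type u} [Category.{v} E] [IsSuitableCategory E] {T : Monad E}
  (hT : IsSuitableMonad T) {S : E}

/-- The underlying graph of the free multicategory on a graph with a fixed object of objects. -/
noncomputable abbrev freeOnObj (X : TGraphOn T S) : TGraphOn T S := freeSpan hT X.graph

/-- The map of free multicategories induced by a map of graphs with a fixed object of objects. -/
noncomputable def freeOnMap {X Y : TGraphOn T S} (p : X ⟶ Y) :
    freeOnObj hT X ⟶ freeOnObj hT Y :=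
  (freeMapOver hT (TSpan.Hom.graph p)).toHom

lemma freeOnAdjunction_map {X Y : TGraphOn T S} (p : X ⟶ Y) :
    (freeOnAdjunction hT S).toMonad.map p = freeOnMap hT p :=
  TSpan.hom_ext (freeOnFunctor_map_hom hT p)

theorem isCartesianMonad_freeOn (S : E) : IsCartesianMonad (freeOnAdjunction hT S).toMonad := by
  have := hT.preserves_pullbacks
  refine ⟨fun X Y p => ?_, fun X Y p => ?_, ?_⟩
  · have sq : IsPullback (freeUnitOn hT X.graph) p (freeOnMap hT p)
        (freeUnitOn hT Y.graph : Y ⟶ freeOnObj hT Y) :=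
      TSpan.isPullback_of_hom (isPullback_freeUnitOn hT (TSpan.Hom.graph p))
    rw [← freeOnAdjunction_unit, ← freeOnAdjunction_unit, ← freeOnAdjunction_map] at sq
    exact sq
  · have sq : IsPullback ((freeOnAdjunction hT S).toMonad.μ.app X)
        (freeOnMap hT (freeOnMap hT p))
        (freeOnMap hT p) ((freeOnAdjunction hT S).toMonad.μ.app Y) :=
      TSpan.isPullback_of_hom (isPullback_freeMult hT (TSpan.Hom.graph p))
    have e : ∀ {a b}, a = freeOnMap hT (freeOnMap hT p) → b = freeOnMap hT p →
        IsPullback ((freeOnAdjunction hT S).toMonad.μ.app X) a b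
          ((freeOnAdjunction hT S).toMonad.μ.app Y) := by
      rintro _ _ rfl rfl
      exact sq
    exact e ((freeOnAdjunction_map hT _).trans
      (congrArg (freeOnMap hT) (freeOnAdjunction_map hT p))) (freeOnAdjunction_map hT p)
  · refine preservesPullbacks_of_isPullback _ fun {P X Y Z p q f g} sq => ?_
    have sq' : IsPullback (freeOnMap hT p) (freeOnMap hT q) (freeOnMap hT f) (freeOnMap hT g) :=
      TSpan.isPullback_of_hom (isPullback_freeMapOver hT
        (IsPullback.of_horiz_isIso ⟨rfl⟩ : IsPullback (𝟙 S) (𝟙 S) (𝟙 S) (𝟙 S))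
        (sq.map (TSpan.apexFunctor T S S) :
          IsPullback (TSpan.Hom.graph p).arr (TSpan.Hom.graph q).arr (TSpan.Hom.graph f).arr
            (TSpan.Hom.graph g).arr))
    simp only [← freeOnAdjunction_map] at sq'
    exact sq'

end FixedObjects

/-! ### Colimits commute with sums and with sequential colimits -/

section Colimits

variable {E : Type u} [Category.{v} E] {J : Type*} [Category J]

lemma isColimit_of_isSum {A B L : J ⥤ E} {i : A ⟶ L} {j : B ⟶ L}
    (hij : ∀ k, IsSum (i.app k) (j.app k)) {a : Cocone A} {b : Cocone B} {l : Cocone L}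
    {i' : a.pt ⟶ l.pt} {j' : b.pt ⟶ l.pt} (h : IsSum i' j')
    (hi : ∀ k, i.app k ≫ l.ι.app k = a.ι.app k ≫ i')
    (hj : ∀ k, j.app k ≫ l.ι.app k = b.ι.app k ≫ j')
    (ha : IsColimit a) (hb : IsColimit b) : Nonempty (IsColimit l) := by
  have key (s : Cocone L) : ∃ m : l.pt ⟶ s.pt, ∀ k, l.ι.app k ≫ m = s.ι.app k := by
    obtain ⟨m, hm, hm'⟩ := h.exists_desc (ha.desc ((Cocone.precompose i).obj s))
      (hb.desc ((Cocone.precompose j).obj s))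
    refine ⟨m, fun k => (hij k).hom_ext _ _ ?_ ?_⟩
    · rw [reassoc_of% hi k, hm, ha.fac]
      rfl
    · rw [reassoc_of% hj k, hm', hb.fac]
      rfl
  refine ⟨⟨fun s => (key s).choose, fun s => (key s).choose_spec, fun s m hm => ?_⟩⟩
  refine h.hom_ext _ _ (ha.hom_ext fun k => ?_) (hb.hom_ext fun k => ?_)
  · rw [← reassoc_of% hi k, ← reassoc_of% hi k, hm, (key s).choose_spec]
  · rw [← reassoc_of% hj k, ← reassoc_of% hj k, hm, (key s).choose_spec]

/-- Sequential colimits commute with colimits. -/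
lemma isColimit_of_isSeqColim {A : ℕ → J ⥤ E} {s : ∀ n, A n ⟶ A (n + 1)} {L : J ⥤ E}
    {ι : ∀ n, A n ⟶ L} (h : ∀ k, IsSeqColim (fun n => (s n).app k) (fun n => (ι n).app k))
    {a : ∀ n, Cocone (A n)} {l : Cocone L} {t : ∀ n, (a n).pt ⟶ (a (n + 1)).pt}
    {κ : ∀ n, (a n).pt ⟶ l.pt} (h' : IsSeqColim t κ)
    (ht : ∀ n k, (a n).ι.app k ≫ t n = (s n).app k ≫ (a (n + 1)).ι.app k)
    (hκ : ∀ n k, (a n).ι.app k ≫ κ n = (ι n).app k ≫ l.ι.app k)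
    (ha : ∀ n, Nonempty (IsColimit (a n))) : Nonempty (IsColimit l) := by
  have ha' := fun n => (ha n).some
  have key (c : Cocone L) : ∃ m : l.pt ⟶ c.pt, ∀ k, l.ι.app k ≫ m = c.ι.app k := by
    obtain ⟨m, hm⟩ := h'.exists_desc (fun n => (ha' n).desc ((Cocone.precompose (ι n)).obj c))
      (fun n => (ha' n).hom_ext fun k => by
        rw [reassoc_of% ht n k, (ha' n).fac, (ha' (n + 1)).fac, Cocone.precompose_obj_ι,
          Cocone.precompose_obj_ι, NatTrans.comp_app, NatTrans.comp_app, ← Category.assoc,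
          (h k).w])
    refine ⟨m, fun k => (h k).hom_ext _ _ fun n => ?_⟩
    rw [← reassoc_of% hκ n k, hm, (ha' n).fac]
    rfl
  refine ⟨⟨fun s => (key s).choose, fun s => (key s).choose_spec, fun c m hm => ?_⟩⟩
  refine h'.hom_ext _ _ fun n => (ha' n).hom_ext fun k => ?_
  rw [reassoc_of% hκ n k, reassoc_of% hκ n k, hm, (key c).choose_spec]

end Colimits

/-! ### The approximations as functors, and colimits they preserve -/

section Functoriality

variable {E : Type u} [Category.{v} E] [IsSuitableCategory E] {T : Monad E}

/-- The composite `χ` is constrained only on apexes, which avoids comparing maps over feet that are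
equal but not definitionally so. -/
lemma cmp_comp {X Y Z : TGraph T} (p : X ⟶ Y) (q : Y ⟶ Z) {R R' R'' : E} {g : R ⟶ R'}
    {g' : R' ⟶ R''} {g'' : R ⟶ R''} {M : TSpan T R X.obj} {M' : TSpan T R' Y.obj}
    {M'' : TSpan T R'' Z.obj} {φ : OverHom g p.obj M M'} {ψ : OverHom g' q.obj M' M''}
    {χ : OverHom g'' (p.obj ≫ q.obj) M M''} (h : χ.hom = φ.hom ≫ ψ.hom) :
    (cmp (TGraph.Hom.over (p ≫ q)) χ).hom = (cmp p.over φ).hom ≫ (cmp q.over ψ).hom := by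
  refine comp_hom_ext ?_ ?_
  · rw [cmp_fst, Category.assoc, cmp_fst, cmp_fst_assoc, h, T.map_comp]
  · rw [cmp_snd, Category.assoc, cmp_snd, cmp_snd_assoc]
    rfl

lemma cmp_id {X : TGraph T} {R : E} {M : TSpan T R X.obj} {φ : OverHom (𝟙 R) (𝟙 X.obj) M M}
    (h : φ.hom = 𝟙 _) : (cmp (TGraph.Hom.over (𝟙 X)) φ).hom = 𝟙 _ := by
  have e : φ.toHom = 𝟙 M := TSpan.hom_ext h
  rw [cmp_id_over, e, hcomp_id]
  rfl

lemma approxMap_id (X : TGraph T) (n : ℕ) :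
    (approxMap (𝟙 X) (unitOver (𝟙 X.obj)) n).hom = 𝟙 _ := by
  induction n with
  | zero => rfl
  | succ n ih =>
    refine (isSum_approx X _ n).hom_ext _ _ ?_ ?_
    · exact (approxInl_map (𝟙 X) _ n).trans ((Category.id_comp _).trans (Category.comp_id _).symm)
    · refine (approxInr_map (𝟙 X) _ n).trans ?_
      rw [cmp_id ih]
      exact (Category.id_comp _).trans (Category.comp_id _).symm

lemma approxMap_comp {X Y Z : TGraph T} (p : X ⟶ Y) (q : Y ⟶ Z) (n : ℕ) :
    (approxMap (p ≫ q) (unitOver (p.obj ≫ q.obj)) n).hom =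
      (approxMap p (unitOver p.obj) n).hom ≫ (approxMap q (unitOver q.obj) n).hom := by
  induction n with
  | zero => rfl
  | succ n ih =>
    refine (isSum_approx X _ n).hom_ext _ _ ?_ ?_
    · rw [approxInl_map, ← Category.assoc (approxInl _ _ _).hom, approxInl_map, Category.assoc,
        approxInl_map]
      exact Category.assoc _ _ _
    · rw [approxInr_map, ← Category.assoc (approxInr _ _ _).hom, approxInr_map, Category.assoc,
        approxInr_map, cmp_comp p q ih, Category.assoc]

/-- The finite approximations to the free multicategory on a graph. -/
noncomputable def approxFunctor (T : Monad E) (n : ℕ) : TGraph T ⥤ E where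
  obj X := (approx X (unit T X.obj) n).apex
  map p := (approxMap p (unitOver p.obj) n).hom
  map_id X := approxMap_id X n
  map_comp p q := approxMap_comp p q n

/-- The composites of a graph with the finite approximations to the free multicategory on it. -/
noncomputable def approxCompFunctor (T : Monad E) (n : ℕ) : TGraph T ⥤ E where
  obj X := (X.span.comp (approx X (unit T X.obj) n)).apex
  map p := (cmp p.over (approxMap p (unitOver p.obj) n)).hom
  map_id X := cmp_id (approxMap_id X n)
  map_comp p q := cmp_comp p q (approxMap_comp p q n)

/-- The object of arrows of the free multicategory on a graph. -/
noncomputable def freeArrFunctor (hT : IsSuitableMonad T) : TGraph T ⥤ E where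
  obj X := (freeSpan hT X).apex
  map p := (freeMapOver hT p).hom
  map_id X := IsSeqColim.hom_ext (isFreeAct_free hT X) _ _ fun n =>
    (tower_freeMap hT (𝟙 X) n).trans ((congrArg (· ≫ _) (approxMap_id X n)).trans
      ((Category.id_comp _).trans (Category.comp_id _).symm))
  map_comp {X Y Z} p q := IsSeqColim.hom_ext (isFreeAct_free hT X) _ _ fun n => by
    rw [← Category.assoc, tower_freeMap, tower_freeMap, Category.assoc, tower_freeMap,
      ← Category.assoc]
    exact congrArg (· ≫ _) (approxMap_comp p q n)

/-- The inclusion of the identities, as a natural transformation. -/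
noncomputable def approxInlNat (T : Monad E) (n : ℕ) :
    TGraph.objFunctor T ⟶ approxFunctor T (n + 1) where
  app X := (approxInl X (unit T X.obj) n).hom
  naturality _ _ p := (approxInl_map p (unitOver p.obj) n).symm

/-- The inclusion of the composites, as a natural transformation. -/
noncomputable def approxInrNat (T : Monad E) (n : ℕ) :
    approxCompFunctor T n ⟶ approxFunctor T (n + 1) where
  app X := (approxInr X (unit T X.obj) n).hom
  naturality _ _ p := (approxInr_map p (unitOver p.obj) n).symm

/-- The inclusions of the finite approximations, as natural transformations. -/
noncomputable def approxStepNat (T : Monad E) (n : ℕ) :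
    approxFunctor T n ⟶ approxFunctor T (n + 1) where
  app X := (approxStep X (unit T X.obj) n).hom
  naturality _ _ p := (approxStep_approxMap p (unitOver p.obj) n).symm

/-- The maps from the finite approximations, as natural transformations. -/
noncomputable def towerNat (hT : IsSuitableMonad T) (n : ℕ) :
    approxFunctor T n ⟶ freeArrFunctor hT where
  app X := (tower (freeIds hT X) (freeAct hT X) n).hom
  naturality _ _ p := (tower_freeMap hT p n).symm

variable {J : Type*} [Category J] {D : J ⥤ TGraph T}

/-- Colimits preserved by the formation of finite approximations are preserved by the formation of
free multicategories. -/
lemma isColimit_freeArr (hT : IsSuitableMonad T) (c : Cocone D)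
    (hobj : Nonempty (IsColimit ((TGraph.objFunctor T).mapCocone c)))
    (hcomp : ∀ n, Nonempty (IsColimit ((approxFunctor T n).mapCocone c)) →
      Nonempty (IsColimit ((approxCompFunctor T n).mapCocone c))) :
    Nonempty (IsColimit ((freeArrFunctor hT).mapCocone c)) := by
  have ha (n : ℕ) : Nonempty (IsColimit ((approxFunctor T n).mapCocone c)) := by
    induction n with
    | zero => exact hobj
    | succ n ih =>
      exact isColimit_of_isSum (i := Functor.whiskerLeft D (approxInlNat T n))
        (j := Functor.whiskerLeft D (approxInrNat T n))
        (a := (TGraph.objFunctor T).mapCocone c) (b := (approxCompFunctor T n).mapCocone c)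
        (i' := (approxInlNat T n).app c.pt) (j' := (approxInrNat T n).app c.pt)
        (fun k => isSum_approx (D.obj k) (unit T (D.obj k).obj) n)
        (isSum_approx c.pt (unit T c.pt.obj) n)
        (fun k => ((approxInlNat T n).naturality (c.ι.app k)).symm)
        (fun k => ((approxInrNat T n).naturality (c.ι.app k)).symm) hobj.some (hcomp n ih).some
  exact isColimit_of_isSeqColim (s := fun n => Functor.whiskerLeft D (approxStepNat T n))
    (ι := fun n => Functor.whiskerLeft D (towerNat hT n))
    (a := fun n => (approxFunctor T n).mapCocone c) (l := (freeArrFunctor hT).mapCocone c)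
    (t := fun n => (approxStepNat T n).app c.pt) (κ := fun n => (towerNat hT n).app c.pt)
    (fun k => isFreeAct_free hT (D.obj k)) (isFreeAct_free hT c.pt)
    (fun n k => (approxStepNat T n).naturality (c.ι.app k))
    (fun n k => (towerNat hT n).naturality (c.ι.app k)) ha

end Functoriality

/-! ### Graphs on a fixed object inside all graphs -/

section FixedObjects

variable {E : Type u} [Category.{v} E] {T : Monad E}

/-- Graphs with a fixed object of objects as graphs. -/
def TSpan.graphFunctor (T : Monad E) (S : E) : TGraphOn T S ⥤ TGraph T where
  obj X := X.graph
  map p := TSpan.Hom.graph p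
  map_comp _ _ := TGraph.Hom.ext (Category.comp_id (𝟙 S)).symm rfl

/-- The diagram of objects is constant at `S`, and a constant diagram on a connected category has
its value as colimit. -/
lemma isColimit_graph_obj {J : Type*} [Category J] [IsConnected J] {S : E} {D : J ⥤ TGraphOn T S}
    (c : Cocone D) :
    Nonempty (IsColimit ((TGraph.objFunctor T).mapCocone ((graphFunctor T S).mapCocone c))) :=
  ⟨isColimitConstCocone J S⟩

end FixedObjects

/-! ### Preservation of colimits of nested sequences -/

section NestedColimits

variable {E : Type u} [Category.{v} E] [IsSuitableCategory E] {T : Monad E}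

instance preservesPullbacks_approxFunctor [PreservesLimitsOfShape WalkingCospan T.toFunctor]
    (n : ℕ) : PreservesLimitsOfShape WalkingCospan (approxFunctor T n) :=
  preservesPullbacks_of_isPullback _ fun sq =>
    isPullback_approxMap (sq.map (TGraph.objFunctor T)) (sq.map (TGraph.arrFunctor T)) n

lemma IsNested.comp {C F : Type*} [Category C] [Category F] {A : ℕ ⥤ C} (hA : IsNested A)
    (G : C ⥤ F) [G.PreservesMonomorphisms] : IsNested (A ⋙ G) := fun _ _ f =>
  have := hA f
  inferInstanceAs (Mono (G.map (A.map f)))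

/-- The formation of free multicategories preserves colimits of nested sequences. -/
lemma isColimit_freeArr_of_isNested (hT : IsSuitableMonad T) {D : ℕ ⥤ TGraph T} (hD : IsNested D)
    (c : Cocone D) (hobj : Nonempty (IsColimit ((TGraph.objFunctor T).mapCocone c)))
    (harr : Nonempty (IsColimit ((TGraph.arrFunctor T).mapCocone c))) :
    Nonempty (IsColimit ((freeArrFunctor hT).mapCocone c)) := by
  have := hT.preserves_pullbacks
  refine isColimit_freeArr hT c hobj fun n hn => ?_
  have nested (G : TGraph T ⥤ E) [PreservesLimitsOfShape WalkingCospan G] (k : ℕ) :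
      Mono (G.map (D.map (homOfLE k.le_succ))) :=
    have := hD (homOfLE k.le_succ)
    inferInstance
  have hA : IsNested (D ⋙ approxFunctor T n) := hD.comp _
  have := hT.preserves_nested _ hA
  have := hT.preserves_nested _ (hD.comp (TGraph.objFunctor T))
  have colA := IsSeqColim.of_isColimit (isColimitOfPreserves T.toFunctor hn.some)
  have colC := IsSeqColim.of_isColimit (isColimitOfPreserves T.toFunctor hobj.some)
  have wA {X Y : TGraph T} (p : X ⟶ Y) :
      T.map (approxMap p (unitOver p.obj) n).hom ≫ T.map (approx Y (unit T Y.obj) n).cod =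
        T.map (approx X (unit T X.obj) n).cod ≫ T.map p.obj := by
    rw [← T.map_comp, ← T.map_comp, OverHom.w_cod]
  -- `X ∘ Aₙ` is the pullback of `T Aₙ` and the arrows of `X` over `T` of the objects. All three are
  -- nested sequences with known colimits, so their pullback has the expected one.
  exact IsSeqColim.isColimit (IsSeqColim.of_isPullback
    (fun k => inferInstanceAs (Mono (T.map ((approxFunctor T n).map (D.map (homOfLE k.le_succ))))))
    (nested (TGraph.arrFunctor T))
    (fun k => inferInstanceAs (Mono (T.map ((TGraph.objFunctor T).map (D.map _)))))
    (fun k => isPullback_comp (D.obj k).span (approx (D.obj k) (unit T (D.obj k).obj) n))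
    (fun k => cmp_fst _ _) (fun k => cmp_snd _ _) (fun k => wA _)
    (fun k => (D.map (homOfLE k.le_succ)).w_dom)
    colA (IsSeqColim.of_isColimit harr.some) colC
    (fun k => cmp_fst _ _) (fun k => cmp_snd _ _) (fun k => wA _)
    (fun k => (c.ι.app k).w_dom) (isPullback_comp c.pt.span (approx c.pt (unit T c.pt.obj) n)))

/-- The object of objects of the free multicategory on a graph is that of the graph. -/
noncomputable def freeObjIso (hT : IsSuitableMonad T) : TGraph.objFunctor T ≅
    (freeAdjunction hT).toMonad.toFunctor ⋙ TGraph.objFunctor T :=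
  NatIso.ofComponents (fun X => Iso.refl X.obj) fun p =>
    (Category.comp_id _).trans ((freeFunctor_map_obj hT p).symm.trans (Category.id_comp _).symm)

/-- The object of arrows of the free multicategory on a graph. -/
noncomputable def freeArrIso (hT : IsSuitableMonad T) : freeArrFunctor hT ≅
    (freeAdjunction hT).toMonad.toFunctor ⋙ TGraph.arrFunctor T :=
  NatIso.ofComponents (fun _ => Iso.refl _) fun p =>
    (Category.comp_id _).trans ((freeFunctor_map_arr hT p).symm.trans (Category.id_comp _).symm)

theorem isSuitableMonad_free (hT : IsSuitableMonad T) :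
    IsSuitableMonad (freeAdjunction hT).toMonad where
  toIsCartesianMonad := isCartesianMonad_free hT
  preserves_nested D hD := by
    have := hT.preserves_pullbacks
    have := (isCartesianMonad_free hT).preserves_pullbacks
    have hD' : IsNested (D ⋙ (freeAdjunction hT).toMonad.toFunctor) := hD.comp _
    have := IsSuitableCategory.hasColimit_nested _ (TGraph.isNested_obj hD)
    have := IsSuitableCategory.hasColimit_nested _ (TGraph.isNested_arr hD)
    have := IsSuitableCategory.hasColimit_nested _ (TGraph.isNested_obj hD')
    have := IsSuitableCategory.hasColimit_nested _ (TGraph.isNested_arr hD')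
    have := TGraph.hasColimit (D ⋙ (freeAdjunction hT).toMonad.toFunctor)
    have := TGraph.preservesColimit_components (D ⋙ (freeAdjunction hT).toMonad.toFunctor)
    have := TGraph.preservesColimit_obj D
    have := TGraph.preservesColimit_arr D
    refine ⟨fun {c} hc => TGraph.jointlyConservative_components.isColimit _ ?_⟩
    have hobj := isColimitOfPreserves (TGraph.objFunctor T) hc
    have harr := isColimit_freeArr_of_isNested hT hD c ⟨hobj⟩
      ⟨isColimitOfPreserves (TGraph.arrFunctor T) hc⟩
    rintro (_ | _)
    · exact ⟨IsColimit.mapCoconeEquiv (freeObjIso hT) hobj⟩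
    · exact ⟨IsColimit.mapCoconeEquiv (freeArrIso hT) harr.some⟩

/-- The object of arrows of the free multicategory on a graph with a fixed object of objects. -/
noncomputable def freeOnArrIso (hT : IsSuitableMonad T) (S : E) :
    graphFunctor T S ⋙ freeArrFunctor hT ≅
      (freeOnAdjunction hT S).toMonad.toFunctor ⋙ apexFunctor T S S :=
  NatIso.ofComponents (fun _ => Iso.refl _) fun p =>
    (Category.comp_id _).trans ((freeOnFunctor_map_hom hT p).symm.trans (Category.id_comp _).symm)

/-- Colimits of spans are detected on apexes, so it is enough to follow the object of arrows of the
free multicategory. -/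
lemma preservesColimit_freeOn (hT : IsSuitableMonad T) {J : Type*} [Category J] {S : E}
    {D : J ⥤ TGraphOn T S} [HasColimit (D ⋙ apexFunctor T S S)]
    [HasColimit ((D ⋙ (freeOnAdjunction hT S).toMonad.toFunctor) ⋙ apexFunctor T S S)]
    (h : ∀ c : Cocone D, IsColimit ((apexFunctor T S S).mapCocone c) →
      Nonempty (IsColimit ((freeArrFunctor hT).mapCocone ((graphFunctor T S).mapCocone c)))) :
    PreservesColimit D (freeOnAdjunction hT S).toMonad.toFunctor := by
  have := TSpan.hasColimit (D ⋙ (freeOnAdjunction hT S).toMonad.toFunctor)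
  have := TSpan.preservesColimit (D ⋙ (freeOnAdjunction hT S).toMonad.toFunctor)
  have := TSpan.preservesColimit D
  refine ⟨fun {c} hc => TSpan.jointlyConservative_apexFunctor.isColimit _ fun _ => ?_⟩
  obtain ⟨h'⟩ := h c (isColimitOfPreserves (apexFunctor T S S) hc)
  exact ⟨IsColimit.mapCoconeEquiv (F := graphFunctor T S ⋙ freeArrFunctor hT)
    (freeOnArrIso hT S) h'⟩

theorem isSuitableMonad_freeOn (hT : IsSuitableMonad T) (S : E) :
    IsSuitableMonad (freeOnAdjunction hT S).toMonad where
  toIsCartesianMonad := isCartesianMonad_freeOn hT S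
  preserves_nested D hD := by
    have := hT.preserves_pullbacks
    have := (isCartesianMonad_freeOn hT S).preserves_pullbacks
    have hD' : IsNested (D ⋙ (freeOnAdjunction hT S).toMonad.toFunctor) := hD.comp _
    have := IsSuitableCategory.hasColimit_nested _ (TSpan.isNested_apex hD)
    have := IsSuitableCategory.hasColimit_nested _ (TSpan.isNested_apex hD')
    refine preservesColimit_freeOn hT fun c hc => ?_
    -- Regarded among all graphs, the sequence has identities as its maps on objects, so it remains
    -- nested.
    have hD'' : IsNested (D ⋙ graphFunctor T S) := fun m n f =>
      TGraph.jointlyConservative_components.mono _ fun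
        | false => inferInstanceAs (Mono (𝟙 S))
        | true => TSpan.isNested_apex hD f
    exact isColimit_freeArr_of_isNested hT hD'' _ (isColimit_graph_obj c) ⟨hc⟩

end NestedColimits

/-! ### Universal filtered colimits and pullbacks -/

section UniversalColimits

universe v₁ u₁

variable {E : Type u} [Category.{v} E] {J : Type u₁} [Category.{v₁} J]

lemma isPullback_of_factor {P P' F G G' K : E} {p : P ⟶ F} {q : P ⟶ G} {p' : P' ⟶ F} {q' : P' ⟶ G'}
    {f : F ⟶ K} {g : G ⟶ K} {g' : G' ⟶ K} {h : G ⟶ G'} {r : P ⟶ P'} (sq : IsPullback p q f g)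
    (sq' : IsPullback p' q' f g') (hg : h ≫ g' = g) (hp : r ≫ p' = p) (hq : r ≫ q' = q ≫ h) :
    IsPullback r q q' h := by
  subst hg hp
  exact (IsPullback.of_bot sq.flip hq.symm sq'.flip).flip

variable {F G : J ⥤ E} {a : Cocone F} {b : Cocone G} {K : E} {f : a.pt ⟶ K}

/-- Universal colimits over an object are preserved by pullback along a map into that object. -/
lemma isColimit_of_isPullback_left (ha : IsUniversalColimit a) {G : E} {g : G ⟶ K} {R : J ⥤ E}
    {l : Cocone R} {α : R ⟶ F} {β : ∀ k, R.obj k ⟶ G}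
    (h : ∀ k, IsPullback (α.app k) (β k) (a.ι.app k ≫ f) g)
    (hβ : ∀ {k k'} (t : k ⟶ k'), R.map t ≫ β k' = β k) {p : l.pt ⟶ a.pt} {q : l.pt ⟶ G}
    (sq : IsPullback p q f g) (hp : ∀ k, l.ι.app k ≫ p = α.app k ≫ a.ι.app k)
    (hq : ∀ k, l.ι.app k ≫ q = β k) : Nonempty (IsColimit l) := by
  refine ha l α p (by ext k; exact (hp k).symm) (fun k k' t => ?_) fun k => ?_
  · exact isPullback_of_factor (h k).flip (h k').flip (a.w_assoc t f) (hβ t) (α.naturality t)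
  · exact isPullback_of_factor (h k).flip sq.flip rfl (hq k) (hp k)

variable {g : b.pt ⟶ K}

/-- Universal colimits over a common object are computed by double colimits of pullbacks. -/
lemma isColimit_of_isPullback_prod [HasPullbacks E] (ha : IsUniversalColimit a)
    (hb : IsUniversalColimit b) {Q : J × J ⥤ E} {l : Cocone Q}
    {π : Q ⟶ CategoryTheory.Prod.fst J J ⋙ F}
    {ρ : Q ⟶ CategoryTheory.Prod.snd J J ⋙ G}
    (h : ∀ k i, IsPullback (π.app (k, i)) (ρ.app (k, i)) (a.ι.app k ≫ f) (b.ι.app i ≫ g))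
    {p : l.pt ⟶ a.pt} {q : l.pt ⟶ b.pt} (sq : IsPullback p q f g)
    (hp : ∀ k i, l.ι.app (k, i) ≫ p = π.app (k, i) ≫ a.ι.app k)
    (hq : ∀ k i, l.ι.app (k, i) ≫ q = ρ.app (k, i) ≫ b.ι.app i) : Nonempty (IsColimit l) := by
  -- The double colimit is computed one variable at a time: `R k` is the pullback of `F k` with the
  -- whole colimit of `G`, and universality of `a` makes `l.pt` the colimit of `R`.
  obtain ⟨R, α, β, hαβ⟩ : ∃ (R : J ⥤ E) (α : R ⟶ F) (β : R ⟶ (Functor.const J).obj b.pt),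
      IsPullback α β (a.ι ≫ (Functor.const J).map f) ((Functor.const J).map g) :=
    ⟨_, _, _, IsPullback.of_hasPullback _ _⟩
  have hR (k : J) : IsPullback (α.app k) (β.app k) (a.ι.app k ≫ f) g :=
    hαβ.map ((evaluation J E).obj k)
  have hβ {k k' : J} (t : k ⟶ k') : R.map t ≫ β.app k' = β.app k :=
    (β.naturality t).trans (Category.comp_id _)
  let cR : Cocone R :=
    { pt := l.pt
      ι := { app := fun k => sq.lift (α.app k ≫ a.ι.app k) (β.app k)
                ((Category.assoc _ _ _).trans (hR k).w)
             naturality := fun k k' t => by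
               apply sq.hom_ext <;> simp [hβ] } }
  have fac₁ (k : J) : cR.ι.app k ≫ p = α.app k ≫ a.ι.app k := sq.lift_fst _ _ _
  have fac₂ (k : J) : cR.ι.app k ≫ q = β.app k := sq.lift_snd _ _ _
  obtain ⟨hcR⟩ := isColimit_of_isPullback_left (l := cR) ha hR hβ sq fac₁ fac₂
  have natπ {k k' i i' : J} (t : k ⟶ k') (s : i ⟶ i') :
      Q.map (Prod.mkHom t s : (k, i) ⟶ (k', i')) ≫ π.app (k', i') = π.app (k, i) ≫ F.map t :=
    π.naturality (Prod.mkHom t s)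
  have natρ {k k' i i' : J} (t : k ⟶ k') (s : i ⟶ i') :
      Q.map (Prod.mkHom t s : (k, i) ⟶ (k', i')) ≫ ρ.app (k', i') = ρ.app (k, i) ≫ G.map s :=
    ρ.naturality (Prod.mkHom t s)
  let u (k i : J) : Q.obj (k, i) ⟶ R.obj k :=
    (hR k).lift (π.app (k, i)) (ρ.app (k, i) ≫ b.ι.app i)
      ((h k i).w.trans (Category.assoc _ _ _).symm)
  have u₁ (k i : J) : u k i ≫ α.app k = π.app (k, i) := (hR k).lift_fst _ _ _
  have u₂ (k i : J) : u k i ≫ β.app k = ρ.app (k, i) ≫ b.ι.app i := (hR k).lift_snd _ _ _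
  have step {k k' i i' : J} (t : k ⟶ k') (s : i ⟶ i') :
      Q.map (Prod.mkHom t s : (k, i) ⟶ (k', i')) ≫ u k' i' = u k i ≫ R.map t := by
    refine (hR k').hom_ext ?_ ?_
    · rw [Category.assoc, u₁, natπ, Category.assoc, α.naturality, reassoc_of% u₁]
    · rw [Category.assoc, u₂, reassoc_of% natρ t s, b.w, Category.assoc, hβ, u₂]
      rfl
  let cQ (k : J) : Cocone (Prod.sectR k J ⋙ Q) :=
    { pt := R.obj k
      ι := { app := u k
             naturality := fun i i' s => (step (𝟙 k) s).trans (by rw [R.map_id]; rfl) } }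
  -- For fixed `k`, universality of `b` makes `R k` the colimit of the row `Q (k, -)`.
  have hcQ (k : J) : Nonempty (IsColimit (cQ k)) := by
    let ρ' : Prod.sectR k J ⋙ Q ⟶ G :=
      { app := fun i => ρ.app (k, i)
        naturality := fun i i' s => natρ (𝟙 k) s }
    exact isColimit_of_isPullback_left (l := cQ k) hb (G := F.obj k) (α := ρ')
      (β := fun i => (π.app (k, i) : Q.obj (k, i) ⟶ F.obj k)) (fun i => (h k i).flip)
      (fun s => (natπ (𝟙 k) s).trans
        ((congrArg (π.app _ ≫ ·) (F.map_id k)).trans (Category.comp_id _)))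
      (hR k).flip (u₂ k) (u₁ k)
  have hcQ' := fun k => (hcQ k).some
  have fac (k i : J) : u k i ≫ cR.ι.app k = l.ι.app (k, i) := by
    refine sq.hom_ext ?_ ?_
    · rw [Category.assoc, fac₁, reassoc_of% u₁, hp]
    · rw [Category.assoc, fac₂, u₂, hq]
  have facQ (s : Cocone Q) (k i : J) :
      u k i ≫ (hcQ' k).desc (s.whisker (Prod.sectR k J)) = s.ι.app (k, i) :=
    (hcQ' k).fac _ i
  let cS (s : Cocone Q) : Cocone R :=
    { pt := s.pt
      ι := { app := fun k => (hcQ' k).desc (s.whisker (Prod.sectR k J))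
             naturality := fun k k' t => (hcQ' k).hom_ext fun i => by
               refine (Category.assoc _ _ _).symm.trans ?_
               refine (congrArg (· ≫ _) (step t (𝟙 i)).symm).trans ?_
               refine (Category.assoc _ _ _).trans ?_
               rw [facQ, s.w]
               exact ((congrArg (u k i ≫ ·) (Category.comp_id _)).trans (facQ s k i)).symm } }
  refine ⟨⟨fun s => hcR.desc (cS s), fun s ⟨k, i⟩ => ?_, fun s m hm => hcR.hom_ext fun k =>
    (hcQ' k).hom_ext fun i => ?_⟩⟩
  · rw [← fac, Category.assoc, hcR.fac]
    exact facQ s k i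
  · rw [hcR.fac]
    exact (Category.assoc _ _ _).symm.trans ((congrArg (· ≫ m) (fac k i)).trans
      ((hm _).trans (facQ s k i).symm))

/-- Universal filtered colimits commute with pullbacks over a fixed object. -/
lemma isColimit_of_isPullback [HasPullbacks E] [IsFiltered J] {P : J ⥤ E} {l : Cocone P}
    (ha : IsUniversalColimit a) (hb : IsUniversalColimit b) {p : P ⟶ F} {q : P ⟶ G}
    (h : ∀ k, IsPullback (p.app k) (q.app k) (a.ι.app k ≫ f) (b.ι.app k ≫ g))
    {p' : l.pt ⟶ a.pt} {q' : l.pt ⟶ b.pt} (sq : IsPullback p' q' f g)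
    (hp : ∀ k, l.ι.app k ≫ p' = p.app k ≫ a.ι.app k)
    (hq : ∀ k, l.ι.app k ≫ q' = q.app k ≫ b.ι.app k) : Nonempty (IsColimit l) := by
  let A : CategoryTheory.Prod.fst J J ⋙ F ⟶ (Functor.const (J × J)).obj K :=
    { app := fun k => a.ι.app k.1 ≫ f
      naturality := fun k k' t => (a.w_assoc t.1 f).trans (Category.comp_id _).symm }
  let B : CategoryTheory.Prod.snd J J ⋙ G ⟶ (Functor.const (J × J)).obj K :=
    { app := fun k => b.ι.app k.2 ≫ g
      naturality := fun k k' t => (b.w_assoc t.2 g).trans (Category.comp_id _).symm }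
  obtain ⟨Q, π, ρ, hQ⟩ : ∃ (Q : J × J ⥤ E) (π : Q ⟶ _) (ρ : Q ⟶ _), IsPullback π ρ A B :=
    ⟨_, _, _, IsPullback.of_hasPullback _ _⟩
  have hQ' (k i : J) :
      IsPullback (π.app (k, i)) (ρ.app (k, i)) (a.ι.app k ≫ f) (b.ι.app i ≫ g) :=
    hQ.map ((evaluation (J × J) E).obj (k, i))
  let lQ : Cocone Q :=
    { pt := l.pt
      ι := { app := fun k => sq.lift (π.app k ≫ a.ι.app k.1) (ρ.app k ≫ b.ι.app k.2)
                ((Category.assoc _ _ _).trans ((hQ' k.1 k.2).w.trans (Category.assoc _ _ _).symm))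
             naturality := fun k k' t => by
               refine sq.hom_ext ?_ ?_
               · simp
               · simp } }
  have fac₁ (k i : J) : lQ.ι.app (k, i) ≫ p' = π.app (k, i) ≫ a.ι.app k := sq.lift_fst _ _ _
  have fac₂ (k i : J) : lQ.ι.app (k, i) ≫ q' = ρ.app (k, i) ≫ b.ι.app i := sq.lift_snd _ _ _
  obtain ⟨hlQ⟩ := isColimit_of_isPullback_prod (l := lQ) ha hb hQ' sq fac₁ fac₂
  -- The diagonal of a filtered category is final, so the colimit over `J × J` may be computed on
  -- the pullbacks with equal indices.
  have hl := (Functor.Final.isColimitWhiskerEquiv (Functor.diag J) _).symm hlQ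
  let e : P ≅ Functor.diag J ⋙ Q :=
    NatIso.ofComponents (fun k => (h k).isoIsPullback _ _ (hQ' k k)) fun {k k'} t => by
      refine (hQ' k' k').hom_ext ?_ ?_
      · simp
      · simp
  refine ⟨((IsColimit.precomposeHomEquiv e _).symm hl).ofIsoColimit
    (Cocone.ext (Iso.refl _) fun k => ?_)⟩
  refine sq.hom_ext ?_ ?_
  · simp [e, hp, fac₁]
  · simp [e, hq, fac₂]

end UniversalColimits

/-! ### Filtered colimits of graphs on a fixed object -/

section FilteredColimits

variable {E : Type u} [Category.{v} E]

lemma hasFilteredColimits_span [HasFilteredColimitsOfSize.{w', w} E] (T : Monad E) (R S : E) :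
    HasFilteredColimitsOfSize.{w', w} (TSpan T R S) :=
  ⟨fun J _ _ =>
    have := HasFilteredColimitsOfSize.HasColimitsOfShape (C := E) J
    inferInstance⟩

lemma filteredColimitsStable_span [HasPullbacks E] [HasFilteredColimitsOfSize.{w', w} E]
    (hE : FilteredColimitsStable.{w', w} E) (T : Monad E) (R S : E) :
    FilteredColimitsStable.{w', w} (TSpan T R S) := fun {J} _ _ _ c hc =>
  have := HasFilteredColimitsOfSize.HasColimitsOfShape (C := E) J
  jointlyConservative_apexFunctor.isUniversalColimit c
    fun _ => hE _ _ (isColimitOfPreserves (apexFunctor T R S) hc)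

variable [IsSuitableCategory E] {T : Monad E}

/-- Since `S` is fixed, `X ∘ Aₙ` is a pullback over the constant object `T S`. Stability makes both
colimits involved universal, so they commute with that pullback. -/
lemma preservesFilteredColimits_freeOn [HasFilteredColimitsOfSize.{w', w} E]
    (hE : FilteredColimitsStable.{w', w} E) [PreservesFilteredColimitsOfSize.{w', w} T.toFunctor]
    (hT : IsSuitableMonad T) (S : E) :
    PreservesFilteredColimitsOfSize.{w', w} (freeOnAdjunction hT S).toMonad.toFunctor := by
  refine ⟨fun J _ _ => ⟨fun {D} => ?_⟩⟩
  have := HasFilteredColimitsOfSize.HasColimitsOfShape (C := E) J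
  have := PreservesFilteredColimitsOfSize.preserves_filtered_colimits (F := T.toFunctor) J
  have := IsFiltered.isConnected J
  have := hT.preserves_pullbacks
  refine preservesColimit_freeOn hT fun c hc =>
    isColimit_freeArr hT _ (isColimit_graph_obj c) fun n ⟨hn⟩ => ?_
  have sq (X : TGraphOn T S) := isPullback_comp X.graph.span (approx X.graph (unit T S) n)
  have hf (k : J) : T.map (approxMap (TSpan.Hom.graph (c.ι.app k)) (unitOver (𝟙 S)) n).hom ≫
      T.map (approx c.pt.graph (unit T S) n).cod =
        T.map (approx (D.obj k).graph (unit T S) n).cod :=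
    (T.map_comp _ _).symm.trans (congrArg T.map
      ((approxMap (TSpan.Hom.graph (c.ι.app k)) (unitOver (𝟙 S)) n).w_cod.trans
        (Category.comp_id _)))
  -- The stagewise legs to `T S` equal the legs of the colimit restricted along coprojections; this
  -- restates the defining pullback in the latter form.
  have of_eq {W A B C : E} {p : W ⟶ A} {q : W ⟶ B} {f f' : A ⟶ C} {g g' : B ⟶ C}
      (h : IsPullback p q f g) (hf : f' = f) (hg : g' = g) : IsPullback p q f' g' :=
    hf ▸ hg ▸ h
  exact isColimit_of_isPullback
    (l := (approxCompFunctor T n).mapCocone ((graphFunctor T S).mapCocone c))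
    (a := T.toFunctor.mapCocone ((approxFunctor T n).mapCocone ((graphFunctor T S).mapCocone c)))
    (b := (apexFunctor T S S).mapCocone c)
    (f := T.map (approx c.pt.graph (unit T S) n).cod) (g := c.pt.dom)
    (p := { app := fun k => fst (D.obj k).graph.span (approx (D.obj k).graph (unit T S) n)
            naturality := fun _ _ _ => cmp_fst _ _ })
    (q := { app := fun k => snd (D.obj k).graph.span (approx (D.obj k).graph (unit T S) n)
            naturality := fun _ _ _ => cmp_snd _ _ })
    (hE _ _ (isColimitOfPreserves T.toFunctor hn)) (hE _ _ hc)
    (fun k => of_eq (sq (D.obj k)) (hf k) (c.ι.app k).w_dom) (sq c.pt)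
    (fun k => cmp_fst _ _) (fun k => cmp_snd _ _)

end FilteredColimits

theorem mainTheorem6 :
    (∀ {E : Type u} [Category.{v} E] [IsSuitableCategory E] (T : Monad E), IsSuitableMonad T →
      (∃ (F : TGraph T ⥤ TMulticat T) (adj : F ⊣ TMulticat.forget T),
        (Monad.comparison adj).IsEquivalence ∧
        IsSuitableCategory (TGraph T) ∧ IsSuitableMonad adj.toMonad) ∧
      ∀ S : E, ∃ (F : TGraphOn T S ⥤ TMulticatOn T S) (adj : F ⊣ TMulticatOn.forget T S),
        (Monad.comparison adj).IsEquivalence ∧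
        IsSuitableCategory (TGraphOn T S) ∧ IsSuitableMonad adj.toMonad ∧
        (HasFilteredColimitsOfSize.{w', w} E →
          PreservesFilteredColimitsOfSize.{w', w} T.toFunctor →
          HasFilteredColimitsOfSize.{w', w} (TGraphOn T S) ∧
          (FilteredColimitsStable.{w', w, v, u} E →
            FilteredColimitsStable.{w', w, v, max u v} (TGraphOn T S) ∧
            PreservesFilteredColimitsOfSize.{w', w} adj.toMonad.toFunctor))) ∧
    (∀ {J : Type w} [Category.{w} J] {E : Type u} [Category.{v} E] (_ : E ≌ (J ⥤ Type w))
      (T : Monad E), IsCartesianMonad T →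
      PreservesFilteredColimitsOfSize.{w, w} T.toFunctor →
      IsSuitableCategory E ∧ IsSuitableMonad T) := by
  refine ⟨fun {E} _ _ T hT => have := hT.preserves_pullbacks;
    ⟨⟨freeFunctor hT, freeAdjunction hT, isEquivalence_comparison hT,
    inferInstance, isSuitableMonad_free hT⟩, fun S => ⟨freeOnFunctor hT S, freeOnAdjunction hT S,
    isEquivalence_comparisonOn hT S, inferInstance, isSuitableMonad_freeOn hT S, fun _ _ =>
    ⟨hasFilteredColimits_span T S S, fun hE => ⟨filteredColimitsStable_span hE T S S,
      preservesFilteredColimits_freeOn hE hT S⟩⟩⟩⟩, fun e T hT _ => ⟨?_, ?_⟩⟩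
  · exact isSuitableCategory_of_equivalence e
  · exact isSuitableMonad_of_finitary T hT
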